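/- Let $\Omega\subset\mathbb{R}^2\cong\mathbb{C}$ be a bounded, simply connected domain with smooth boundary and $0\in\Omega$, let $\theta$ denote the polar angle about the origin, and let $\varphi_\star:\partial\Omega\to\mathbb{R}$ be (single-valued and) of class $C^2$. For $n\ge 1$ and distinct points $a=(a_1,\dots,a_n)$ of $\Omega$, let $u_\star$ be the canonical harmonic map with vortices of degree one at the $a_j$ and Dirichlet datum $e^{in\theta+i\varphi_\star}$, that is, $$u_\star(x)=\prod_{j=1}^n\frac{x-a_j}{|x-a_j|}\,e^{i\psi_\star(x)},\qquad \Delta\psi_\star=0\ \text{in }\Omega,\qquad u_\star=e^{in\theta+i\varphi_\star}\ \text{on }\partial\Omega,$$ with $\psi_\star$ real-valued, in $H^1(\Omega)$ and continuous on $\overline\Omega$. Let $$W(a)=\lim_{r\to0^+}\Big(\int_{\Omega\setminus\bigcup_j B_r(a_j)}\tfrac12|\nabla u_\star|^2\,dx-\pi n\log\tfrac1r\Big)$$ be the renormalized energy for the Dirichlet problem (the integrals are finite and the limit exists), and let $$\rho_a=\tfrac14\min\Big\{\min_{j\ne k}|a_j-a_k|,\ \min_j\operatorname{dist}(a_j,\partial\Omega)\Big\}.$$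 Then there is a constant $C$ depending only on $\Omega$ and $\varphi_\star$ (not on $n$ or $a$) such that for all $n\ge1$ and all such $a$, $$\rho_a\ \ge\ e^{-W(a)-Cn^2}.$$ -/

import Mathlib

open Filter Topology MeasureTheory
open scoped ContDiff

noncomputable section

/-- A bounded, simply connected planar domain with `C^∞` boundary: near each of its boundary
points the domain is the negativity set of a smooth function with nonvanishing gradient there.
The plane `ℝ²` is identified with `ℂ`. -/
structure IsSmoothSimplyConnectedDomain (Ω : Set ℂ) : Prop where
  isOpen : IsOpen Ω
  isBounded : Bornology.IsBounded Ω
  simplyConnected : SimplyConnectedSpace Ω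
  smoothBoundary : ∀ p ∈ frontier Ω, ∃ U ∈ 𝓝 p, ∃ g : ℂ → ℝ,
    ContDiff ℝ ∞ g ∧ fderiv ℝ g p ≠ 0 ∧ Ω ∩ U = {x ∈ U | g x < 0}

/-- `φ` is a (single-valued) function of class `C²` on the boundary curve of `Ω`, that is, it
agrees there with a `C²` function on the plane. -/
def IsC2OnBoundary (Ω : Set ℂ) (φ : ℂ → ℝ) : Prop :=
  ∃ Φ : ℂ → ℝ, ContDiff ℝ 2 Φ ∧ Set.EqOn φ Φ (frontier Ω)

/-- Configurations of `n` distinct points of `Ω`. -/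
def IsConfiguration (Ω : Set ℂ) {n : ℕ} (a : Fin n → ℂ) : Prop :=
  Function.Injective a ∧ ∀ j, a j ∈ Ω

/-- `ρ_a`, a quarter of the least of the distances `|a_j - a_k|` (`j ≠ k`) and
`dist (a_j, ∂Ω)`. -/
def vortexSeparation (Ω : Set ℂ) {n : ℕ} (a : Fin n → ℂ) : ℝ :=
  (1 / 4) * sInf ({r | ∃ j k, j ≠ k ∧ r = dist (a j) (a k)} ∪
    {r | ∃ j, r = Metric.infDist (a j) (frontier Ω)})

/-- The squared Euclidean norm `|∂₁f|² + |∂₂f|²` of the gradient of a function on the plane. -/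
def gradSq {E : Type*} [NormedAddCommGroup E] [NormedSpace ℝ E] (f : ℂ → E) (x : ℂ) : ℝ :=
  ‖fderiv ℝ f x 1‖ ^ 2 + ‖fderiv ℝ f x Complex.I‖ ^ 2

/-- The Dirichlet datum `exp (i n θ + i φ)`, where `θ` is the polar angle about the origin. -/
def boundaryDatum (n : ℕ) (φ : ℂ → ℝ) (x : ℂ) : ℂ :=
  (x / (‖x‖ : ℂ)) ^ n * Complex.exp (Complex.I * (φ x : ℂ))

/-- `u` is the canonical harmonic map on `Ω` with vortices of degree one at `a_1, …, a_n` and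
Dirichlet datum `exp (i n θ + i φ)`: it has the form `∏ (x - a_j) / |x - a_j| · exp (i ψ)` with `ψ`
harmonic, continuous up to the boundary and in `H¹ (Ω)`, and takes the datum on `∂Ω`. -/
def IsCanonicalHarmonicMap (Ω : Set ℂ) (φ : ℂ → ℝ) {n : ℕ} (a : Fin n → ℂ) (u : ℂ → ℂ) : Prop :=
  ∃ ψ : ℂ → ℝ,
    InnerProductSpace.HarmonicOnNhd ψ Ω ∧
    ContinuousOn ψ (closure Ω) ∧
    IntegrableOn (gradSq ψ) Ω ∧
    (∀ x ∈ closure Ω \ Set.range a,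
      u x = (∏ j, (x - a j) / (‖x - a j‖ : ℂ)) * Complex.exp (Complex.I * (ψ x : ℂ))) ∧
    ∀ x ∈ frontier Ω, u x = boundaryDatum n φ x

/-- `Ω_r(a)`, the domain with the discs of radius `r` about the vortices removed. -/
def perforated (Ω : Set ℂ) {n : ℕ} (a : Fin n → ℂ) (r : ℝ) : Set ℂ :=
  Ω \ ⋃ j, Metric.ball (a j) r

/-- `W` is the renormalized energy
`lim_{r → 0} (∫_{Ω_r(a)} ½ |∇u|² - π n log (1 / r))` of the canonical harmonic map `u` with vortices
`a`, the integral being finite for every `r > 0`. -/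
def IsRenormalizedEnergy (Ω : Set ℂ) {n : ℕ} (a : Fin n → ℂ) (u : ℂ → ℂ) (W : ℝ) : Prop :=
  (∀ r > 0, IntegrableOn (gradSq u) (perforated Ω a r)) ∧
  Tendsto (fun r : ℝ => (∫ x in perforated Ω a r, (1 / 2) * gradSq u x)
    - Real.pi * n * Real.log (1 / r)) (𝓝[>] 0) (𝓝 W)

end

/-!
# Separation of the vortices of a canonical harmonic map

Write `E = ∑ ∇ log |x - a_j|` and `i` for the rotation by a right angle. Off the vortices the density of
the energy of `u` is `|i E + ∇ψ|² / 2`, and `|E|² / 2` produces the divergence `π n log (1 / r)`. Hence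
`W` is the sum of the regular part of the energy of `E`, of `∫ ⟪i E, ∇ψ⟫` and of `∫ |∇ψ|² / 2`
(`isRenormalizedEnergy_of_phase`). The lower bound comes from discarding the last term by duality: for
every test potential `h`,
`∫ |∇ψ|² / 2 ≥ ∫ ⟪i ∇h, ∇ψ⟫ - ∫ |∇h|² / 2`, integrals over `Ω`.

What is left is linear in `∇ψ`, and can be moved to the complement of `Ω`. Since `0` and the `a_j` lie in
the connected set `Ω`, the function `(x - a_j) / x` has a logarithm near the complement, so that the
Dirichlet datum extends there as `∏ (x - a_j) / |x - a_j| · exp (i g)` with a single-valued phase `g` and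
`∇g = -i E + O(n)` (`exists_exterior_phase`). The phases `ψ` and `g` agree modulo `2π` on `∂Ω`, and no
curl is created there:
`∫_Ω ⟪i ∇ξ, ∇ψ⟫ + ∫_{Ωᶜ} ⟪i ∇ξ, ∇g⟫ = 0` for test functions `ξ` (`setIntegral_jac_add_compl_eq_zero`). This
needs neither a trace theorem nor regularity of the boundary: near `∂Ω` the function `ψ - g` is reduced
to a small real function that vanishes on the boundary, and is truncated near its zeros.
With `ξ` a cut-off of `∑ log |x - a_j| + h`, and with the energy of `E` in `Ω` computed by integrating
along rays from the vortices, all divergences cancel, and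
`W ≥ -π ∑_{j ≠ k} log |a_j - a_k| + ∫_{Ωᶜ} (|E|² / 2 + ⟪∇h, E⟫) - ∫_Ω |∇h|² / 2 - C n²`
up to a cutoff at a large distance (`exists_le_renormalizedEnergy`).

The choice `h = 0` bounds the distance of two vortices from below. For the distance `d` of `a_j` to the
boundary, let `p` be the nearest boundary point and `h = log (|x - p|² + d²) / 2`. The smooth boundary
leaves an exterior sector at `p` that is nearly a half disc, of a radius independent of `p`
(`exists_exterior_cone`). On each ray of the sector an integration by parts shows that
`⟪∇h, E⟫` gains `K = log (1 / d) + O(1)` from `a_j` and loses at most a constant to each other vortex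
(`coreEnergy_sub_le_integral_ray`), while off the sector `|E|² / 2 + ⟪∇h, E⟫` is at least `-|∇h|² / 2`, whose
integral along a ray is `-K / 2`. As the half-angle of the sector exceeds `π / 3` by enough, the balance is
at least `K - C n`, so that `log (1 / d) ≤ W + C n²`.
-/

/-! ### Planar gradients -/

/-- The gradient of a real function on the plane, as a complex number. -/
noncomputable def planeGrad (f : ℂ → ℝ) (x : ℂ) : ℂ :=
  ⟨fderiv ℝ f x 1, fderiv ℝ f x Complex.I⟩

lemma real_inner_eq (z w : ℂ) : inner ℝ z w = z.re * w.re + z.im * w.im := by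
  simp [Complex.inner]; ring

lemma inner_planeGrad (f : ℂ → ℝ) (x v : ℂ) : inner ℝ (planeGrad f x) v = fderiv ℝ f x v := by
  have hv : v = v.re • (1 : ℂ) + v.im • Complex.I := by simp
  conv_rhs => rw [hv, map_add, map_smul, map_smul]
  simp [planeGrad]

lemma planeGrad_eq_of_hasFDerivAt {f : ℂ → ℝ} {L : ℂ →L[ℝ] ℝ} {x G : ℂ}
    (h : HasFDerivAt f L x) (hL : ∀ v, L v = inner ℝ G v) : planeGrad f x = G := by
  apply Complex.ext <;> simp [planeGrad, h.fderiv, hL]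

lemma gradSq_eq_norm_planeGrad_sq (f : ℂ → ℝ) (x : ℂ) : gradSq f x = ‖planeGrad f x‖ ^ 2 := by
  rw [← Complex.normSq_eq_norm_sq, Complex.normSq_apply]
  simp [gradSq, planeGrad]; ring

lemma planeGrad_congr {f g : ℂ → ℝ} {x : ℂ} (h : f =ᶠ[𝓝 x] g) : planeGrad f x = planeGrad g x := by
  simp [planeGrad, h.fderiv_eq]

lemma planeGrad_add {f g : ℂ → ℝ} {x : ℂ} (hf : DifferentiableAt ℝ f x)
    (hg : DifferentiableAt ℝ g x) :
    planeGrad (fun y => f y + g y) x = planeGrad f x + planeGrad g x := by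
  apply Complex.ext <;> simp [planeGrad, fderiv_fun_add hf hg]

lemma planeGrad_sub {f g : ℂ → ℝ} {x : ℂ} (hf : DifferentiableAt ℝ f x)
    (hg : DifferentiableAt ℝ g x) :
    planeGrad (fun y => f y - g y) x = planeGrad f x - planeGrad g x := by
  apply Complex.ext <;> simp [planeGrad, fderiv_fun_sub hf hg]

lemma planeGrad_mul {f g : ℂ → ℝ} {x : ℂ} (hf : DifferentiableAt ℝ f x)
    (hg : DifferentiableAt ℝ g x) :
    planeGrad (fun y => f y * g y) x = (f x : ℂ) * planeGrad g x + (g x : ℂ) * planeGrad f x := by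
  apply Complex.ext <;> simp [planeGrad, fderiv_fun_mul hf hg]

lemma planeGrad_sum {ι : Type*} (s : Finset ι) {f : ι → ℂ → ℝ} {x : ℂ}
    (hf : ∀ i ∈ s, DifferentiableAt ℝ (f i) x) :
    planeGrad (fun y => ∑ i ∈ s, f i y) x = ∑ i ∈ s, planeGrad (f i) x := by
  apply Complex.ext <;> simp [planeGrad, fderiv_fun_sum hf]

lemma continuousOn_planeGrad {f : ℂ → ℝ} {U : Set ℂ} (hU : IsOpen U) (hf : ContDiffOn ℝ 1 f U) :
    ContinuousOn (planeGrad f) U := by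
  have h := hf.continuousOn_fderiv_of_isOpen hU le_rfl
  have e : planeGrad f = fun x => ((fderiv ℝ f x 1 : ℝ) : ℂ) +
      ((fderiv ℝ f x Complex.I : ℝ) : ℂ) * Complex.I := by
    funext x; apply Complex.ext <;> simp [planeGrad]
  rw [e]
  exact (Complex.continuous_ofReal.comp_continuousOn (h.clm_apply continuousOn_const)).add
    ((Complex.continuous_ofReal.comp_continuousOn (h.clm_apply continuousOn_const)).mul
      continuousOn_const)

lemma continuous_planeGrad {f : ℂ → ℝ} (hf : ContDiff ℝ 1 f) : Continuous (planeGrad f) := by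
  rw [← continuousOn_univ]
  exact continuousOn_planeGrad isOpen_univ hf.contDiffOn

lemma planeGrad_eq_zero_of_notMem_tsupport {f : ℂ → ℝ} {x : ℂ} (hx : x ∉ tsupport f) :
    planeGrad f x = 0 := by
  rw [planeGrad_congr (notMem_tsupport_iff_eventuallyEq.1 hx)]
  simp [planeGrad]; rfl

/-! ### Jacobian integrals -/

/-- The Jacobian determinant `∂₁f ∂₂g - ∂₂f ∂₁g = ⟪i ∇f, ∇g⟫` of two real functions. -/
noncomputable def jac (f g : ℂ → ℝ) (x : ℂ) : ℝ := inner ℝ (Complex.I * planeGrad f x) (planeGrad g x)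

lemma jac_eq (f g : ℂ → ℝ) (x : ℂ) : jac f g x =
    fderiv ℝ f x 1 * fderiv ℝ g x Complex.I - fderiv ℝ f x Complex.I * fderiv ℝ g x 1 := by
  simp [jac, planeGrad]; ring

lemma abs_jac_le (f g : ℂ → ℝ) (x : ℂ) : |jac f g x| ≤ ‖planeGrad f x‖ * ‖planeGrad g x‖ := by
  simpa [jac] using abs_real_inner_le_norm (Complex.I * planeGrad f x) (planeGrad g x)

lemma integral_fderiv_apply_eq_zero {F : ℂ → ℝ} (hF : ContDiff ℝ 1 F) (hc : HasCompactSupport F)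
    (v : ℂ) : ∫ x, fderiv ℝ F x v = 0 := by
  have hi : Integrable (fun x => fderiv ℝ F x v) :=
    ((hF.continuous_fderiv one_ne_zero).clm_apply continuous_const).integrable_of_hasCompactSupport
      (hc.fderiv_apply ℝ v)
  have := integral_mul_fderiv_eq_neg_fderiv_mul_of_integrable (μ := (volume : Measure ℂ))
    (f := fun _ => (1 : ℝ)) (g := F) (v := v) (by simp) (by simpa using hi)
    (by simpa using hF.continuous.integrable_of_hasCompactSupport hc)
    (fun x _ => differentiableAt_const _) (fun x _ => hF.differentiable one_ne_zero x)
  simpa using this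

/-- The Jacobian determinant is the divergence of `f (∂₂g, -∂₁g)`, so its integral vanishes when this
field has compact support. -/
lemma setIntegral_jac_eq_zero {U K : Set ℂ} (hU : IsOpen U) (hK : IsCompact K) (hKU : K ⊆ U)
    {f g : ℂ → ℝ} (hf : ContDiffOn ℝ 1 f U) (hg : ContDiffOn ℝ 2 g U)
    (h0 : ∀ x ∈ U \ K, f x = 0 ∨ fderiv ℝ g x = 0) : ∫ x in U, jac f g x = 0 := by
  classical
  have hg' : ContDiffOn ℝ 1 (fderiv ℝ g) U := hg.fderiv_of_isOpen hU (by norm_num)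
  -- `F v` is `f ∂ᵥg` extended by zero; the symmetry of the second derivative of `g` leaves only the
  -- terms with `∇f` in the divergence
  set F : ℂ → ℂ → ℝ := fun v => U.indicator (fun x => f x * fderiv ℝ g x v)
  have hFK : ∀ v, ∀ x ∉ K, F v x = 0 := by
    intro v x hx
    by_cases hxU : x ∈ U
    · rcases h0 x ⟨hxU, hx⟩ with h | h <;> simp [F, hxU, h]
    · simp [F, hxU]
  have hFz : ∀ v, ∀ x ∉ K, F v =ᶠ[𝓝 x] fun _ => 0 := fun v x hx => by
    filter_upwards [hK.isClosed.isOpen_compl.mem_nhds hx] with y hy using hFK v y hy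
  have hFU : ∀ v, ∀ x ∈ U, F v =ᶠ[𝓝 x] fun y => f y * fderiv ℝ g y v := fun v x hx => by
    filter_upwards [hU.mem_nhds hx] with y hy using by simp [F, hy]
  have hFC : ∀ v, ContDiff ℝ 1 (F v) := by
    intro v
    rw [contDiff_iff_contDiffAt]
    intro x
    by_cases hx : x ∈ K
    · have hxU := hU.mem_nhds (hKU hx)
      exact ((hf.contDiffAt hxU).mul ((hg'.contDiffAt hxU).clm_apply contDiffAt_const)).congr_of_eventuallyEq
        (hFU v x (hKU hx))
    · exact contDiffAt_const.congr_of_eventuallyEq (hFz v x hx)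
  have hFs : ∀ v, HasCompactSupport (F v) := fun v => HasCompactSupport.intro hK (hFK v)
  have key : ∀ x ∈ U, jac f g x = fderiv ℝ (F Complex.I) x 1 - fderiv ℝ (F 1) x Complex.I := by
    intro x hx
    have hxU := hU.mem_nhds hx
    have hfd : DifferentiableAt ℝ f x := (hf.contDiffAt hxU).differentiableAt one_ne_zero
    have hgd : DifferentiableAt ℝ (fderiv ℝ g) x := (hg'.contDiffAt hxU).differentiableAt one_ne_zero
    have hsymm : IsSymmSndFDerivAt ℝ g x :=
      (hg.contDiffAt hxU).isSymmSndFDerivAt (by simp)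
    have hF : ∀ v w, fderiv ℝ (F v) x w =
        f x * fderiv ℝ (fderiv ℝ g) x w v + fderiv ℝ g x v * fderiv ℝ f x w := by
      intro v w
      have h1 := hfd.hasFDerivAt.fun_mul (hgd.hasFDerivAt.clm_apply (hasFDerivAt_const v x))
      rw [(hFU v x hx).fderiv_eq, HasFDerivAt.fderiv h1]
      simp
    rw [jac_eq, hF, hF, hsymm.eq 1 Complex.I]
    ring
  rw [setIntegral_congr_fun hU.measurableSet key]
  have hi : ∀ v w, Integrable (fun x => fderiv ℝ (F v) x w) := fun v w =>
    (((hFC v).continuous_fderiv one_ne_zero).clm_apply continuous_const).integrable_of_hasCompactSupport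
      ((hFs v).fderiv_apply ℝ w)
  have hall : ∫ x in U, (fderiv ℝ (F Complex.I) x 1 - fderiv ℝ (F 1) x Complex.I) =
      ∫ x, (fderiv ℝ (F Complex.I) x 1 - fderiv ℝ (F 1) x Complex.I) := by
    apply setIntegral_eq_integral_of_forall_compl_eq_zero
    intro x hx
    have hxK : x ∉ K := fun h => hx (hKU h)
    simp [(hFz _ x hxK).fderiv_eq]
  rw [hall, integral_sub (hi _ _) (hi _ _), integral_fderiv_apply_eq_zero (hFC _) (hFs _),
    integral_fderiv_apply_eq_zero (hFC _) (hFs _), sub_zero]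

/-- At almost every zero of a differentiable function the gradient vanishes. -/
lemma ae_planeGrad_eq_zero_of_eq_zero {U : Set ℂ} (hU : IsOpen U) {η : ℂ → ℝ}
    (hη : DifferentiableOn ℝ η U) :
    ∀ᵐ x ∂(volume.restrict U), η x = 0 → planeGrad η x = 0 := by
  -- on the zero set `η` is approximated by the zero map with constant `0`, which determines the
  -- derivative at almost every point of the set
  set s : Set ℂ := U ∩ {x | η x = 0}
  have hs : MeasurableSet s := by
    have h1 := (hη.continuousOn.isOpen_inter_preimage hU
      (isClosed_singleton (x := (0 : ℝ))).isOpen_compl).measurableSet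
    convert hU.measurableSet.diff h1 using 1
    ext x; simp [s]
  have hd : ∀ x ∈ s, HasFDerivWithinAt (fun y => (η y : ℂ))
      (Complex.ofRealCLM.comp (fderiv ℝ η x)) s x := fun x hx =>
    (Complex.ofRealCLM.hasFDerivAt.comp x
      (hη.differentiableAt (hU.mem_nhds hx.1)).hasFDerivAt).hasFDerivWithinAt
  have ha : ApproximatesLinearOn (fun y => (η y : ℂ)) (0 : ℂ →L[ℝ] ℂ) s 0 := by
    intro x hx y hy
    have h1 : η x = 0 := hx.2
    have h2 : η y = 0 := hy.2
    simp [h1, h2]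
  have := ha.norm_fderiv_sub_le volume hs _ hd
  rw [ae_restrict_iff' hs] at this
  rw [ae_restrict_iff' hU.measurableSet]
  filter_upwards [this] with x hx hxU h0
  have h1 : Complex.ofRealCLM.comp (fderiv ℝ η x) = 0 := by
    have := hx ⟨hxU, h0⟩
    simpa using this
  have h2 : ∀ v, fderiv ℝ η x v = 0 := fun v => by
    have := DFunLike.congr_fun h1 v
    simpa using this
  simp [planeGrad, h2]; rfl

/-! ### The phase across the boundary -/

/-- A smooth function on the line that vanishes on `[-1, 1]`, has slope one outside `[-2, 2]`, and has
bounded slope. -/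
lemma exists_contDiff_truncation : ∃ B : ℝ → ℝ, ContDiff ℝ 2 B ∧ (∀ t, |t| ≤ 1 → B t = 0) ∧
    (∀ t, 2 < |t| → deriv B t = 1) ∧ ∃ C, ∀ t, |deriv B t| ≤ C := by
  let b : ContDiffBump (0 : ℝ) := ⟨1, 2, by norm_num, by norm_num⟩
  have hB : ContDiff ℝ 2 (fun t : ℝ => t * (1 - b t)) :=
    contDiff_id.mul (contDiff_const.sub b.contDiff)
  have h1 : ∀ t : ℝ, 2 < |t| → deriv (fun t : ℝ => t * (1 - b t)) t = 1 := by
    intro t ht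
    have : (fun t : ℝ => t * (1 - b t)) =ᶠ[𝓝 t] id := by
      filter_upwards [(isOpen_lt continuous_const continuous_abs).mem_nhds ht] with y hy
      have : b y = 0 := b.zero_of_le_dist (by simpa [Real.dist_eq] using hy.le)
      simp [this]
    rw [this.deriv_eq]; simp
  refine ⟨_, hB, fun t ht => ?_, h1, ?_⟩
  · have : b t = 1 := b.one_of_mem_closedBall (by simpa [Real.dist_eq] using ht)
    simp [this]
  · obtain ⟨C, hC⟩ := (isCompact_Icc (a := (-2 : ℝ)) (b := 2)).exists_bound_of_continuousOn
      (hB.continuous_deriv (by norm_num)).continuousOn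
    refine ⟨max C 1, fun t => ?_⟩
    by_cases ht : |t| ≤ 2
    · exact (hC t (abs_le.1 ht)).trans (le_max_left _ _)
    · rw [h1 t (not_le.1 ht)]; simp

/-- If `η` vanishes on the boundary then `∇η` is `L²`-orthogonal to the rotated gradient `i ∇f`:
apply `setIntegral_jac_eq_zero` to truncations of `η` that vanish near the boundary. -/
lemma setIntegral_jac_eq_zero_of_tendsto {Ω A : Set ℂ} (hΩ : IsOpen Ω) (hA : IsClosed A)
    {f η : ℂ → ℝ} (hf : ContDiff ℝ 1 f) (hfc : HasCompactSupport f) (hfA : Disjoint (tsupport f) A)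
    (hη : ContDiffOn ℝ 2 η (Ω \ A))
    (hη0 : ∀ x ∈ frontier Ω, x ∉ A → Tendsto η (𝓝[Ω \ A] x) (𝓝 0))
    (hint : IntegrableOn (jac f η) (Ω \ A)) : ∫ x in Ω \ A, jac f η x = 0 := by
  obtain ⟨B, hB, hB0, hB1, C, hC⟩ := exists_contDiff_truncation
  have hO : IsOpen (Ω \ A) := hΩ.sdiff hA
  -- `T n` vanishes for `|y| ≤ 1 / (n + 1)`, its slope is bounded and tends to one for `y ≠ 0`
  set T : ℕ → ℝ → ℝ := fun n y => ((n : ℝ) + 1)⁻¹ * B (((n : ℝ) + 1) * y)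
  have hnpos : ∀ n : ℕ, (0 : ℝ) < (n : ℝ) + 1 := fun n => by positivity
  have hTd : ∀ n y, HasDerivAt (T n) (deriv B (((n : ℝ) + 1) * y)) y := by
    intro n y
    have h1 : HasDerivAt B (deriv B (((n : ℝ) + 1) * y)) (((n : ℝ) + 1) * y) :=
      (hB.differentiable (by norm_num) _).hasDerivAt
    have h2 : HasDerivAt (fun y : ℝ => ((n : ℝ) + 1) * y) ((n : ℝ) + 1) y := by
      simpa using (hasDerivAt_id y).const_mul ((n : ℝ) + 1)
    have h3 := (h1.comp y h2).const_mul ((n : ℝ) + 1)⁻¹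
    refine h3.congr_deriv ?_
    field_simp [(hnpos n).ne']
  have hηd : ∀ x ∈ Ω \ A, DifferentiableAt ℝ η x := fun x hx =>
    (hη.contDiffAt (hO.mem_nhds hx)).differentiableAt (by norm_num)
  have hjac : ∀ n, ∀ x ∈ Ω \ A, jac f (fun y => T n (η y)) x =
      deriv B (((n : ℝ) + 1) * η x) * jac f η x := by
    intro n x hx
    have h := ((hTd n (η x)).comp_hasFDerivAt x (hηd x hx).hasFDerivAt)
    have h' : fderiv ℝ (fun y => T n (η y)) x = deriv B (((n : ℝ) + 1) * η x) • fderiv ℝ η x :=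
      h.fderiv
    rw [jac_eq, jac_eq, h']
    simp; ring
  have hzero : ∀ n : ℕ, ∫ x in Ω \ A, deriv B (((n : ℝ) + 1) * η x) * jac f η x = 0 := by
    intro n
    rw [← setIntegral_congr_fun hO.measurableSet (hjac n)]
    set K : Set ℂ := {x | x ∈ tsupport f ∧ x ∈ Ω \ A ∧ ((n : ℝ) + 1)⁻¹ ≤ |η x|}
    have hKO : K ⊆ Ω \ A := fun x hx => hx.2.1
    -- limit points on the boundary are excluded, since `η` is small near them
    have hKc : IsClosed K := by
      rw [← closure_subset_iff_isClosed]
      intro x hx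
      have hxf : x ∈ tsupport f :=
        (isClosed_tsupport f).closure_subset_iff.2 (fun y hy => hy.1) hx
      have hxA : x ∉ A := Set.disjoint_left.1 hfA hxf
      have hxΩ : x ∈ closure Ω := closure_mono (fun y hy => (hKO hy).1) hx
      rw [mem_closure_iff_frequently] at hx
      by_cases hxo : x ∈ Ω
      · refine ⟨hxf, ⟨hxo, hxA⟩, ?_⟩
        by_contra hlt
        push Not at hlt
        have hc : ContinuousAt (fun y => |η y|) x := (hηd x ⟨hxo, hxA⟩).continuousAt.abs
        obtain ⟨y, hy, hy'⟩ := (hx.and_eventually (hc.eventually_lt continuousAt_const hlt)).exists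
        exact absurd hy.2.2 (not_le.2 hy')
      · have hfr : x ∈ frontier Ω := by rw [hΩ.frontier_eq]; exact ⟨hxΩ, hxo⟩
        have h1 := (hη0 x hfr hxA).abs
        rw [abs_zero] at h1
        have h2 := h1.eventually (gt_mem_nhds (inv_pos.2 (hnpos n)))
        rw [eventually_nhdsWithin_iff] at h2
        obtain ⟨y, hy, hy'⟩ := (hx.and_eventually h2).exists
        exact absurd hy.2.2 (not_le.2 (hy' hy.2.1))
    have hK : IsCompact K := hfc.isCompact.of_isClosed_subset hKc (fun x hx => hx.1)
    refine setIntegral_jac_eq_zero hO hK hKO hf.contDiffOn ?_ ?_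
    · have hTc : ContDiff ℝ 2 (T n) := contDiff_const.mul (hB.comp (contDiff_const.mul contDiff_id))
      exact hTc.comp_contDiffOn hη
    · rintro x ⟨hx, hxK⟩
      by_cases hxf : x ∈ tsupport f
      · right
        have hlt : |η x| < ((n : ℝ) + 1)⁻¹ := by
          by_contra h
          exact hxK ⟨hxf, hx, not_lt.1 h⟩
        have hc : ContinuousAt (fun y => |η y|) x := (hηd x hx).continuousAt.abs
        have : (fun y => T n (η y)) =ᶠ[𝓝 x] fun _ => 0 := by
          filter_upwards [hc.eventually_lt continuousAt_const hlt] with y hy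
          have : B (((n : ℝ) + 1) * η y) = 0 := by
            apply hB0
            rw [abs_mul, abs_of_pos (hnpos n), ← le_inv_mul_iff₀ (hnpos n), mul_one]
            exact hy.le
          simp [T, this]
        rw [this.fderiv_eq]; simp
      · exact Or.inl (image_eq_zero_of_notMem_tsupport hxf)
  have hlim : Tendsto (fun n : ℕ => ∫ x in Ω \ A, deriv B (((n : ℝ) + 1) * η x) * jac f η x) atTop
      (𝓝 (∫ x in Ω \ A, jac f η x)) := by
    refine tendsto_integral_of_dominated_convergence (fun x => C * ‖jac f η x‖) ?_
      (hint.norm.const_mul C) ?_ ?_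
    · intro n
      refine AEStronglyMeasurable.mul ?_ hint.aestronglyMeasurable
      refine ContinuousOn.aestronglyMeasurable ?_ hO.measurableSet
      exact (hB.continuous_deriv (by norm_num)).comp_continuousOn
        (continuousOn_const.mul hη.continuousOn)
    · intro n
      filter_upwards with x
      rw [norm_mul]
      exact mul_le_mul_of_nonneg_right (hC _) (norm_nonneg _)
    · filter_upwards [ae_planeGrad_eq_zero_of_eq_zero hO (hη.differentiableOn (by norm_num))] with x hx
      by_cases h0 : η x = 0
      · have : jac f η x = 0 := by simp [jac, hx h0]
        simp [this]
      · refine tendsto_const_nhds.congr' ?_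
        have h1 : Tendsto (fun n : ℕ => ((n : ℝ) + 1) * |η x|) atTop atTop :=
          (tendsto_atTop_add_const_right _ _ tendsto_natCast_atTop_atTop).atTop_mul_const
            (abs_pos.2 h0)
        filter_upwards [h1.eventually_gt_atTop 2] with n hn
        rw [hB1 _ (by rwa [abs_mul, abs_of_pos (hnpos n)]), one_mul]
  refine tendsto_nhds_unique hlim ?_
  simp [hzero]

lemma exists_smooth_cutoff {s t : Set ℂ} (hs : IsClosed s) (ht : IsClosed t) (hd : Disjoint s t) :
    ∃ f : ℂ → ℝ, ContDiff ℝ ∞ f ∧ (∀ᶠ x in 𝓝ˢ s, f x = 0) ∧ (∀ᶠ x in 𝓝ˢ t, f x = 1) ∧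
      ∀ x, f x ∈ Set.Icc 0 1 := by
  obtain ⟨f, h0, h1, h2⟩ := exists_contMDiffMap_zero_one_nhds_of_isClosed
    (modelWithCornersSelf ℝ ℂ) (n := (⊤ : ℕ∞)) hs ht hd
  exact ⟨f, f.contMDiff.contDiff, h0, h1, h2⟩

/-- If a phase `ψ` on `Ω` and a phase `g` on a neighbourhood of the complement of `Ω` agree modulo
`2π` on the boundary, then together they have no distributional curl across the boundary. The test
function is split into a part inside `Ω` and a part near the complement, on which the difference of the
phases is reduced to a single-valued function vanishing on the boundary. -/
lemma setIntegral_jac_add_compl_eq_zero {Ω N : Set ℂ} (hΩ : IsOpen Ω)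
    (hN : IsOpen N) (hΩN : Ωᶜ ⊆ N) {ψ g ξ : ℂ → ℝ} (hψ : ContDiffOn ℝ 2 ψ Ω)
    (hψc : ContinuousOn ψ (closure Ω)) (hψi : IntegrableOn (planeGrad ψ) Ω)
    (hg : ContDiffOn ℝ 2 g N)
    (hbd : ∀ x ∈ frontier Ω, Real.cos (ψ x - g x) = 1)
    (hξ : ContDiff ℝ 2 ξ) (hξc : HasCompactSupport ξ) :
    (∫ x in Ω, jac ξ ψ x) + ∫ x in Ωᶜ, jac ξ g x = 0 := by
  have hΩm := hΩ.measurableSet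
  have hfrN : frontier Ω ⊆ N := fun x hx => hΩN (by rw [hΩ.frontier_eq] at hx; exact hx.2)
  -- the points of `closure Ω` where the two phases cannot be compared modulo `2π`
  set A : Set ℂ := {x | x ∈ closure Ω ∧ (x ∈ N → Real.cos (ψ x - g x) ≤ 0)} with hAdef
  have hAc : IsClosed A := by
    have hc : ContinuousOn (fun x => Real.cos (ψ x - g x)) (closure Ω ∩ N) :=
      Real.continuous_cos.comp_continuousOn
        ((hψc.mono Set.inter_subset_left).sub (hg.continuousOn.mono Set.inter_subset_right))
    obtain ⟨u, hu, hue⟩ := continuousOn_iff'.1 hc (Set.Ioi 0) isOpen_Ioi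
    have : A = closure Ω \ (u ∩ N) := by
      ext x
      have hx := Set.ext_iff.1 hue x
      simp only [Set.mem_inter_iff, Set.mem_preimage, Set.mem_Ioi] at hx
      simp only [hAdef, Set.mem_ofPred_eq, Set.mem_sdiff, Set.mem_inter_iff, ← not_lt]
      tauto
    rw [this]
    exact isClosed_closure.sdiff (hu.inter hN)
  have hAΩ : A ⊆ Ω := by
    intro x hx
    by_contra hxΩ
    have hfr : x ∈ frontier Ω := by rw [hΩ.frontier_eq]; exact ⟨hx.1, hxΩ⟩
    have := hx.2 (hfrN hfr)
    rw [hbd x hfr] at this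
    norm_num at this
  -- `ξ = f + k` with `k` supported in `Ω`, and `f` supported where `ψ` and `g` can be compared
  obtain ⟨χ, hχ, hχ0, hχ1, -⟩ := exists_smooth_cutoff hAc hΩ.isClosed_compl
    (Set.disjoint_left.2 fun x hx hx' => hx' (hAΩ hx))
  have hχ2 : ContDiff ℝ 2 χ := contDiff_infty.1 hχ 2
  set f : ℂ → ℝ := fun x => χ x * ξ x
  set k : ℂ → ℝ := fun x => (1 - χ x) * ξ x
  have hf2 : ContDiff ℝ 2 f := hχ2.mul hξ
  have hk2 : ContDiff ℝ 2 k := (contDiff_const.sub hχ2).mul hξ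
  have hf1 : ContDiff ℝ 1 f := hf2.of_le (by norm_num)
  have hk1 : ContDiff ℝ 1 k := hk2.of_le (by norm_num)
  have hfc : HasCompactSupport f := hξc.mul_left
  have hkc : HasCompactSupport k := hξc.mul_left
  have hfA : Disjoint (tsupport f) A := by
    rw [Set.disjoint_left]
    intro x hxf hxA
    refine (notMem_tsupport_iff_eventuallyEq.2 ?_) hxf
    filter_upwards [eventually_nhdsSet_iff_forall.1 hχ0 x hxA] with y hy using by simp [f, hy]
  have hkΩ : tsupport k ⊆ Ω := by
    intro x hxk
    by_contra hx
    refine (notMem_tsupport_iff_eventuallyEq.2 ?_) hxk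
    filter_upwards [eventually_nhdsSet_iff_forall.1 hχ1 x hx] with y hy using by simp [k, hy]
  have hfN : tsupport f ⊆ N := by
    intro x hx
    by_contra hxN
    have hxΩ : x ∈ Ω := by by_contra h; exact hxN (hΩN h)
    exact Set.disjoint_left.1 hfA hx ⟨subset_closure hxΩ, fun h => absurd h hxN⟩
  have hsplit : ∀ q : ℂ → ℝ, ∀ x, jac ξ q x = jac f q x + jac k q x := by
    intro q x
    have h1 : planeGrad ξ x = planeGrad f x + planeGrad k x := by
      rw [← planeGrad_add (hf1.differentiable one_ne_zero x) (hk1.differentiable one_ne_zero x)]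
      congr 1
      funext y; simp [f, k]; ring
    rw [jac, jac, jac, h1, mul_add, inner_add_left]
  have hbound : ∀ {p : ℂ → ℝ}, ContDiff ℝ 1 p → HasCompactSupport p →
      ∃ M, ∀ x, ‖planeGrad p x‖ ≤ M := by
    intro p hp hpc
    obtain ⟨M, hM⟩ := hpc.isCompact.exists_bound_of_continuousOn (continuous_planeGrad hp).continuousOn
    refine ⟨max M 0, fun x => ?_⟩
    by_cases hx : x ∈ tsupport p
    · exact (hM x hx).trans (le_max_left _ _)
    · rw [planeGrad_eq_zero_of_notMem_tsupport hx]; simp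
  have hIψ : ∀ {p : ℂ → ℝ}, ContDiff ℝ 1 p → HasCompactSupport p → IntegrableOn (jac p ψ) Ω := by
    intro p hp hpc
    obtain ⟨M, hM⟩ := hbound hp hpc
    refine Integrable.mono' (hψi.norm.const_mul M) ?_ ?_
    · exact ((continuousOn_const.mul (continuous_planeGrad hp).continuousOn).inner
        (continuousOn_planeGrad hΩ (hψ.of_le (by norm_num)))).aestronglyMeasurable hΩm
    · filter_upwards with x
      exact (abs_jac_le _ _ _).trans (mul_le_mul_of_nonneg_right (hM x) (norm_nonneg _))
  have hIg : Integrable (jac f g) := by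
    have hcN := (continuousOn_const (c := Complex.I)).mul (continuous_planeGrad hf1).continuousOn |>.inner
      (continuousOn_planeGrad hN (hg.of_le (by norm_num))) (𝕜 := ℝ)
    rw [← integrableOn_iff_integrable_of_support_subset (s := tsupport f)]
    · exact (hcN.mono hfN).integrableOn_compact hfc.isCompact
    · intro x hx
      by_contra h
      exact hx (by simp [jac, planeGrad_eq_zero_of_notMem_tsupport h])
  -- the part of `ξ` inside `Ω`
  have hk0 : ∫ x in Ω, jac k ψ x = 0 :=
    setIntegral_jac_eq_zero hΩ hkc.isCompact hkΩ hk1.contDiffOn hψ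
      fun x hx => Or.inl (image_eq_zero_of_notMem_tsupport hx.2)
  have hk0' : ∀ x ∈ Ωᶜ, jac k g x = 0 := fun x hx => by
    simp [jac, planeGrad_eq_zero_of_notMem_tsupport (fun h => hx (hkΩ h))]
  -- the part of `ξ` across the boundary
  have hfg : ∫ x, jac f g x = 0 := by
    rw [← setIntegral_eq_integral_of_forall_compl_eq_zero (s := N)]
    · exact setIntegral_jac_eq_zero hN hfc.isCompact hfN hf1.contDiffOn hg
        fun x hx => Or.inl (image_eq_zero_of_notMem_tsupport hx.2)
    · intro x hx
      simp [jac, planeGrad_eq_zero_of_notMem_tsupport (fun h => hx (hfN h))]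
  have hO : IsOpen (Ω \ A) := hΩ.sdiff hAc
  have hON : Ω \ A ⊆ N := by
    rintro x ⟨hx, hxA⟩
    by_contra h
    exact hxA ⟨subset_closure hx, fun h' => absurd h' h⟩
  have hcos : ∀ x ∈ Ω \ A, 0 < Real.cos (ψ x - g x) := by
    rintro x ⟨hx, hxA⟩
    by_contra h
    exact hxA ⟨subset_closure hx, fun _ => not_lt.1 h⟩
  -- off `A` this is the representative of `ψ - g` modulo `2π` in `(-π / 2, π / 2)`
  set η : ℂ → ℝ := fun x => Real.arcsin (Real.sin (ψ x - g x))
  have hsin : ∀ x ∈ Ω \ A, Real.sin (ψ x - g x) ≠ -1 ∧ Real.sin (ψ x - g x) ≠ 1 := by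
    intro x hx
    have h1 := Real.sin_sq_add_cos_sq (ψ x - g x)
    have h2 := hcos x hx
    constructor <;> intro h <;> rw [h] at h1 <;> nlinarith
  have hηC : ContDiffOn ℝ 2 η (Ω \ A) := by
    intro x hx
    have h1 : ContDiffAt ℝ 2 (fun x => Real.sin (ψ x - g x)) x :=
      Real.contDiff_sin.contDiffAt.comp x
        ((hψ.contDiffAt (hΩ.mem_nhds hx.1)).sub (hg.contDiffAt (hN.mem_nhds (hON hx))))
    exact ((Real.contDiffAt_arcsin (hsin x hx).1 (hsin x hx).2).comp x h1).contDiffWithinAt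
  have hηg : ∀ x ∈ Ω \ A, planeGrad η x = planeGrad ψ x - planeGrad g x := by
    intro x hx
    have hψd := (hψ.contDiffAt (hΩ.mem_nhds hx.1)).differentiableAt (by norm_num)
    have hgd := (hg.contDiffAt (hN.mem_nhds (hON hx))).differentiableAt (by norm_num)
    rw [← planeGrad_sub hψd hgd]
    have h1 := (Real.hasDerivAt_arcsin (hsin x hx).1 (hsin x hx).2).comp _
      (Real.hasDerivAt_sin (ψ x - g x))
    have h2 : 1 / √(1 - Real.sin (ψ x - g x) ^ 2) * Real.cos (ψ x - g x) = 1 := by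
      rw [← Real.cos_sq', Real.sqrt_sq (hcos x hx).le, one_div_mul_cancel (hcos x hx).ne']
    rw [h2] at h1
    have h3 := h1.comp_hasFDerivAt x (hψd.sub hgd).hasFDerivAt
    refine planeGrad_eq_of_hasFDerivAt h3 fun v => ?_
    rw [inner_planeGrad]; simp; rfl
  have hjη : ∀ x ∈ Ω \ A, jac f η x = jac f ψ x - jac f g x := by
    intro x hx
    rw [jac, hηg x hx, inner_sub_right, jac, jac]
  have hη0 : ∫ x in Ω \ A, jac f η x = 0 := by
    refine setIntegral_jac_eq_zero_of_tendsto hΩ hAc hf1 hfc hfA hηC ?_ ?_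
    · intro x hx hxA
      have hc : ContinuousOn (fun x => Real.arcsin (Real.sin (ψ x - g x))) (closure Ω ∩ N) :=
        Real.continuous_arcsin.comp_continuousOn (Real.continuous_sin.comp_continuousOn
          ((hψc.mono Set.inter_subset_left).sub (hg.continuousOn.mono Set.inter_subset_right)))
      have h1 := hc x ⟨frontier_subset_closure hx, hfrN hx⟩
      have h2 : Real.sin (ψ x - g x) = 0 := by
        have := Real.sin_sq_add_cos_sq (ψ x - g x)
        rw [hbd x hx] at this
        nlinarith
      rw [ContinuousWithinAt, h2, Real.arcsin_zero] at h1
      exact h1.mono_left (nhdsWithin_mono _ fun y hy => ⟨subset_closure hy.1, hON hy⟩)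
    · refine IntegrableOn.congr_fun ?_ (fun x hx => (hjη x hx).symm) hO.measurableSet
      exact ((hIψ hf1 hfc).mono_set Set.sdiff_subset).sub hIg.integrableOn
  have hfψg : ∫ x in Ω, (jac f ψ x - jac f g x) = 0 := by
    rw [← hη0, setIntegral_congr_fun hO.measurableSet hjη]
    apply setIntegral_eq_of_subset_of_forall_sdiff_eq_zero hΩm Set.sdiff_subset
    rintro x ⟨hx, hxA⟩
    have hxA' : x ∈ A := by by_contra h; exact hxA ⟨hx, h⟩
    have := Set.disjoint_right.1 hfA hxA'
    simp [jac, planeGrad_eq_zero_of_notMem_tsupport this]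
  rw [integral_sub (hIψ hf1 hfc) hIg.integrableOn] at hfψg
  have h1 : ∫ x in Ω, jac ξ ψ x = ∫ x in Ω, jac f ψ x := by
    simp_rw [hsplit ψ]
    rw [integral_add (hIψ hf1 hfc) (hIψ hk1 hkc), hk0, add_zero]
  have h2 : ∫ x in Ωᶜ, jac ξ g x = ∫ x in Ωᶜ, jac f g x :=
    setIntegral_congr_fun hΩm.compl fun x hx => by
      simp only [hsplit g x, hk0' x hx, add_zero]
  rw [h1, h2]
  have h3 := integral_add_compl hΩm hIg
  linarith

/-! ### Polar coordinates -/

/-- The point with polar coordinates `(ρ, θ)` about `p`, angles being measured from the direction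
`ν`. -/
noncomputable def polarPt (p ν : ℂ) (θ ρ : ℝ) : ℂ :=
  p + ν * (ρ * (Real.cos θ + Real.sin θ * Complex.I))

lemma integrableOn_polarCoord_symm {F : ℂ → ℝ} (hF : Integrable F) :
    IntegrableOn (fun q : ℝ × ℝ => q.1 * F (Complex.polarCoord.symm q)) polarCoord.target := by
  have h1 : Integrable (fun q : ℝ × ℝ => F (Complex.measurableEquivRealProd.symm q)) :=
    (Complex.volume_preserving_equiv_real_prod.symm).integrable_comp_of_integrable hF
  have h2 := (integrableOn_image_iff_integrableOn_abs_det_fderiv_smul volume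
    polarCoord.open_target.measurableSet
    (fun q _ => (hasFDerivAt_polarCoord_symm q).hasFDerivWithinAt) polarCoord.symm.injOn
    (fun q : ℝ × ℝ => F (Complex.measurableEquivRealProd.symm q))).1 h1.integrableOn
  refine h2.congr_fun (fun q hq => ?_) polarCoord.open_target.measurableSet
  have hq0 : 0 < q.1 := hq.1
  simp only [smul_eq_mul, det_fderivPolarCoordSymm, abs_of_pos hq0,
    Complex.measurableEquivRealProd_symm_polarCoord_symm_apply]

lemma measurePreserving_rigidMotion (p : ℂ) {ν : ℂ} (hν : ‖ν‖ = 1) :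
    MeasurePreserving (fun z : ℂ => p + ν * z) := by
  have h1 : MeasurePreserving (rotation ⟨ν, by simpa [Submonoid.unitSphere] using hν⟩) :=
    LinearIsometryEquiv.measurePreserving _
  exact (measurePreserving_add_left volume p).comp h1

lemma measurableEmbedding_rigidMotion (p : ℂ) {ν : ℂ} (hν : ‖ν‖ = 1) :
    MeasurableEmbedding (fun z : ℂ => p + ν * z) := by
  have hν0 : ν ≠ 0 := by rintro rfl; simp at hν
  exact ((Homeomorph.mulLeft₀ ν hν0).trans (Homeomorph.addLeft p)).measurableEmbedding

/-- Integration in polar coordinates about `p`, with the integrability of the slices. -/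
lemma integral_polarPt {F : ℂ → ℝ} (hF : Integrable F) (p : ℂ) {ν : ℂ} (hν : ‖ν‖ = 1) :
    (∀ᵐ θ ∂(volume.restrict (Set.Ioo (-Real.pi) Real.pi)),
      IntegrableOn (fun ρ => ρ * F (polarPt p ν θ ρ)) (Set.Ioi 0)) ∧
    IntegrableOn (fun θ => ∫ ρ in Set.Ioi (0 : ℝ), ρ * F (polarPt p ν θ ρ))
      (Set.Ioo (-Real.pi) Real.pi) ∧
    ∫ x, F x = ∫ θ in Set.Ioo (-Real.pi) Real.pi, ∫ ρ in Set.Ioi (0 : ℝ),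
      ρ * F (polarPt p ν θ ρ) := by
  have hmp := measurePreserving_rigidMotion p hν
  have hG : Integrable (fun z => F (p + ν * z)) := hmp.integrable_comp_of_integrable hF
  have h1 := integrableOn_polarCoord_symm hG
  have h2 : Integrable (fun q : ℝ × ℝ => q.1 * F (polarPt p ν q.2 q.1))
      ((volume.restrict (Set.Ioi (0 : ℝ))).prod
        (volume.restrict (Set.Ioo (-Real.pi) Real.pi))) := by
    rw [Measure.prod_restrict, ← Measure.volume_eq_prod]
    simpa [IntegrableOn, polarPt, polarCoord_target, Complex.polarCoord_symm_apply] using h1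
  refine ⟨h2.prod_left_ae, h2.integral_prod_right, ?_⟩
  rw [← hmp.integral_comp (measurableEmbedding_rigidMotion p hν),
    ← Complex.integral_comp_polarCoord_symm, polarCoord_target, Measure.volume_eq_prod,
    ← Measure.prod_restrict]
  have := integral_prod_symm _ h2
  simpa [polarPt, Complex.polarCoord_symm_apply] using this

lemma norm_cos_add_sin_mul_I (θ : ℝ) : ‖(Real.cos θ + Real.sin θ * Complex.I : ℂ)‖ = 1 := by
  have := Complex.norm_exp_ofReal_mul_I θ
  rwa [Complex.exp_mul_I, ← Complex.ofReal_cos, ← Complex.ofReal_sin] at this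

lemma norm_polarPt_sub (p : ℂ) {ν : ℂ} (hν : ‖ν‖ = 1) (θ : ℝ) {ρ : ℝ} (hρ : 0 ≤ ρ) :
    ‖polarPt p ν θ ρ - p‖ = ρ := by
  rw [polarPt, add_sub_cancel_left, norm_mul, norm_mul, hν, norm_cos_add_sin_mul_I,
    Complex.norm_real, Real.norm_of_nonneg hρ]
  ring

lemma hasDerivAt_polarPt (p ν : ℂ) (θ ρ : ℝ) :
    HasDerivAt (polarPt p ν θ) (ν * (Real.cos θ + Real.sin θ * Complex.I)) ρ := by
  have h : HasDerivAt (fun ρ : ℝ => (ρ : ℂ)) 1 ρ := Complex.ofRealCLM.hasDerivAt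
  have h2 := ((h.mul_const (Real.cos θ + Real.sin θ * Complex.I : ℂ)).const_mul ν).const_add p
  rwa [one_mul] at h2

lemma hasDerivAt_comp_polarPt {f : ℂ → ℝ} {p ν : ℂ} {θ ρ : ℝ}
    (hf : DifferentiableAt ℝ f (polarPt p ν θ ρ)) :
    HasDerivAt (fun ρ => f (polarPt p ν θ ρ)) (inner ℝ (planeGrad f (polarPt p ν θ ρ))
      (ν * (Real.cos θ + Real.sin θ * Complex.I))) ρ := by
  rw [inner_planeGrad]
  exact hf.hasFDerivAt.comp_hasDerivAt ρ (hasDerivAt_polarPt p ν θ ρ)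

/-! ### Logarithmic potentials -/

/-- The potential `log |x - b|`, regularised at length scale `δ`. -/
noncomputable def logPot (δ : ℝ) (b x : ℂ) : ℝ := (1 / 2) * Real.log (‖x - b‖ ^ 2 + δ ^ 2)

/-- The gradient of `logPot δ b`. -/
noncomputable def logField (δ : ℝ) (b x : ℂ) : ℂ := ((‖x - b‖ ^ 2 + δ ^ 2)⁻¹ : ℝ) * (x - b)

lemma logPot_zero (b x : ℂ) : logPot 0 b x = Real.log ‖x - b‖ := by
  simp [logPot, Real.log_pow]

lemma contDiff_norm_sub_sq_add (δ : ℝ) (b : ℂ) :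
    ContDiff ℝ ∞ (fun x : ℂ => ‖x - b‖ ^ 2 + δ ^ 2) :=
  ((contDiff_id.sub contDiff_const).norm_sq ℝ).add contDiff_const

lemma contDiffAt_logPot {δ : ℝ} {b x : ℂ} (h : ‖x - b‖ ^ 2 + δ ^ 2 ≠ 0) :
    ContDiffAt ℝ ∞ (logPot δ b) x :=
  contDiffAt_const.mul ((contDiff_norm_sub_sq_add δ b).contDiffAt.log h)

lemma sq_add_sq_ne_zero_of_ne {δ : ℝ} {b x : ℂ} (h : x ≠ b) : ‖x - b‖ ^ 2 + δ ^ 2 ≠ 0 := by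
  have := norm_pos_iff.2 (sub_ne_zero.2 h); positivity

lemma contDiff_logPot {δ : ℝ} (hδ : δ ≠ 0) (b : ℂ) : ContDiff ℝ ∞ (logPot δ b) :=
  contDiff_iff_contDiffAt.2 fun x => contDiffAt_logPot (by positivity)

lemma planeGrad_logPot {δ : ℝ} {b x : ℂ} (h : ‖x - b‖ ^ 2 + δ ^ 2 ≠ 0) :
    planeGrad (logPot δ b) x = logField δ b x := by
  have h1 : HasFDerivAt (fun x : ℂ => x - b) (ContinuousLinearMap.id ℝ ℂ) x :=
    (hasFDerivAt_id x).sub_const b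
  have h2 := ((h1.norm_sq.add_const (δ ^ 2)).log h).const_mul (1 / 2)
  refine planeGrad_eq_of_hasFDerivAt h2 fun v => ?_
  rw [logField, ← Complex.real_smul, real_inner_smul_left]
  simp [-Complex.inner, inner_sub_left]
  ring

lemma logField_zero (b x : ℂ) : logField 0 b x = ((‖x - b‖ ^ 2)⁻¹ : ℝ) * (x - b) := by
  simp [logField]

lemma norm_logField (δ : ℝ) (b x : ℂ) :
    ‖logField δ b x‖ = (‖x - b‖ ^ 2 + δ ^ 2)⁻¹ * ‖x - b‖ := by
  rw [logField, norm_mul, Complex.norm_real, Real.norm_of_nonneg (by positivity)]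

lemma norm_logField_le (δ : ℝ) (b x : ℂ) : ‖logField δ b x‖ ≤ ‖x - b‖⁻¹ := by
  rw [norm_logField]
  rcases (norm_nonneg (x - b)).eq_or_lt with h | h
  · simp [← h]
  · rw [inv_mul_eq_div, div_le_iff₀ (by positivity), mul_add]
    have : ‖x - b‖⁻¹ * ‖x - b‖ ^ 2 = ‖x - b‖ := by field_simp
    rw [this]
    have : 0 ≤ ‖x - b‖⁻¹ * δ ^ 2 := by positivity
    linarith

lemma norm_logField_zero (b x : ℂ) : ‖logField 0 b x‖ = ‖x - b‖⁻¹ := by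
  rw [norm_logField]
  rcases (norm_nonneg (x - b)).eq_or_lt with h | h
  · simp [← h]
  · field_simp; simp

lemma measurable_logField (δ : ℝ) (b : ℂ) : Measurable (logField δ b) := by
  unfold logField; fun_prop

lemma tendsto_logField (b x : ℂ) : Tendsto (fun δ => logField δ b x) (𝓝 0) (𝓝 (logField 0 b x)) := by
  by_cases h : x = b
  · simp [logField, h]
  · have hc : Continuous fun δ : ℝ => ‖x - b‖ ^ 2 + δ ^ 2 := by fun_prop
    have h1 : ContinuousAt (fun δ : ℝ => (‖x - b‖ ^ 2 + δ ^ 2)⁻¹) 0 :=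
      hc.continuousAt.inv₀ (sq_add_sq_ne_zero_of_ne h)
    exact ((Complex.continuous_ofReal.continuousAt.comp h1).mul continuousAt_const)

lemma tendsto_logPot {b x : ℂ} (h : x ≠ b) :
    Tendsto (fun δ => logPot δ b x) (𝓝 0) (𝓝 (logPot 0 b x)) := by
  have hc : Continuous fun δ : ℝ => ‖x - b‖ ^ 2 + δ ^ 2 := by fun_prop
  exact (hc.continuousAt.log (sq_add_sq_ne_zero_of_ne h)).const_mul _

lemma integrableOn_inv_norm_sub (b : ℂ) {s : Set ℂ} (hs : Bornology.IsBounded s) :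
    IntegrableOn (fun x => ‖x - b‖⁻¹) s := by
  have h0 : LocallyIntegrable (fun x : ℂ => ‖x‖⁻¹) := by
    refine locallyIntegrable_of_norm_le_rpow (C := 1) (α := 1) (by simp) (by simp) ?_
      (by fun_prop)
    filter_upwards with x
    simp [Real.rpow_neg_one]
  have h1 := h0.integrableOn_isCompact (k := (fun x => x - b) '' closure s)
    ((Metric.isCompact_of_isClosed_isBounded isClosed_closure hs.closure).image (by fun_prop))
  have h2 := ((measurePreserving_sub_right volume b).integrableOn_comp_preimage
    (Homeomorph.subRight b).measurableEmbedding).2 h1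
  exact h2.mono_set fun x hx => ⟨x, subset_closure hx, rfl⟩

lemma inv_norm_mul_inv_norm_le {a b : ℂ} (hab : a ≠ b) (x : ℂ) :
    ‖x - a‖⁻¹ * ‖x - b‖⁻¹ ≤ ‖a - b‖⁻¹ * (‖x - a‖⁻¹ + ‖x - b‖⁻¹) := by
  have hd : 0 < ‖a - b‖ := norm_pos_iff.2 (sub_ne_zero.2 hab)
  rcases (norm_nonneg (x - a)).eq_or_lt with h | h
  · simp [← h]; positivity
  rcases (norm_nonneg (x - b)).eq_or_lt with h' | h'
  · simp [← h']; positivity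
  have ht : ‖a - b‖ ≤ ‖x - b‖ + ‖x - a‖ := by
    have := norm_sub_le (x - b) (x - a)
    rwa [sub_sub_sub_cancel_left] at this
  rw [inv_add_inv h.ne' h'.ne', ← mul_inv, inv_mul_eq_div, div_div, le_div_iff₀ (by positivity),
    inv_mul_le_iff₀ (by positivity)]
  nlinarith [mul_pos h h']

lemma integrableOn_inv_norm_mul_inv_norm {a b : ℂ} (hab : a ≠ b) {s : Set ℂ}
    (hs : Bornology.IsBounded s) : IntegrableOn (fun x => ‖x - a‖⁻¹ * ‖x - b‖⁻¹) s := by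
  refine Integrable.mono' (((integrableOn_inv_norm_sub a hs).add
    (integrableOn_inv_norm_sub b hs)).const_mul ‖a - b‖⁻¹) (by fun_prop) ?_
  filter_upwards with x
  rw [Real.norm_of_nonneg (by positivity)]
  exact inv_norm_mul_inv_norm_le hab x

/-- The field `logField 0 b` inverts the radial derivative: integrating `⟪∇f, (x-b)/|x-b|²⟫` along rays
from the circle of radius `r` leaves the boundary values of `f`. -/
lemma setIntegral_inner_planeGrad_logField {f : ℂ → ℝ} {b : ℂ} {r : ℝ} (hr : 0 ≤ r)
    (hd : ∀ x, r < ‖x - b‖ → DifferentiableAt ℝ f x) (hcont : ContinuousOn f {x | r ≤ ‖x - b‖})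
    (hc : HasCompactSupport f)
    (hint : IntegrableOn (fun x => inner ℝ (planeGrad f x) (logField 0 b x)) {x | r < ‖x - b‖}) :
    ∫ x in {x | r < ‖x - b‖}, inner ℝ (planeGrad f x) (logField 0 b x) =
      -∫ θ in Set.Ioo (-Real.pi) Real.pi, f (polarPt b 1 θ r) := by
  have hm : MeasurableSet {x : ℂ | r < ‖x - b‖} :=
    (isOpen_lt continuous_const (by fun_prop)).measurableSet
  set F : ℂ → ℝ := {x | r < ‖x - b‖}.indicator
    (fun x => inner ℝ (planeGrad f x) (logField 0 b x)) with hF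
  have hFi : Integrable F := hint.integrable_indicator hm
  obtain ⟨h1, -, h3⟩ := integral_polarPt hFi b (ν := 1) (by simp)
  rw [← integral_indicator hm, h3, ← integral_neg]
  refine integral_congr_ae ?_
  filter_upwards [h1] with θ hθ
  set e : ℂ := 1 * (Real.cos θ + Real.sin θ * Complex.I) with he
  have hnorm : ∀ ρ : ℝ, 0 ≤ ρ → ‖polarPt b 1 θ ρ - b‖ = ρ := fun ρ h =>
    norm_polarPt_sub b (by simp) θ h
  have hz : ∀ ρ ∈ Set.Ioi (0 : ℝ) \ Set.Ioi r, ρ * F (polarPt b 1 θ ρ) = 0 := by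
    rintro ρ ⟨h0, hρ⟩
    have : polarPt b 1 θ ρ ∉ {x | r < ‖x - b‖} := by
      simpa [hnorm ρ (le_of_lt h0)] using hρ
    simp only [hF, Set.indicator_of_notMem this, mul_zero]
  have hsub : Set.Ioi r ⊆ Set.Ioi (0 : ℝ) := Set.Ioi_subset_Ioi hr
  rw [setIntegral_eq_of_subset_of_forall_sdiff_eq_zero measurableSet_Ioi hsub hz]
  have hval : ∀ ρ ∈ Set.Ioi r, ρ * F (polarPt b 1 θ ρ) = inner ℝ (planeGrad f (polarPt b 1 θ ρ)) e := by
    intro ρ hρ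
    have h0 : 0 < ρ := hr.trans_lt hρ
    have hmem : polarPt b 1 θ ρ ∈ {x | r < ‖x - b‖} := by
      simpa [hnorm ρ h0.le] using hρ
    have hE : logField 0 b (polarPt b 1 θ ρ) = (ρ⁻¹ : ℝ) • e := by
      rw [logField_zero, hnorm ρ h0.le, polarPt, add_sub_cancel_left, he, Complex.real_smul]
      push_cast
      field_simp
    simp only [hF, Set.indicator_of_mem hmem, hE, real_inner_smul_right]
    rw [← mul_assoc, mul_inv_cancel₀ h0.ne', one_mul]
  have hder : ∀ ρ ∈ Set.Ioi r, HasDerivAt (fun ρ => f (polarPt b 1 θ ρ))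
      (ρ * F (polarPt b 1 θ ρ)) ρ := by
    intro ρ hρ
    rw [hval ρ hρ]
    refine hasDerivAt_comp_polarPt (hd _ ?_)
    rw [hnorm ρ (hr.trans (le_of_lt hρ))]; exact hρ
  have hcw : ContinuousWithinAt (fun ρ => f (polarPt b 1 θ ρ)) (Set.Ici r) r := by
    have h4 : ContinuousWithinAt f {x | r ≤ ‖x - b‖} (polarPt b 1 θ r) :=
      hcont _ (by simp [hnorm r hr])
    refine h4.comp (hasDerivAt_polarPt b 1 θ r).continuousAt.continuousWithinAt ?_
    intro ρ hρ
    simpa [hnorm ρ (hr.trans hρ)] using hρ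
  have htend : Tendsto (fun ρ => f (polarPt b 1 θ ρ)) atTop (𝓝 0) := by
    obtain ⟨D, hD⟩ := hc.isCompact.isBounded.exists_norm_le
    refine tendsto_const_nhds.congr' ?_
    filter_upwards [eventually_gt_atTop (D + ‖b‖), eventually_ge_atTop 0] with ρ hρ h0
    symm
    apply image_eq_zero_of_notMem_tsupport
    intro hmem
    have := hD _ hmem
    have h5 := hnorm ρ h0
    have := norm_sub_le (polarPt b 1 θ ρ) b
    linarith
  rw [integral_Ioi_of_hasDerivAt_of_tendsto hcw hder (hθ.mono_set hsub) htend, zero_sub]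

/-- `ζ` is a smooth cutoff, equal to one on the disc of radius `R` and to zero off the disc of radius
`2 R`, with gradient at most `M`. -/
structure IsPlateau (R M : ℝ) (ζ : ℂ → ℝ) : Prop where
  contDiff : ContDiff ℝ ∞ ζ
  eventually_one : ∀ x, ‖x‖ ≤ R → ∀ᶠ y in 𝓝 x, ζ y = 1
  eventually_zero : ∀ x, 2 * R ≤ ‖x‖ → ∀ᶠ y in 𝓝 x, ζ y = 0
  mem_Icc : ∀ x, ζ x ∈ Set.Icc 0 1
  norm_grad_le : ∀ x, ‖planeGrad ζ x‖ ≤ M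

lemma exists_isPlateau {R : ℝ} (hR : 0 < R) : ∃ ζ M, IsPlateau R M ζ := by
  obtain ⟨ζ, h1, h2, h3, h4⟩ := exists_smooth_cutoff (s := {x : ℂ | 2 * R ≤ ‖x‖}) (t := {x | ‖x‖ ≤ R})
    (isClosed_le continuous_const continuous_norm) (isClosed_le continuous_norm continuous_const)
    (Set.disjoint_left.2 fun x hx hx' => by
      simp only [Set.mem_ofPred_eq] at hx hx'; linarith)
  have h2' := fun x hx => eventually_nhdsSet_iff_forall.1 h2 x hx
  obtain ⟨M, hM⟩ := (isCompact_closedBall (0 : ℂ) (2 * R)).exists_bound_of_continuousOn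
    (continuous_planeGrad (contDiff_infty.1 h1 1)).continuousOn
  refine ⟨ζ, max M 0, h1, fun x hx => eventually_nhdsSet_iff_forall.1 h3 x hx, h2', h4, fun x => ?_⟩
  by_cases hx : 2 * R ≤ ‖x‖
  · have h0 : planeGrad ζ x = planeGrad (fun _ => 0) x := planeGrad_congr (h2' x hx)
    have h5 : planeGrad (fun _ => (0 : ℝ)) x = 0 := by simp [planeGrad]; rfl
    rw [h0, h5]; simp
  · exact (hM x (by simpa using (not_le.1 hx).le)).trans (le_max_left _ _)

namespace IsPlateau

variable {R M : ℝ} {ζ : ℂ → ℝ}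

lemma nonneg (h : IsPlateau R M ζ) : 0 ≤ M := (norm_nonneg _).trans (h.norm_grad_le 0)

lemma eq_one (h : IsPlateau R M ζ) {x : ℂ} (hx : ‖x‖ ≤ R) : ζ x = 1 :=
  (h.eventually_one x hx).self_of_nhds

lemma eq_zero (h : IsPlateau R M ζ) {x : ℂ} (hx : 2 * R ≤ ‖x‖) : ζ x = 0 :=
  (h.eventually_zero x hx).self_of_nhds

lemma grad_eq_zero_of_le (h : IsPlateau R M ζ) {x : ℂ} (hx : ‖x‖ ≤ R) : planeGrad ζ x = 0 := by
  have : planeGrad ζ x = planeGrad (fun _ => 1) x := planeGrad_congr (h.eventually_one x hx)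
  rw [this]; simp [planeGrad]; rfl

lemma grad_eq_zero_of_ge (h : IsPlateau R M ζ) {x : ℂ} (hx : 2 * R ≤ ‖x‖) : planeGrad ζ x = 0 := by
  have : planeGrad ζ x = planeGrad (fun _ => 0) x := planeGrad_congr (h.eventually_zero x hx)
  rw [this]; simp [planeGrad]; rfl

lemma hasCompactSupport (h : IsPlateau R M ζ) : HasCompactSupport ζ :=
  HasCompactSupport.intro (isCompact_closedBall (0 : ℂ) (2 * R)) fun x hx =>
    h.eq_zero (by simpa using (not_le.1 (by simpa using hx)).le)

lemma differentiableAt (h : IsPlateau R M ζ) (x : ℂ) : DifferentiableAt ℝ ζ x :=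
  h.contDiff.differentiable (by simp) x

lemma continuous_grad (h : IsPlateau R M ζ) : Continuous (planeGrad ζ) :=
  continuous_planeGrad (contDiff_infty.1 h.contDiff 1)

end IsPlateau

/-- The gradient of the product of the cutoff `ζ` and the potential `logPot δ a`. -/
noncomputable def cutField (ζ : ℂ → ℝ) (δ : ℝ) (a x : ℂ) : ℂ :=
  (ζ x : ℂ) * logField δ a x + (logPot δ a x : ℂ) * planeGrad ζ x

lemma planeGrad_mul_logPot {ζ : ℂ → ℝ} {δ : ℝ} {a x : ℂ} (hζ : DifferentiableAt ℝ ζ x)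
    (h : ‖x - a‖ ^ 2 + δ ^ 2 ≠ 0) :
    planeGrad (fun y => ζ y * logPot δ a y) x = cutField ζ δ a x := by
  rw [planeGrad_mul hζ ((contDiffAt_logPot h).differentiableAt (by simp)), planeGrad_logPot h, cutField]

lemma measurable_logPot (δ : ℝ) (a : ℂ) : Measurable (logPot δ a) := by
  unfold logPot; fun_prop

lemma measurable_cutField {R M : ℝ} {ζ : ℂ → ℝ} (hζ : IsPlateau R M ζ) (δ : ℝ) (a : ℂ) :
    Measurable (cutField ζ δ a) := by
  have h1 := hζ.contDiff.continuous.measurable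
  have h2 := hζ.continuous_grad.measurable
  have h3 := measurable_logField δ a
  have h4 := measurable_logPot δ a
  unfold cutField
  fun_prop

/-- On the annulus where the cutoff varies the potentials of points well inside it are bounded. -/
lemma abs_logPot_le {R δ : ℝ} (hR : 1 ≤ R) (hδ : |δ| ≤ 2 * R) {a x : ℂ} (ha : ‖a‖ ≤ R - 1)
    (hx : R ≤ ‖x‖) (hx' : ‖x‖ ≤ 2 * R) : |logPot δ a x| ≤ 5 * R := by
  have h1 : 1 ≤ ‖x - a‖ := by have := norm_sub_norm_le x a; linarith
  have h2 : ‖x - a‖ ≤ 3 * R := by have := norm_sub_le x a; linarith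
  have h3 : δ ^ 2 ≤ (2 * R) ^ 2 := sq_le_sq' (abs_le.1 hδ).1 (abs_le.1 hδ).2
  have h4 : 1 ≤ ‖x - a‖ ^ 2 + δ ^ 2 := by nlinarith [sq_nonneg δ]
  have h5 : ‖x - a‖ ^ 2 + δ ^ 2 ≤ (5 * R) ^ 2 := by nlinarith
  rw [logPot, abs_of_nonneg (mul_nonneg (by norm_num) (Real.log_nonneg h4))]
  have h6 := Real.log_le_log (by positivity) h5
  rw [Real.log_pow] at h6
  have h7 := Real.log_le_self (show 0 ≤ 5 * R by linarith)
  push_cast at h6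
  linarith

lemma norm_cutField_le {R M δ : ℝ} {ζ : ℂ → ℝ} (hζ : IsPlateau R M ζ) (hR : 1 ≤ R)
    (hδ : |δ| ≤ 2 * R) {a : ℂ} (ha : ‖a‖ ≤ R - 1) (x : ℂ) :
    ‖cutField ζ δ a x‖ ≤ (Metric.ball (0 : ℂ) (2 * R)).indicator
      (fun x => ‖x - a‖⁻¹ + 5 * R * M) x := by
  by_cases hx : x ∈ Metric.ball (0 : ℂ) (2 * R)
  · rw [Set.indicator_of_mem hx]
    have hx' : ‖x‖ < 2 * R := by simpa using hx
    refine (norm_add_le _ _).trans (add_le_add ?_ ?_)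
    · rw [norm_mul, Complex.norm_real, Real.norm_of_nonneg (hζ.mem_Icc x).1]
      have := mul_le_mul (hζ.mem_Icc x).2 (norm_logField_le δ a x) (norm_nonneg _) zero_le_one
      rwa [one_mul] at this
    · have h0 : 0 ≤ 5 * R * M := mul_nonneg (by linarith) hζ.nonneg
      by_cases hxR : ‖x‖ ≤ R
      · rw [hζ.grad_eq_zero_of_le hxR]; simpa using h0
      · rw [norm_mul, Complex.norm_real]
        exact mul_le_mul (abs_logPot_le hR hδ ha (not_le.1 hxR).le hx'.le) (hζ.norm_grad_le x)
          (norm_nonneg _) (by linarith)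
  · have hx' : 2 * R ≤ ‖x‖ := by simpa using hx
    rw [Set.indicator_of_notMem hx, cutField, hζ.eq_zero hx', hζ.grad_eq_zero_of_ge hx']
    simp

lemma tendsto_cutField {R M : ℝ} {ζ : ℂ → ℝ} (hζ : IsPlateau R M ζ) {a : ℂ}
    (ha : ‖a‖ ≤ R - 1) (x : ℂ) :
    Tendsto (fun δ => cutField ζ δ a x) (𝓝 0) (𝓝 (cutField ζ 0 a x)) := by
  refine (tendsto_const_nhds.mul (tendsto_logField a x)).add ?_
  by_cases hx : x = a
  · rw [hζ.grad_eq_zero_of_le (show ‖x‖ ≤ R by rw [hx]; linarith)]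
    simp
  · exact ((Complex.continuous_ofReal.tendsto _).comp (tendsto_logPot hx)).mul tendsto_const_nhds

lemma integral_const_circle (c : ℝ) : ∫ _θ in Set.Ioo (-Real.pi) Real.pi, c = 2 * Real.pi * c := by
  simp [Real.pi_pos.le]; left; ring

/-- Potential theory in the plane: `-½ ∫ ⟪∇(ζ log |x - a|), ∇ log |x - b|⟫ = π log |a - b|`. -/
lemma integral_inner_cutField_logField {R M : ℝ} {ζ : ℂ → ℝ} (hζ : IsPlateau R M ζ) (hR : 1 ≤ R)
    {a b : ℂ} (ha : ‖a‖ ≤ R - 1) (hb : ‖b‖ ≤ R - 1) (hab : a ≠ b) :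
    Integrable (fun x => inner ℝ (cutField ζ 0 a x) (logField 0 b x)) ∧
    ∫ x, inner ℝ (cutField ζ 0 a x) (logField 0 b x) = -(2 * Real.pi * Real.log ‖a - b‖) := by
  set G : ℂ → ℝ := (Metric.ball (0 : ℂ) (2 * R)).indicator
    (fun x => ‖x - a‖⁻¹ * ‖x - b‖⁻¹ + 5 * R * M * ‖x - b‖⁻¹) with hG
  have hGi : Integrable G := by
    refine IntegrableOn.integrable_indicator ?_ Metric.isOpen_ball.measurableSet
    exact (integrableOn_inv_norm_mul_inv_norm hab Metric.isBounded_ball).add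
      ((integrableOn_inv_norm_sub b Metric.isBounded_ball).const_mul _)
  have hbd : ∀ δ : ℝ, |δ| ≤ 2 * R → ∀ x, ‖inner ℝ (cutField ζ δ a x) (logField 0 b x)‖ ≤ G x := by
    intro δ hδ x
    refine (norm_inner_le_norm _ _).trans ?_
    have h1 := norm_cutField_le hζ hR hδ ha x
    rw [norm_logField_zero]
    refine (mul_le_mul_of_nonneg_right h1 (by positivity)).trans (le_of_eq ?_)
    by_cases hx : x ∈ Metric.ball (0 : ℂ) (2 * R)
    · simp only [hG, Set.indicator_of_mem hx]; ring
    · simp only [hG, Set.indicator_of_notMem hx, zero_mul]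
  have hms : ∀ δ, AEStronglyMeasurable (fun x => inner ℝ (cutField ζ δ a x) (logField 0 b x)) :=
    fun δ => ((measurable_cutField hζ δ a).inner (measurable_logField 0 b)).aestronglyMeasurable
  have hI : ∀ δ : ℝ, |δ| ≤ 2 * R → Integrable (fun x => inner ℝ (cutField ζ δ a x) (logField 0 b x)) :=
    fun δ hδ => hGi.mono' (hms δ) (Eventually.of_forall (hbd δ hδ))
  refine ⟨hI 0 (by simp; linarith), ?_⟩
  -- smooth the pole at `a` at scale `δ`, integrate along rays from `b`, and let `δ` tend to zero
  have hδ : ∀ᶠ δ : ℝ in 𝓝[>] 0, |δ| ≤ 2 * R ∧ 0 < δ := by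
    filter_upwards [Ioo_mem_nhdsGT (show (0 : ℝ) < 2 * R by linarith)] with δ hδ
    exact ⟨by rw [abs_of_pos hδ.1]; exact hδ.2.le, hδ.1⟩
  have hlim : Tendsto (fun δ => ∫ x, inner ℝ (cutField ζ δ a x) (logField 0 b x)) (𝓝[>] 0)
      (𝓝 (∫ x, inner ℝ (cutField ζ 0 a x) (logField 0 b x))) := by
    refine tendsto_integral_filter_of_dominated_convergence G (Eventually.of_forall hms) ?_ hGi ?_
    · filter_upwards [hδ] with δ hδ
      exact Eventually.of_forall (hbd δ hδ.1)
    · filter_upwards with x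
      exact ((tendsto_cutField hζ ha x).mono_left nhdsWithin_le_nhds).inner tendsto_const_nhds
  have hlim2 : Tendsto (fun δ => ∫ x, inner ℝ (cutField ζ δ a x) (logField 0 b x)) (𝓝[>] 0)
      (𝓝 (-(2 * Real.pi * Real.log ‖a - b‖))) := by
    have h1 : Tendsto (fun δ => -(2 * Real.pi * logPot δ a b)) (𝓝[>] 0)
        (𝓝 (-(2 * Real.pi * logPot 0 a b))) :=
      (((tendsto_logPot hab.symm).const_mul _).neg).mono_left nhdsWithin_le_nhds
    rw [logPot_zero, norm_sub_rev] at h1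
    refine h1.congr' ?_
    filter_upwards [hδ] with δ hδ
    have hne : ∀ x, ‖x - a‖ ^ 2 + δ ^ 2 ≠ 0 := fun x => by have := hδ.2; positivity
    have hfd : ContDiff ℝ ∞ (fun y => ζ y * logPot δ a y) :=
      hζ.contDiff.mul (contDiff_logPot hδ.2.ne' a)
    have hgrad : ∀ x, planeGrad (fun y => ζ y * logPot δ a y) x = cutField ζ δ a x := fun x =>
      planeGrad_mul_logPot (hζ.differentiableAt x) (hne x)
    have h2 := setIntegral_inner_planeGrad_logField (f := fun y => ζ y * logPot δ a y) (b := b)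
      (r := 0) le_rfl (fun x _ => hfd.differentiable (by simp) x) hfd.continuous.continuousOn
      hζ.hasCompactSupport.mul_right (by simp_rw [hgrad]; exact (hI δ hδ.1).integrableOn)
    have h3 : ∀ θ, polarPt b 1 θ 0 = b := fun θ => by simp [polarPt]
    simp only [hgrad, h3, hζ.eq_one (show ‖b‖ ≤ R by linarith), one_mul,
      integral_const_circle] at h2
    rw [← h2]
    refine setIntegral_eq_integral_of_ae_compl_eq_zero ?_
    filter_upwards with x hx
    have : x = b := by simpa [sub_eq_zero] using hx
    simp [this, logField]
  exact tendsto_nhds_unique hlim hlim2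

/-- The Dirichlet integral of `log |x - a|`, cut off far away, outside the disc of radius `r`. -/
lemma setIntegral_inner_cutField_logField_self {R M : ℝ} {ζ : ℂ → ℝ} (hζ : IsPlateau R M ζ)
    (hR : 1 ≤ R) {a : ℂ} (ha : ‖a‖ ≤ R - 1) {r : ℝ} (hr : 0 < r) (hr1 : r ≤ 1) :
    IntegrableOn (fun x => inner ℝ (cutField ζ 0 a x) (logField 0 a x)) (Metric.ball a r)ᶜ ∧
    ∫ x in (Metric.ball a r)ᶜ, inner ℝ (cutField ζ 0 a x) (logField 0 a x) =
      2 * Real.pi * Real.log (1 / r) := by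
  have hm : MeasurableSet (Metric.ball a r)ᶜ := Metric.isOpen_ball.measurableSet.compl
  have hint : IntegrableOn (fun x => inner ℝ (cutField ζ 0 a x) (logField 0 a x))
      (Metric.ball a r)ᶜ := by
    have hGi : Integrable ((Metric.ball (0 : ℂ) (2 * R)).indicator
        (fun x => ‖x - a‖⁻¹ * r⁻¹ + 5 * R * M * r⁻¹)) := by
      refine IntegrableOn.integrable_indicator ?_ Metric.isOpen_ball.measurableSet
      exact ((integrableOn_inv_norm_sub a Metric.isBounded_ball).mul_const _).add
        (integrableOn_const (by finiteness))
    refine hGi.integrableOn.mono'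
      (((measurable_cutField hζ 0 a).inner (measurable_logField 0 a)).aestronglyMeasurable) ?_
    filter_upwards [ae_restrict_mem hm] with x hx
    have hx' : r ≤ ‖x - a‖ := by simpa [dist_eq_norm] using hx
    refine (norm_inner_le_norm _ _).trans ?_
    have h1 := norm_cutField_le hζ hR (δ := 0) (by simp; linarith) ha x
    rw [norm_logField_zero]
    refine (mul_le_mul h1 (inv_anti₀ hr hx') (by positivity) ((norm_nonneg _).trans h1)).trans
      (le_of_eq ?_)
    by_cases hx : x ∈ Metric.ball (0 : ℂ) (2 * R)
    · simp only [Set.indicator_of_mem hx]; ring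
    · simp only [Set.indicator_of_notMem hx, zero_mul]
  refine ⟨hint, ?_⟩
  have hne : ∀ x, r ≤ ‖x - a‖ → x ≠ a := by
    rintro x hx rfl
    simp at hx; linarith
  have hgrad : ∀ x, r ≤ ‖x - a‖ →
      planeGrad (fun y => ζ y * logPot 0 a y) x = cutField ζ 0 a x := fun x hx =>
    planeGrad_mul_logPot (hζ.differentiableAt x) (sq_add_sq_ne_zero_of_ne (hne x hx))
  have hdiff : ∀ x, r ≤ ‖x - a‖ → DifferentiableAt ℝ (fun y => ζ y * logPot 0 a y) x := fun x hx =>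
    (hζ.differentiableAt x).mul
      ((contDiffAt_logPot (sq_add_sq_ne_zero_of_ne (hne x hx))).differentiableAt (by simp))
  have hmo : MeasurableSet {x : ℂ | r < ‖x - a‖} :=
    (isOpen_lt continuous_const (by fun_prop)).measurableSet
  have hsub : {x : ℂ | r < ‖x - a‖} ⊆ (Metric.ball a r)ᶜ := fun x hx => by
    simpa [dist_eq_norm] using le_of_lt hx
  have h2 := setIntegral_inner_planeGrad_logField (f := fun y => ζ y * logPot 0 a y) (b := a)
    hr.le (fun x hx => hdiff x (le_of_lt hx)) (fun x hx => (hdiff x hx).continuousAt.continuousWithinAt)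
    hζ.hasCompactSupport.mul_right
    ((hint.mono_set hsub).congr_fun (fun x hx => by simp only [hgrad x (le_of_lt hx)]) hmo)
  rw [setIntegral_congr_fun hmo (fun x hx => by rw [hgrad x (le_of_lt hx)])] at h2
  have h3 : ∀ θ, ζ (polarPt a 1 θ r) * logPot 0 a (polarPt a 1 θ r) = Real.log r := by
    intro θ
    have h4 : ‖polarPt a 1 θ r - a‖ = r := norm_polarPt_sub a (by simp) θ hr.le
    rw [logPot_zero, h4, hζ.eq_one, one_mul]
    have := norm_sub_norm_le (polarPt a 1 θ r) a
    linarith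
  simp only [h3, integral_const_circle] at h2
  rw [show 2 * Real.pi * Real.log (1 / r) = -(2 * Real.pi * Real.log r) by
    rw [one_div, Real.log_inv]; ring, ← h2]
  refine setIntegral_congr_set ?_
  have h5 : volume (Metric.sphere a r) = 0 := Measure.addHaar_sphere _ _ _
  refine (ae_eq_set.2 ⟨measure_mono_null ?_ h5, ?_⟩)
  · rintro x ⟨hx, hx'⟩
    have h6 : r ≤ dist x a := by simpa using hx
    have h7 : dist x a ≤ r := by simpa [dist_eq_norm] using hx'
    exact le_antisymm h7 h6
  · rw [Set.sdiff_eq_empty.2 hsub]; simp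

/-! ### Phases of the canonical harmonic map -/

lemma inner_logField_zero (a x v : ℂ) : inner ℝ (logField 0 a x) v = (v / (x - a)).re := by
  rw [logField_zero, Complex.div_re, ← Complex.normSq_eq_norm_sq, ← Complex.real_smul,
    real_inner_smul_left, real_inner_eq]
  ring

lemma inner_I_mul_logField_zero (a x v : ℂ) :
    inner ℝ (Complex.I * logField 0 a x) v = (v / (x - a)).im := by
  rw [logField_zero, Complex.div_im, ← Complex.normSq_eq_norm_sq, mul_left_comm, ← Complex.real_smul,
    real_inner_smul_left, real_inner_eq]
  simp
  ring

/-- `f` has phase gradient `G` at `x`: to first order `f (x + v) = f x (1 + i ⟪G, v⟫)`. -/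
def HasPhaseGradAt (f : ℂ → ℂ) (G x : ℂ) : Prop :=
  ∃ L : ℂ →L[ℝ] ℂ, HasFDerivAt f L x ∧ ∀ v, L v = f x * (Complex.I * (inner ℝ G v : ℝ))

lemma HasPhaseGradAt.mul {f g : ℂ → ℂ} {F G x : ℂ} (hf : HasPhaseGradAt f F x)
    (hg : HasPhaseGradAt g G x) : HasPhaseGradAt (fun y => f y * g y) (F + G) x := by
  obtain ⟨L, hL, hLv⟩ := hf
  obtain ⟨K, hK, hKv⟩ := hg
  refine ⟨_, hL.fun_mul hK, fun v => ?_⟩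
  simp only [_root_.add_apply, _root_.smul_apply, hLv, hKv, smul_eq_mul,
    inner_add_left, Complex.ofReal_add]
  ring

lemma HasPhaseGradAt.prod {ι : Type*} (s : Finset ι) {f : ι → ℂ → ℂ} {G : ι → ℂ} {x : ℂ}
    (h : ∀ i ∈ s, HasPhaseGradAt (f i) (G i) x) :
    HasPhaseGradAt (fun y => ∏ i ∈ s, f i y) (∑ i ∈ s, G i) x := by
  classical
  induction s using Finset.induction_on with
  | empty => exact ⟨0, by simpa using hasFDerivAt_const (1 : ℂ) x, by simp⟩
  | insert i s hi ih =>
    simp only [Finset.prod_insert hi, Finset.sum_insert hi]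
    exact (h i (by simp)).mul (ih fun j hj => h j (by simp [hj]))

lemma hasPhaseGradAt_exp {ψ : ℂ → ℝ} {x : ℂ} (h : DifferentiableAt ℝ ψ x) :
    HasPhaseGradAt (fun y => Complex.exp (Complex.I * (ψ y : ℂ))) (planeGrad ψ x) x := by
  have h1 : HasFDerivAt (fun y => (ψ y : ℂ)) (Complex.ofRealCLM.comp (fderiv ℝ ψ x)) x :=
    Complex.ofRealCLM.hasFDerivAt.comp x h.hasFDerivAt
  refine ⟨_, (h1.const_mul Complex.I).cexp, fun v => ?_⟩
  rw [inner_planeGrad]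
  simp

lemma norm_sub_eq_exp_logPot {a x : ℂ} (h : x ≠ a) : ‖x - a‖ = Real.exp (logPot 0 a x) := by
  rw [logPot_zero, Real.exp_log (norm_pos_iff.2 (sub_ne_zero.2 h))]

lemma hasPhaseGradAt_sub_div_norm {a x : ℂ} (h : x ≠ a) :
    HasPhaseGradAt (fun y => (y - a) / (‖y - a‖ : ℂ)) (Complex.I * logField 0 a x) x := by
  have hne : ‖x - a‖ ^ 2 + (0 : ℝ) ^ 2 ≠ 0 := sq_add_sq_ne_zero_of_ne h
  have hd := ((contDiffAt_logPot hne).differentiableAt (by simp)).hasFDerivAt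
  have h1 : HasFDerivAt (fun y => ((-logPot 0 a y : ℝ) : ℂ))
      (Complex.ofRealCLM.comp (-fderiv ℝ (logPot 0 a) x)) x :=
    Complex.ofRealCLM.hasFDerivAt.comp x hd.neg
  have h2 := ((hasFDerivAt_id (𝕜 := ℝ) x).sub_const a).fun_mul h1.cexp
  have hev : (fun y => (y - a) / (‖y - a‖ : ℂ)) =ᶠ[𝓝 x]
      fun y => (y - a) * Complex.exp ((-logPot 0 a y : ℝ) : ℂ) := by
    filter_upwards [isOpen_ne.mem_nhds h] with y hy
    rw [norm_sub_eq_exp_logPot hy, div_eq_mul_inv]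
    push_cast
    rw [← Complex.exp_neg]
  refine ⟨_, h2.congr_of_eventuallyEq hev, fun v => ?_⟩
  rw [inner_I_mul_logField_zero, hev.self_of_nhds]
  have h3 : fderiv ℝ (logPot 0 a) x v = (v / (x - a)).re := by
    rw [← inner_planeGrad, planeGrad_logPot hne, inner_logField_zero]
  have h4 : v = (x - a) * (v / (x - a)) := by field_simp [sub_ne_zero.2 h]
  have h5 := Complex.re_add_im (v / (x - a))
  set w := v / (x - a)
  simp [h3]
  rw [h4]
  linear_combination (- (x - a) * Complex.exp (-(logPot 0 a x : ℂ))) * h5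

lemma HasPhaseGradAt.gradSq_eq {f : ℂ → ℂ} {G x : ℂ} (h : HasPhaseGradAt f G x)
    (h1 : ‖f x‖ = 1) : gradSq f x = ‖G‖ ^ 2 := by
  obtain ⟨L, hL, hLv⟩ := h
  rw [gradSq, hL.fderiv, hLv, hLv, ← Complex.normSq_eq_norm_sq G, Complex.normSq_apply]
  simp only [norm_mul, h1, Complex.norm_I, Complex.norm_real, one_mul, Real.norm_eq_abs, sq_abs,
    real_inner_eq]
  simp; ring

lemma norm_prod_sub_div_norm {n : ℕ} {a : Fin n → ℂ} {x : ℂ} (hx : x ∉ Set.range a) :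
    ‖∏ j, (x - a j) / (‖x - a j‖ : ℂ)‖ = 1 := by
  rw [norm_prod]
  refine Finset.prod_eq_one fun j _ => ?_
  have : ‖x - a j‖ ≠ 0 := norm_ne_zero_iff.2 (sub_ne_zero.2 fun h => hx ⟨j, h.symm⟩)
  rw [norm_div, Complex.norm_real, norm_norm, div_self this]

lemma norm_exp_I_mul_ofReal (t : ℝ) : ‖Complex.exp (Complex.I * (t : ℂ))‖ = 1 := by
  rw [mul_comm]; exact Complex.norm_exp_ofReal_mul_I t

/-- The energy density of a map with vortices `a` and regular phase `ψ`. -/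
lemma gradSq_eq_of_eqOn {U : Set ℂ} (hU : IsOpen U) {n : ℕ} {a : Fin n → ℂ} {u : ℂ → ℂ} {ψ : ℂ → ℝ}
    (hψ : DifferentiableOn ℝ ψ U)
    (hu : ∀ x ∈ U \ Set.range a,
      u x = (∏ j, (x - a j) / (‖x - a j‖ : ℂ)) * Complex.exp (Complex.I * (ψ x : ℂ)))
    {x : ℂ} (hx : x ∈ U \ Set.range a) :
    gradSq u x = ‖Complex.I * (∑ j, logField 0 (a j) x) + planeGrad ψ x‖ ^ 2 := by
  have hopen : IsOpen (U \ Set.range a) := hU.sdiff (Set.finite_range a).isClosed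
  have h1 : HasPhaseGradAt
      (fun y => (∏ j, (y - a j) / (‖y - a j‖ : ℂ)) * Complex.exp (Complex.I * (ψ y : ℂ)))
      (∑ j, Complex.I * logField 0 (a j) x + planeGrad ψ x) x :=
    (HasPhaseGradAt.prod Finset.univ fun j _ =>
      hasPhaseGradAt_sub_div_norm fun h => hx.2 ⟨j, h.symm⟩).mul
      (hasPhaseGradAt_exp (hψ.differentiableAt (hU.mem_nhds hx.1)))
  have h2 : gradSq u x = gradSq
      (fun y => (∏ j, (y - a j) / (‖y - a j‖ : ℂ)) * Complex.exp (Complex.I * (ψ y : ℂ))) x := by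
    have : u =ᶠ[𝓝 x]
        fun y => (∏ j, (y - a j) / (‖y - a j‖ : ℂ)) * Complex.exp (Complex.I * (ψ y : ℂ)) := by
      filter_upwards [hopen.mem_nhds hx] with y hy using hu y hy
    simp only [gradSq, this.fderiv_eq]
  rw [h2, h1.gradSq_eq, Finset.mul_sum]
  rw [norm_mul, norm_prod_sub_div_norm hx.2, norm_exp_I_mul_ofReal, one_mul]

/-- Near the complement of a domain containing `0` and `b` the function `(x - b) / x` has a
holomorphic logarithm. -/
lemma exists_log_sub_div {Ω : Set ℂ} (hΩ : IsOpen Ω) (hc : IsPreconnected Ω) (h0 : (0 : ℂ) ∈ Ω)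
    {b : ℂ} (hb : b ∈ Ω) : ∃ N : Set ℂ, IsOpen N ∧ Ωᶜ ⊆ N ∧ ∃ L : ℂ → ℂ, DifferentiableOn ℂ L N ∧
      ∀ x ∈ N, Complex.exp (L x) = (x - b) / x := by
  set P : ℂ → Prop := fun b => ∃ N : Set ℂ, IsOpen N ∧ Ωᶜ ⊆ N ∧ ∃ L : ℂ → ℂ,
    DifferentiableOn ℂ L N ∧ ∀ x ∈ N, Complex.exp (L x) = (x - b) / x
  -- moving `b` by less than its distance to the complement multiplies the function by a factor in
  -- the disc of radius one about `1`, where the principal logarithm is available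
  have step : ∀ b b' ε, (∀ x ∉ Ω, ε ≤ ‖x - b‖) → ‖b - b'‖ < ε → P b → P b' := by
    rintro b b' ε hε hbb ⟨N, hN, hΩN, L, hL, hLe⟩
    refine ⟨N ∩ {x | ‖b - b'‖ < ‖x - b‖}, hN.inter (isOpen_lt continuous_const (by fun_prop)),
      fun x hx => ⟨hΩN hx, hbb.trans_le (hε x hx)⟩,
      fun x => L x + Complex.log (1 + (b - b') / (x - b)), ?_, ?_⟩
    · rintro x ⟨hx, hx'⟩
      have hpos : 0 < ‖x - b‖ := (norm_nonneg _).trans_lt hx'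
      have hs : 1 + (b - b') / (x - b) ∈ Complex.slitPlane := by
        apply Complex.mem_slitPlane_of_norm_lt_one
        rw [norm_div, div_lt_one hpos]; exact hx'
      have hd : DifferentiableAt ℂ (fun x => 1 + (b - b') / (x - b)) x :=
        (differentiableAt_const _).add ((differentiableAt_const _).div
          (differentiableAt_id.sub_const b) (norm_pos_iff.1 hpos))
      exact (((hL x hx).differentiableAt (hN.mem_nhds hx)).add (hd.clog hs)).differentiableWithinAt
    · rintro x ⟨hx, hx'⟩
      have hpos : 0 < ‖x - b‖ := (norm_nonneg _).trans_lt hx'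
      have hxb : x - b ≠ 0 := norm_pos_iff.1 hpos
      have hne : 1 + (b - b') / (x - b) ≠ 0 := by
        apply Complex.slitPlane_ne_zero
        apply Complex.mem_slitPlane_of_norm_lt_one
        rw [norm_div, div_lt_one hpos]; exact hx'
      rw [Complex.exp_add, hLe x hx, Complex.exp_log hne]
      field_simp
      ring
  have hP0 : P 0 := by
    refine ⟨{0}ᶜ, isOpen_compl_singleton, fun x hx h => hx (h ▸ h0), fun _ => 0,
      differentiableOn_const _, fun x hx => ?_⟩
    have : x ≠ 0 := hx
    simp [this]
  -- the set of `b` in `Ω` with a logarithm contains `0`, and it is open and closed in `Ω`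
  have hnear : ∀ b ∈ Ω, ∃ ε > 0, ∀ b' ∈ Metric.ball b ε, b' ∈ Ω ∧ (P b ↔ P b') := by
    intro b hb
    obtain ⟨ε, hε, hball⟩ := Metric.isOpen_iff.1 hΩ b hb
    refine ⟨ε / 2, half_pos hε, fun b' hb' => ?_⟩
    rw [Metric.mem_ball, dist_eq_norm] at hb'
    have h1 : ∀ x ∉ Ω, ε ≤ ‖x - b‖ := fun x hx => by
      by_contra h
      exact hx (hball (by simpa [dist_eq_norm] using h))
    refine ⟨hball (by simp [dist_eq_norm]; linarith), step b b' ε h1 ?_, step b' b (ε / 2) ?_ hb'⟩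
    · rw [norm_sub_rev]; linarith
    · intro x hx
      have h2 := norm_sub_le_norm_sub_add_norm_sub x b' b
      have h3 := h1 x hx
      linarith
  have hU : IsOpen {b | b ∈ Ω ∧ P b} := Metric.isOpen_iff.2 fun b ⟨hb, hPb⟩ => by
    obtain ⟨ε, hε, h⟩ := hnear b hb
    exact ⟨ε, hε, fun b' hb' => ⟨(h b' hb').1, (h b' hb').2.1 hPb⟩⟩
  have hV : IsOpen {b | b ∈ Ω ∧ ¬ P b} := Metric.isOpen_iff.2 fun b ⟨hb, hPb⟩ => by
    obtain ⟨ε, hε, h⟩ := hnear b hb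
    exact ⟨ε, hε, fun b' hb' => ⟨(h b' hb').1, fun h' => hPb ((h b' hb').2.2 h')⟩⟩
  have := hc.subset_left_of_subset_union hU hV
    (Set.disjoint_left.2 fun x hx hx' => hx'.2 hx.2)
    (fun x hx => by by_cases h : P x; exacts [Or.inl ⟨hx, h⟩, Or.inr ⟨hx, h⟩]) ⟨0, h0, h0, hP0⟩
  exact (this hb).2

/-- The phase on a neighbourhood of the complement of `Ω` that continues the Dirichlet datum. Apart from
the singular fields of the vortices, its gradient is of order `n` there. -/
lemma exists_exterior_phase {Ω : Set ℂ} (hΩ : IsOpen Ω) (hc : IsPreconnected Ω) (h0 : (0 : ℂ) ∈ Ω)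
    {Φ : ℂ → ℝ} (hΦ : ContDiff ℝ 2 Φ) {n : ℕ} {a : Fin n → ℂ} (ha : ∀ j, a j ∈ Ω) :
    ∃ N : Set ℂ, IsOpen N ∧ Ωᶜ ⊆ N ∧ ∃ g : ℂ → ℝ, ContDiffOn ℝ 2 g N ∧
      (∀ x ∈ N, planeGrad g x = planeGrad Φ x + n * (Complex.I * logField 0 0 x) -
        Complex.I * ∑ j, logField 0 (a j) x) ∧
      ∀ x ∈ N, (∏ j, (x - a j) / (‖x - a j‖ : ℂ)) * Complex.exp (Complex.I * (g x : ℂ)) =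
        (x / (‖x‖ : ℂ)) ^ n * Complex.exp (Complex.I * (Φ x : ℂ)) := by
  choose N hN hΩN L hL hLe using fun j => exists_log_sub_div hΩ hc h0 (ha j)
  have hne : ∀ j, ∀ x ∈ N j, x ≠ 0 ∧ x - a j ≠ 0 := by
    intro j x hx
    have := Complex.exp_ne_zero (L j x)
    rw [hLe j x hx] at this
    exact ⟨(div_ne_zero_iff.1 this).2, (div_ne_zero_iff.1 this).1⟩
  have hLd : ∀ j, ∀ x ∈ N j, HasDerivAt (L j) (1 / (x - a j) - 1 / x) x := by
    intro j x hx
    obtain ⟨hx0, hxa⟩ := hne j x hx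
    have h1 := ((hL j x hx).differentiableAt ((hN j).mem_nhds hx)).hasDerivAt
    have h2 : HasDerivAt (fun y => (y - a j) / y) (a j / x ^ 2) x := by
      have := ((hasDerivAt_id x).sub_const (a j)).div (hasDerivAt_id x) hx0
      refine this.congr_deriv ?_
      simp
    have h3 : HasDerivAt (fun y => (y - a j) / y) (Complex.exp (L j x) * deriv (L j) x) x := by
      refine h1.cexp.congr_of_eventuallyEq ?_
      filter_upwards [(hN j).mem_nhds hx] with y hy using (hLe j y hy).symm
    have h4 := h2.unique h3
    rw [hLe j x hx] at h4
    have h5 : deriv (L j) x = 1 / (x - a j) - 1 / x := by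
      field_simp at h4 ⊢
      linear_combination -h4
    rwa [h5] at h1
  have hIm : ∀ j, ∀ x ∈ N j, HasFDerivAt (fun y => (L j y).im)
      (Complex.imCLM.comp ((ContinuousLinearMap.toSpanSingleton ℂ
        (1 / (x - a j) - 1 / x)).restrictScalars ℝ)) x :=
    fun j x hx => Complex.imCLM.hasFDerivAt.comp x ((hLd j x hx).hasFDerivAt.restrictScalars ℝ)
  have hImg : ∀ j, ∀ x ∈ N j, planeGrad (fun y => (L j y).im) x =
      Complex.I * logField 0 (a j) x - Complex.I * logField 0 0 x := by
    intro j x hx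
    refine planeGrad_eq_of_hasFDerivAt (hIm j x hx) fun v => ?_
    rw [inner_sub_left, inner_I_mul_logField_zero, inner_I_mul_logField_zero, sub_zero,
      ← Complex.sub_im]
    simp only [ContinuousLinearMap.comp_apply, ContinuousLinearMap.coe_restrictScalars',
      ContinuousLinearMap.toSpanSingleton_apply, Complex.imCLM_apply, smul_eq_mul]
    congr 1
    ring
  set N' : Set ℂ := (⋂ j, N j) ∩ {0}ᶜ
  have hN'o : IsOpen N' := (isOpen_iInter_of_finite hN).inter isOpen_compl_singleton
  have hmem : ∀ x ∈ N', ∀ j, x ∈ N j := fun x hx j => Set.mem_iInter.1 hx.1 j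
  refine ⟨N', hN'o, fun x hx => ⟨Set.mem_iInter.2 fun j => hΩN j hx, fun h => hx (h ▸ h0)⟩,
    fun x => Φ x - ∑ j, (L j x).im, ?_, ?_, ?_⟩
  · refine hΦ.contDiffOn.sub (ContDiffOn.sum fun j _ x hx => ?_)
    have h1 : ContDiffAt ℂ 2 (L j) x :=
      ((hL j).contDiffOn (hN j)).contDiffAt ((hN j).mem_nhds (hmem x hx j))
    exact (Complex.imCLM.contDiff.contDiffAt.comp x (h1.restrict_scalars ℝ)).contDiffWithinAt
  · intro x hx
    have hd : ∀ j ∈ Finset.univ, DifferentiableAt ℝ (fun y => (L j y).im) x := fun j _ =>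
      (hIm j x (hmem x hx j)).differentiableAt
    rw [planeGrad_sub (hΦ.differentiable (by norm_num) x) (DifferentiableAt.fun_sum hd),
      planeGrad_sum _ hd, Finset.sum_congr rfl fun j _ => hImg j x (hmem x hx j),
      Finset.sum_sub_distrib, ← Finset.mul_sum]
    simp
    ring
  · intro x hx
    have hx0 : x ≠ 0 := hx.2
    have h1 : ∀ j, (x - a j) / (‖x - a j‖ : ℂ) =
        x / (‖x‖ : ℂ) * Complex.exp (Complex.I * ((L j x).im : ℂ)) := by
      intro j
      have hxa := (hne j x (hmem x hx j)).2
      have h2 := hLe j x (hmem x hx j)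
      have h3 : Complex.exp (Complex.I * ((L j x).im : ℂ)) * (‖Complex.exp (L j x)‖ : ℂ) =
          Complex.exp (L j x) := by
        rw [Complex.norm_exp, Complex.ofReal_exp, ← Complex.exp_add]
        congr 1
        conv_rhs => rw [← Complex.re_add_im (L j x)]
        ring
      rw [h2, norm_div] at h3
      have hn1 : (‖x - a j‖ : ℂ) ≠ 0 := by exact_mod_cast norm_ne_zero_iff.2 hxa
      push_cast at h3
      field_simp at h3 ⊢
      linear_combination -h3
    simp_rw [h1]
    rw [Finset.prod_mul_distrib, Finset.prod_const, Finset.card_univ, Fintype.card_fin,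
      ← Complex.exp_sum, mul_assoc, ← Complex.exp_add]
    congr 2
    push_cast
    rw [mul_sub, Finset.mul_sum]
    ring

/-! ### Existence of the renormalized energy -/

lemma measurableSet_perforated {Ω : Set ℂ} (hΩ : IsOpen Ω) {n : ℕ} (a : Fin n → ℂ) (r : ℝ) :
    MeasurableSet (perforated Ω a r) :=
  hΩ.measurableSet.diff (isOpen_iUnion fun _ => Metric.isOpen_ball).measurableSet

lemma mem_perforated {Ω : Set ℂ} {n : ℕ} {a : Fin n → ℂ} {r : ℝ} {x : ℂ} :
    x ∈ perforated Ω a r ↔ x ∈ Ω ∧ ∀ j, r ≤ ‖x - a j‖ := by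
  simp [perforated, dist_eq_norm]

lemma perforated_subset_diff_range {Ω : Set ℂ} {n : ℕ} {a : Fin n → ℂ} {r : ℝ} (hr : 0 < r) :
    perforated Ω a r ⊆ Ω \ Set.range a := by
  intro x hx
  rw [mem_perforated] at hx
  refine ⟨hx.1, ?_⟩
  rintro ⟨j, rfl⟩
  have := hx.2 j
  simp at this
  linarith

lemma tendsto_setIntegral_perforated {Ω : Set ℂ} (hΩ : IsOpen Ω) {n : ℕ} (a : Fin n → ℂ)
    {f : ℂ → ℝ} (hf : IntegrableOn f Ω) :
    Tendsto (fun r => ∫ x in perforated Ω a r, f x) (𝓝[>] 0) (𝓝 (∫ x in Ω, f x)) := by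
  have h1 : ∀ r, ∫ x in perforated Ω a r, f x =
      ∫ x in Ω, (perforated Ω a r).indicator f x := fun r => by
    rw [setIntegral_indicator (measurableSet_perforated hΩ a r),
      Set.inter_eq_self_of_subset_right (fun x hx => hx.1)]
  simp_rw [h1]
  refine tendsto_integral_filter_of_dominated_convergence (fun x => ‖f x‖)
    (Eventually.of_forall fun r =>
      hf.aestronglyMeasurable.indicator (measurableSet_perforated hΩ a r))
    (Eventually.of_forall fun r => Eventually.of_forall fun x => norm_indicator_le_norm_self _ _)
    hf.norm ?_
  have hnull : ∀ᵐ x ∂(volume.restrict Ω), x ∉ Set.range a :=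
    ae_restrict_of_ae (measure_eq_zero_iff_ae_notMem.1 ((Set.finite_range a).measure_zero volume))
  filter_upwards [hnull, ae_restrict_mem hΩ.measurableSet] with x hx hxΩ
  refine tendsto_const_nhds.congr' ?_
  have h2 : ∀ j, ∀ᶠ r : ℝ in 𝓝[>] 0, r ≤ ‖x - a j‖ := fun j => by
    have : 0 < ‖x - a j‖ := norm_pos_iff.2 (sub_ne_zero.2 fun h => hx ⟨j, h.symm⟩)
    exact nhdsWithin_le_nhds (Iic_mem_nhds this)
  filter_upwards [eventually_all.2 h2] with r hr
  rw [Set.indicator_of_mem (mem_perforated.2 ⟨hxΩ, hr⟩)]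

lemma cutField_eq_logField {R M : ℝ} {ζ : ℂ → ℝ} (hζ : IsPlateau R M ζ) (δ : ℝ) (a : ℂ) {x : ℂ}
    (hx : ‖x‖ ≤ R) : cutField ζ δ a x = logField δ a x := by
  rw [cutField, hζ.eq_one hx, hζ.grad_eq_zero_of_le hx]; simp

/-- The self energy of one vortex: the divergent part of its Dirichlet integral is `2π log (1/r)`. -/
lemma tendsto_setIntegral_logField_self {Ω : Set ℂ} (hΩ : IsOpen Ω) {R M : ℝ} {ζ : ℂ → ℝ}
    (hζ : IsPlateau R M ζ) (hR : 1 ≤ R) (hΩR : ∀ x ∈ Ω, ‖x‖ ≤ R - 1) {n : ℕ} {a : Fin n → ℂ}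
    (ha : IsConfiguration Ω a) (j : Fin n) :
    Tendsto (fun r : ℝ => (∫ x in perforated Ω a r, inner ℝ (logField 0 (a j) x) (logField 0 (a j) x))
      - 2 * Real.pi * Real.log (1 / r)) (𝓝[>] 0)
      (𝓝 (-∫ x in Ωᶜ, inner ℝ (cutField ζ 0 (a j) x) (logField 0 (a j) x))) := by
  set F : ℂ → ℝ := fun x => inner ℝ (cutField ζ 0 (a j) x) (logField 0 (a j) x) with hF
  have haj := hΩR _ (ha.2 j)
  obtain ⟨δ, ⟨hδ0, hδ1⟩, hδ⟩ : ∃ δ : ℝ, (0 < δ ∧ δ ≤ 1) ∧ ∀ k, k ≠ j → 2 * δ ≤ ‖a j - a k‖ := by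
    have h1 : ∀ k, ∀ᶠ δ : ℝ in 𝓝[>] 0, k ≠ j → 2 * δ ≤ ‖a j - a k‖ := by
      intro k
      by_cases hk : k = j
      · simp [hk]
      · have h2 : 0 < ‖a j - a k‖ := norm_pos_iff.2 (sub_ne_zero.2 fun h => hk (ha.1 h).symm)
        filter_upwards [Ioo_mem_nhdsGT (half_pos h2)] with δ hδ _
        linarith [hδ.2]
    obtain ⟨δ, h3, h4⟩ := ((eventually_all.2 h1).and (Ioo_mem_nhdsGT zero_lt_one)).exists
    exact ⟨δ, ⟨h4.1, h4.2.le⟩, h3⟩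
  -- outside a fixed disc about `a j` the density is integrable, so that removing the small discs about
  -- the other vortices costs nothing in the limit
  set B : Set ℂ := (Metric.ball (a j) δ)ᶜ with hB
  have hBm : MeasurableSet B := Metric.isOpen_ball.measurableSet.compl
  have hFB : Integrable (B.indicator F) :=
    (setIntegral_inner_cutField_logField_self hζ hR haj hδ0 hδ1).1.integrable_indicator hBm
  have hlim : Tendsto (fun r => (∫ x in perforated Ω a r, B.indicator F x) - (∫ x in Ω, B.indicator F x)
      - ∫ x in Ωᶜ, F x) (𝓝[>] 0) (𝓝 (-∫ x in Ωᶜ, F x)) := by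
    have := ((tendsto_setIntegral_perforated hΩ a hFB.integrableOn).sub_const
      (∫ x in Ω, B.indicator F x)).sub_const (∫ x in Ωᶜ, F x)
    simpa using this
  refine hlim.congr' ?_
  obtain ⟨ε, hε, hball⟩ := Metric.isOpen_iff.1 hΩ _ (ha.2 j)
  filter_upwards [Ioo_mem_nhdsGT (lt_min hδ0 hε)] with r hr
  have hr0 := hr.1
  have hrδ : r < δ := hr.2.trans_le (min_le_left _ _)
  have hrε : r < ε := hr.2.trans_le (min_le_right _ _)
  obtain ⟨hFi, hFr⟩ := setIntegral_inner_cutField_logField_self hζ hR haj hr0 (hrδ.le.trans hδ1)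
  have hPm := measurableSet_perforated hΩ a r
  have hPsub : perforated Ω a r ⊆ (Metric.ball (a j) r)ᶜ := fun x hx => by
    simpa [dist_eq_norm] using (mem_perforated.1 hx).2 j
  have hcsub : Ωᶜ ⊆ (Metric.ball (a j) r)ᶜ :=
    Set.compl_subset_compl.2 ((Metric.ball_subset_ball hrε.le).trans hball)
  set D : Set ℂ := (Ω \ perforated Ω a r) \ Metric.ball (a j) r with hD
  have hDm : MeasurableSet D := (hΩ.measurableSet.diff hPm).diff Metric.isOpen_ball.measurableSet
  have hDsub : D ⊆ (Metric.ball (a j) r)ᶜ := fun x hx => hx.2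
  have hdec : (Metric.ball (a j) r)ᶜ = (perforated Ω a r ∪ Ωᶜ) ∪ D := by
    ext x
    have h1 := @hPsub x
    have h2 := @hcsub x
    simp only [hD, Set.mem_union, Set.mem_sdiff, Set.mem_compl_iff] at h1 h2 ⊢
    tauto
  have hsum : (∫ x in perforated Ω a r, F x) + (∫ x in Ωᶜ, F x) + ∫ x in D, F x =
      2 * Real.pi * Real.log (1 / r) := by
    rw [← hFr, hdec, setIntegral_union _ hDm, setIntegral_union _ hΩ.measurableSet.compl]
    · exact hFi.mono_set hPsub
    · exact hFi.mono_set hcsub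
    · exact Set.disjoint_left.2 fun x hx hx' => hx' hx.1
    · exact (hFi.mono_set hPsub).union (hFi.mono_set hcsub)
    · exact hFi.mono_set hDsub
    · refine Set.disjoint_left.2 fun x hx hx' => ?_
      rcases hx with h | h
      · exact hx'.1.2 h
      · exact h hx'.1.1
  -- the discs about the other vortices lie in `B`
  have hDB : ∫ x in D, F x = (∫ x in Ω, B.indicator F x) - ∫ x in perforated Ω a r, B.indicator F x := by
    rw [← setIntegral_sdiff hPm hFB.integrableOn (fun x hx => hx.1)]
    have h1 : ∫ x in D, F x = ∫ x in D, B.indicator F x := by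
      refine setIntegral_congr_fun hDm fun x hx => ?_
      have : x ∈ B := by
        obtain ⟨⟨hxΩ, hxP⟩, hxj⟩ := hx
        rw [mem_perforated] at hxP
        push Not at hxP
        obtain ⟨k, hk⟩ := hxP hxΩ
        have hkj : k ≠ j := by
          rintro rfl
          exact hxj (by simpa [dist_eq_norm] using hk)
        have h3 := hδ k hkj
        have h4 := norm_sub_le_norm_sub_add_norm_sub (a j) x (a k)
        rw [norm_sub_rev (a j) x] at h4
        simp only [hB, Set.mem_compl_iff, Metric.mem_ball, dist_eq_norm, not_lt]
        linarith
      simp only [Set.indicator_of_mem this]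
    rw [h1]
    symm
    refine setIntegral_eq_of_subset_of_forall_sdiff_eq_zero (hΩ.measurableSet.diff hPm)
      (fun x hx => hx.1) fun x hx => ?_
    have : x ∈ Metric.ball (a j) r := by
      by_contra h
      exact hx.2 ⟨hx.1, h⟩
    exact Set.indicator_of_notMem (fun h : x ∈ B => h (Metric.ball_subset_ball hrδ.le this)) _
  have hPF : ∫ x in perforated Ω a r, F x =
      ∫ x in perforated Ω a r, inner ℝ (logField 0 (a j) x) (logField 0 (a j) x) := by
    refine setIntegral_congr_fun hPm fun x hx => ?_
    simp only [hF]
    rw [cutField_eq_logField hζ 0 (a j) ((hΩR x hx.1).trans (by linarith))]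
  rw [← hPF]
  linarith

/-- The renormalized energy of the potential part of the canonical map. -/
lemma tendsto_setIntegral_sum_logField {Ω : Set ℂ} (hΩ : IsOpen Ω) {R M : ℝ} {ζ : ℂ → ℝ}
    (hζ : IsPlateau R M ζ) (hR : 1 ≤ R) (hΩR : ∀ x ∈ Ω, ‖x‖ ≤ R - 1) {n : ℕ} {a : Fin n → ℂ}
    (ha : IsConfiguration Ω a) :
    Tendsto (fun r : ℝ => (∫ x in perforated Ω a r, (1 / 2) * ‖∑ j, logField 0 (a j) x‖ ^ 2)
      - Real.pi * n * Real.log (1 / r)) (𝓝[>] 0)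
      (𝓝 (-Real.pi * (∑ j, ∑ k, Real.log ‖a j - a k‖) - (1 / 2) *
        ∑ j, ∑ k, ∫ x in Ωᶜ, inner ℝ (cutField ζ 0 (a j) x) (logField 0 (a k) x))) := by
  -- the formula includes the case `j = k`, where the logarithm is `log 0 = 0`
  have hpair : ∀ j k, Tendsto (fun r : ℝ =>
      (∫ x in perforated Ω a r, inner ℝ (logField 0 (a j) x) (logField 0 (a k) x))
      - if j = k then 2 * Real.pi * Real.log (1 / r) else 0) (𝓝[>] 0)
      (𝓝 (-(2 * Real.pi * Real.log ‖a j - a k‖)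
        - ∫ x in Ωᶜ, inner ℝ (cutField ζ 0 (a j) x) (logField 0 (a k) x))) := by
    intro j k
    by_cases hjk : j = k
    · subst hjk
      simpa using tendsto_setIntegral_logField_self hΩ hζ hR hΩR ha j
    · have hne : a j ≠ a k := fun h => hjk (ha.1 h)
      obtain ⟨hi, he⟩ := integral_inner_cutField_logField hζ hR (hΩR _ (ha.2 j)) (hΩR _ (ha.2 k)) hne
      have hEq : Set.EqOn (fun x => inner ℝ (cutField ζ 0 (a j) x) (logField 0 (a k) x))
          (fun x => inner ℝ (logField 0 (a j) x) (logField 0 (a k) x)) Ω := fun x hx => by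
        simp only [cutField_eq_logField hζ 0 (a j) ((hΩR x hx).trans (by linarith))]
      have h1 := tendsto_setIntegral_perforated hΩ a
        (hi.integrableOn.congr_fun hEq hΩ.measurableSet)
      rw [← setIntegral_congr_fun hΩ.measurableSet hEq] at h1
      have h2 := integral_add_compl hΩ.measurableSet hi
      rw [he] at h2
      simp only [hjk, if_false, sub_zero]
      convert h1 using 2
      linarith
  have hint : ∀ r > 0, ∀ j k, IntegrableOn
      (fun x => inner ℝ (logField 0 (a j) x) (logField 0 (a k) x)) (perforated Ω a r) := by
    intro r hr j k
    have hb : Bornology.IsBounded (perforated Ω a r) :=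
      (Metric.isBounded_closedBall (x := (0 : ℂ)) (r := R - 1)).subset fun x hx => by
        simpa using hΩR x hx.1
    refine Measure.integrableOn_of_bounded (M := r⁻¹ * r⁻¹) hb.measure_lt_top.ne
      ((measurable_logField 0 (a j)).inner (measurable_logField 0 (a k))).aestronglyMeasurable ?_
    filter_upwards [ae_restrict_mem (measurableSet_perforated hΩ a r)] with x hx
    refine (norm_inner_le_norm _ _).trans ?_
    rw [norm_logField_zero, norm_logField_zero]
    have h1 := (mem_perforated.1 hx).2
    exact mul_le_mul (inv_anti₀ hr (h1 j)) (inv_anti₀ hr (h1 k)) (by positivity) (by positivity)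
  have hsum := (tendsto_finsetSum Finset.univ fun j _ =>
    tendsto_finsetSum Finset.univ fun k _ => hpair j k).const_mul (1 / 2)
  have hval : (1 / 2) * ∑ j, ∑ k, (-(2 * Real.pi * Real.log ‖a j - a k‖)
        - ∫ x in Ωᶜ, inner ℝ (cutField ζ 0 (a j) x) (logField 0 (a k) x)) =
      -Real.pi * (∑ j, ∑ k, Real.log ‖a j - a k‖) - (1 / 2) *
        ∑ j, ∑ k, ∫ x in Ωᶜ, inner ℝ (cutField ζ 0 (a j) x) (logField 0 (a k) x) := by
    simp only [Finset.sum_sub_distrib, Finset.sum_neg_distrib, ← Finset.mul_sum]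
    ring
  rw [hval] at hsum
  refine hsum.congr' ?_
  filter_upwards [self_mem_nhdsWithin] with r hr
  have h1 : ∀ x, (1 / 2) * ‖∑ j, logField 0 (a j) x‖ ^ 2 =
      (1 / 2) * ∑ j, ∑ k, inner ℝ (logField 0 (a j) x) (logField 0 (a k) x) := by
    intro x
    rw [← real_inner_self_eq_norm_sq, sum_inner]
    simp_rw [inner_sum]
  simp_rw [h1]
  rw [integral_const_mul, integral_finsetSum _ fun j _ => integrable_finsetSum _ fun k _ => hint r hr j k]
  simp_rw [integral_finsetSum Finset.univ fun k _ => hint r hr _ k, Finset.sum_sub_distrib]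
  simp
  ring

lemma aestronglyMeasurable_planeGrad {Ω : Set ℂ} (hΩ : IsOpen Ω) {ψ : ℂ → ℝ}
    (hψ : ContDiffOn ℝ 2 ψ Ω) : AEStronglyMeasurable (planeGrad ψ) (volume.restrict Ω) :=
  (continuousOn_planeGrad hΩ (hψ.of_le (by norm_num))).aestronglyMeasurable hΩ.measurableSet

lemma integrableOn_planeGrad {Ω : Set ℂ} (hΩ : IsOpen Ω) (hb : Bornology.IsBounded Ω) {ψ : ℂ → ℝ}
    (hψ : ContDiffOn ℝ 2 ψ Ω) (hψi : IntegrableOn (fun x => ‖planeGrad ψ x‖ ^ 2) Ω) :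
    IntegrableOn (planeGrad ψ) Ω := by
  refine Integrable.mono' ((integrableOn_const (C := (1 : ℝ)) hb.measure_lt_top.ne).add hψi)
    (aestronglyMeasurable_planeGrad hΩ hψ) ?_
  filter_upwards with x
  simp only [Pi.add_apply]
  nlinarith [sq_nonneg (‖planeGrad ψ x‖ - 1)]

lemma integrableOn_inv_norm_mul_planeGrad {Ω : Set ℂ} (hΩ : IsOpen Ω) (hb : Bornology.IsBounded Ω)
    {ψ : ℂ → ℝ} (hψ : ContDiffOn ℝ 2 ψ Ω) (hψi : IntegrableOn (fun x => ‖planeGrad ψ x‖ ^ 2) Ω)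
    {a : ℂ} (ha : a ∈ Ω) : IntegrableOn (fun x => ‖x - a‖⁻¹ * ‖planeGrad ψ x‖) Ω := by
  obtain ⟨ε, hε, hball⟩ := Metric.nhds_basis_closedBall.mem_iff.1 (hΩ.mem_nhds ha)
  obtain ⟨M, hM⟩ := (isCompact_closedBall a ε).exists_bound_of_continuousOn
    ((continuousOn_planeGrad hΩ (hψ.of_le (by norm_num))).mono hball)
  have hi := integrableOn_planeGrad hΩ hb hψ hψi
  refine Integrable.mono' (((integrableOn_inv_norm_sub a hb).const_mul |M|).add
    (hi.norm.const_mul ε⁻¹)) ?_ ?_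
  · have h1 : Measurable fun x : ℂ => ‖x - a‖⁻¹ := by fun_prop
    exact h1.aestronglyMeasurable.mul (aestronglyMeasurable_planeGrad hΩ hψ).norm
  · filter_upwards with x
    simp only [Pi.add_apply]
    rw [Real.norm_of_nonneg (by positivity)]
    by_cases hx : x ∈ Metric.closedBall a ε
    · have h1 : ‖x - a‖⁻¹ * ‖planeGrad ψ x‖ ≤ ‖x - a‖⁻¹ * |M| :=
        mul_le_mul_of_nonneg_left ((hM x hx).trans (le_abs_self M)) (by positivity)
      have h2 : 0 ≤ ε⁻¹ * ‖planeGrad ψ x‖ := by positivity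
      linarith
    · have h1 : ε ≤ ‖x - a‖ := by simpa [dist_eq_norm] using (not_le.1 (by simpa [dist_eq_norm] using hx)).le
      have h2 : ‖x - a‖⁻¹ * ‖planeGrad ψ x‖ ≤ ε⁻¹ * ‖planeGrad ψ x‖ :=
        mul_le_mul_of_nonneg_right (inv_anti₀ hε h1) (norm_nonneg _)
      have h3 : 0 ≤ |M| * ‖x - a‖⁻¹ := by positivity
      linarith

lemma integrableOn_inner_logField_planeGrad {Ω : Set ℂ} (hΩ : IsOpen Ω) (hb : Bornology.IsBounded Ω)
    {ψ : ℂ → ℝ} (hψ : ContDiffOn ℝ 2 ψ Ω) (hψi : IntegrableOn (fun x => ‖planeGrad ψ x‖ ^ 2) Ω)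
    {a : ℂ} (ha : a ∈ Ω) :
    IntegrableOn (fun x => inner ℝ (Complex.I * logField 0 a x) (planeGrad ψ x)) Ω := by
  refine (integrableOn_inv_norm_mul_planeGrad hΩ hb hψ hψi ha).mono' ?_ ?_
  · exact (((measurable_logField 0 a).const_mul Complex.I).aestronglyMeasurable).inner
      (aestronglyMeasurable_planeGrad hΩ hψ)
  · filter_upwards with x
    refine (norm_inner_le_norm _ _).trans (le_of_eq ?_)
    rw [norm_mul, Complex.norm_I, one_mul, norm_logField_zero]

/-- In the expansion of `|i E + ∇ψ|²`, where `E` is the gradient of `∑ log |x - a_j|`, only the term `|E|²`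
diverges. -/
lemma isRenormalizedEnergy_of_phase {Ω : Set ℂ} (hΩ : IsOpen Ω) {R M : ℝ} {ζ : ℂ → ℝ}
    (hζ : IsPlateau R M ζ) (hR : 1 ≤ R) (hΩR : ∀ x ∈ Ω, ‖x‖ ≤ R - 1) {n : ℕ} {a : Fin n → ℂ}
    (ha : IsConfiguration Ω a) {u : ℂ → ℂ} {ψ : ℂ → ℝ} (hψ : ContDiffOn ℝ 2 ψ Ω)
    (hψi : IntegrableOn (fun x => ‖planeGrad ψ x‖ ^ 2) Ω)
    (hu : ∀ x ∈ Ω \ Set.range a,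
      u x = (∏ j, (x - a j) / (‖x - a j‖ : ℂ)) * Complex.exp (Complex.I * (ψ x : ℂ))) :
    IsRenormalizedEnergy Ω a u
      ((-Real.pi * (∑ j, ∑ k, Real.log ‖a j - a k‖) - (1 / 2) *
        ∑ j, ∑ k, ∫ x in Ωᶜ, inner ℝ (cutField ζ 0 (a j) x) (logField 0 (a k) x)) +
        (∑ j, ∫ x in Ω, inner ℝ (Complex.I * logField 0 (a j) x) (planeGrad ψ x)) +
        (1 / 2) * ∫ x in Ω, ‖planeGrad ψ x‖ ^ 2) := by
  have hb : Bornology.IsBounded Ω :=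
    (Metric.isBounded_closedBall (x := (0 : ℂ)) (r := R - 1)).subset fun x hx => by
      simpa using hΩR x hx
  set E : ℂ → ℂ := fun x => ∑ j, logField 0 (a j) x with hE
  have hEm : Measurable E := Finset.measurable_fun_sum _ fun j _ => measurable_logField 0 (a j)
  have hgrad : ∀ r > 0, ∀ x ∈ perforated Ω a r,
      gradSq u x = ‖Complex.I * E x + planeGrad ψ x‖ ^ 2 := fun r hr x hx =>
    gradSq_eq_of_eqOn hΩ (hψ.differentiableOn (by norm_num)) hu (perforated_subset_diff_range hr hx)
  have hPm := measurableSet_perforated hΩ a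
  have hPΩ : ∀ r, perforated Ω a r ⊆ Ω := fun r x hx => hx.1
  have hE2 : ∀ r > 0, IntegrableOn (fun x => ‖E x‖ ^ 2) (perforated Ω a r) := by
    intro r hr
    refine Measure.integrableOn_of_bounded (M := (n * r⁻¹) ^ 2) (hb.subset (hPΩ r)).measure_lt_top.ne
      (hEm.norm.pow_const 2).aestronglyMeasurable ?_
    filter_upwards [ae_restrict_mem (hPm r)] with x hx
    rw [norm_pow, norm_norm]
    refine pow_le_pow_left₀ (norm_nonneg _) ?_ 2
    refine (norm_sum_le _ _).trans ?_
    have h1 : ∀ j ∈ Finset.univ, ‖logField 0 (a j) x‖ ≤ r⁻¹ := fun j _ => by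
      rw [norm_logField_zero]
      exact inv_anti₀ hr ((mem_perforated.1 hx).2 j)
    simpa using Finset.sum_le_card_nsmul _ _ _ h1
  have hcross : IntegrableOn (fun x => inner ℝ (Complex.I * E x) (planeGrad ψ x)) Ω := by
    have : (fun x => inner ℝ (Complex.I * E x) (planeGrad ψ x)) =
        fun x => ∑ j, inner ℝ (Complex.I * logField 0 (a j) x) (planeGrad ψ x) := by
      funext x; rw [hE, Finset.mul_sum, sum_inner]
    rw [this]
    exact integrable_finsetSum _ fun j _ =>
      integrableOn_inner_logField_planeGrad hΩ hb hψ hψi (ha.2 j)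
  have hcrossv : ∫ x in Ω, inner ℝ (Complex.I * E x) (planeGrad ψ x) =
      ∑ j, ∫ x in Ω, inner ℝ (Complex.I * logField 0 (a j) x) (planeGrad ψ x) := by
    rw [← integral_finsetSum _ fun j _ =>
      integrableOn_inner_logField_planeGrad hΩ hb hψ hψi (ha.2 j)]
    refine integral_congr_ae (Eventually.of_forall fun x => ?_)
    simp only [hE, Finset.mul_sum, sum_inner]
  have hexp : ∀ x, ‖Complex.I * E x + planeGrad ψ x‖ ^ 2 =
      ‖E x‖ ^ 2 + 2 * inner ℝ (Complex.I * E x) (planeGrad ψ x) + ‖planeGrad ψ x‖ ^ 2 := fun x => by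
    rw [norm_add_sq_real, norm_mul, Complex.norm_I, one_mul]
  constructor
  · intro r hr
    refine IntegrableOn.congr_fun ?_ (fun x hx => (hgrad r hr x hx).symm) (hPm r)
    simp_rw [hexp]
    exact ((hE2 r hr).add ((hcross.mono_set (hPΩ r)).const_mul 2)).add (hψi.mono_set (hPΩ r))
  · have h1 := tendsto_setIntegral_sum_logField hΩ hζ hR hΩR ha
    have h2 := tendsto_setIntegral_perforated hΩ a hcross
    have h3 := (tendsto_setIntegral_perforated hΩ a hψi).const_mul (1 / 2)
    rw [hcrossv] at h2
    refine ((h1.add h2).add h3).congr' ?_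
    filter_upwards [self_mem_nhdsWithin] with r hr
    have h4 : ∫ x in perforated Ω a r, 1 / 2 * gradSq u x = ∫ x in perforated Ω a r,
        (1 / 2 * ‖E x‖ ^ 2 + inner ℝ (Complex.I * E x) (planeGrad ψ x) +
          1 / 2 * ‖planeGrad ψ x‖ ^ 2) :=
      setIntegral_congr_fun (hPm r) fun x hx => by
        simp only [hgrad r hr x hx, hexp x]
        ring
    rw [h4]
    have i1 := (hE2 r hr).const_mul (1 / 2)
    have i2 := hcross.mono_set (hPΩ r)
    have i3 := (hψi.mono_set (hPΩ r)).const_mul (1 / 2)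
    have i12 : IntegrableOn (fun x => 1 / 2 * ‖E x‖ ^ 2 + inner ℝ (Complex.I * E x) (planeGrad ψ x))
        (perforated Ω a r) := i1.add i2
    rw [integral_add i12 i3, integral_add i1 i2,
      integral_const_mul (1 / 2) fun x => ‖planeGrad ψ x‖ ^ 2]
    ring

/-! ### The lower bound by duality -/

lemma integrable_of_norm_le_indicator {R c : ℝ} {a : ℂ} {s : Set ℂ} {f : ℂ → ℝ} (k : ℝ)
    (hf : AEStronglyMeasurable f (volume.restrict s)) (hs : MeasurableSet s)
    (h : ∀ x ∈ s, ‖f x‖ ≤ (Metric.ball (0 : ℂ) R).indicator (fun x => k * ‖x - a‖⁻¹ + c) x) :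
    IntegrableOn f s := by
  have hi : Integrable ((Metric.ball (0 : ℂ) R).indicator (fun x => k * ‖x - a‖⁻¹ + c)) :=
    IntegrableOn.integrable_indicator (((integrableOn_inv_norm_sub a Metric.isBounded_ball).const_mul k).add
      (integrableOn_const (by finiteness))) Metric.isOpen_ball.measurableSet
  refine hi.integrableOn.mono' hf ?_
  filter_upwards [ae_restrict_mem hs] with x hx using h x hx

/-- The phase gradient `∇ψ` tested against the rotated gradient of a potential: the integral over `Ω`
is determined by the exterior phase `g`. -/
lemma setIntegral_inner_logField_planeGrad_eq {Ω N : Set ℂ} (hΩ : IsOpen Ω) (hN : IsOpen N)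
    (hΩN : Ωᶜ ⊆ N) {R M : ℝ} {ζ : ℂ → ℝ} (hζ : IsPlateau R M ζ) (hR : 1 ≤ R)
    (hΩR : ∀ x ∈ Ω, ‖x‖ ≤ R - 1) {ψ g : ℂ → ℝ} (hψ : ContDiffOn ℝ 2 ψ Ω)
    (hψc : ContinuousOn ψ (closure Ω)) (hψi : IntegrableOn (fun x => ‖planeGrad ψ x‖ ^ 2) Ω)
    (hg : ContDiffOn ℝ 2 g N) (hbd : ∀ x ∈ frontier Ω, Real.cos (ψ x - g x) = 1)
    {δ : ℝ} {b : ℂ} (hδb : δ ≠ 0 ∨ δ = 0 ∧ b ∈ Ω) :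
    ∫ x in Ω, inner ℝ (Complex.I * logField δ b x) (planeGrad ψ x) =
      -∫ x in Ωᶜ, inner ℝ (Complex.I * cutField ζ δ b x) (planeGrad g x) := by
  have hb : Bornology.IsBounded Ω :=
    (Metric.isBounded_closedBall (x := (0 : ℂ)) (r := R - 1)).subset fun x hx => by
      simpa using hΩR x hx
  have hψ1 := integrableOn_planeGrad hΩ hb hψ hψi
  have hΩm := hΩ.measurableSet
  have hpos : ∀ δ : ℝ, δ ≠ 0 → ∫ x in Ω, inner ℝ (Complex.I * logField δ b x) (planeGrad ψ x) =
      -∫ x in Ωᶜ, inner ℝ (Complex.I * cutField ζ δ b x) (planeGrad g x) := by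
    intro δ hδ
    have hgr : ∀ x, planeGrad (fun y => ζ y * logPot δ b y) x = cutField ζ δ b x := fun x =>
      planeGrad_mul_logPot (hζ.differentiableAt x) (by positivity)
    have h := setIntegral_jac_add_compl_eq_zero hΩ hN hΩN hψ hψc hψ1 hg hbd
      (ξ := fun y => ζ y * logPot δ b y)
      (contDiff_infty.1 (hζ.contDiff.mul (contDiff_logPot hδ b)) 2) hζ.hasCompactSupport.mul_right
    simp only [jac, hgr] at h
    rw [setIntegral_congr_fun hΩm (g := fun x => inner ℝ (Complex.I * logField δ b x) (planeGrad ψ x))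
      fun x hx => by
        simp only [cutField_eq_logField hζ δ b ((hΩR x hx).trans (by linarith))]] at h
    linarith
  rcases hδb with h | ⟨rfl, hbΩ⟩
  · exact hpos δ h
  -- a pole in `Ω` is reached as a limit of smoothed poles
  have hnear : ∀ᶠ δ : ℝ in 𝓝[>] 0, 0 < δ ∧ |δ| ≤ 2 * R := by
    filter_upwards [Ioo_mem_nhdsGT (show (0 : ℝ) < 2 * R by linarith)] with δ hδ
    exact ⟨hδ.1, by rw [abs_of_pos hδ.1]; exact hδ.2.le⟩
  have hbR := hΩR b hbΩ
  have hgm : AEStronglyMeasurable (planeGrad g) (volume.restrict Ωᶜ) :=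
    ((continuousOn_planeGrad hN (hg.of_le (by norm_num))).mono hΩN).aestronglyMeasurable hΩm.compl
  have hl1 : Tendsto (fun δ => ∫ x in Ω, inner ℝ (Complex.I * logField δ b x) (planeGrad ψ x)) (𝓝[>] 0)
      (𝓝 (∫ x in Ω, inner ℝ (Complex.I * logField 0 b x) (planeGrad ψ x))) := by
    refine tendsto_integral_filter_of_dominated_convergence _ (Eventually.of_forall fun δ => ?_)
      (Eventually.of_forall fun δ => Eventually.of_forall fun x => ?_)
      (integrableOn_inv_norm_mul_planeGrad hΩ hb hψ hψi hbΩ) (Eventually.of_forall fun x => ?_)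
    · exact (((measurable_logField δ b).const_mul Complex.I).aestronglyMeasurable).inner
        (aestronglyMeasurable_planeGrad hΩ hψ)
    · refine (norm_inner_le_norm _ _).trans ?_
      rw [norm_mul, Complex.norm_I, one_mul]
      exact mul_le_mul_of_nonneg_right (norm_logField_le δ b x) (norm_nonneg _)
    · exact (((tendsto_logField b x).const_mul Complex.I).mono_left nhdsWithin_le_nhds).inner
        tendsto_const_nhds
  obtain ⟨K, hK⟩ := ((isCompact_closedBall (0 : ℂ) (2 * R)).diff hΩ).exists_bound_of_continuousOn
    ((continuousOn_planeGrad hN (hg.of_le (by norm_num))).mono fun x hx => hΩN hx.2)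
  have hl2 : Tendsto (fun δ => ∫ x in Ωᶜ, inner ℝ (Complex.I * cutField ζ δ b x) (planeGrad g x)) (𝓝[>] 0)
      (𝓝 (∫ x in Ωᶜ, inner ℝ (Complex.I * cutField ζ 0 b x) (planeGrad g x))) := by
    have hi : Integrable ((Metric.ball (0 : ℂ) (2 * R)).indicator
        (fun x => |K| * (‖x - b‖⁻¹ + 5 * R * M))) :=
      IntegrableOn.integrable_indicator (((integrableOn_inv_norm_sub b Metric.isBounded_ball).add
        (integrableOn_const (by finiteness))).const_mul _) Metric.isOpen_ball.measurableSet
    refine tendsto_integral_filter_of_dominated_convergence _ (Eventually.of_forall fun δ => ?_)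
      ?_ hi.integrableOn (Eventually.of_forall fun x => ?_)
    · exact (((measurable_cutField hζ δ b).const_mul Complex.I).aestronglyMeasurable).inner hgm
    · filter_upwards [hnear] with δ hδ
      filter_upwards [ae_restrict_mem hΩm.compl] with x hx
      refine (norm_inner_le_norm _ _).trans ?_
      rw [norm_mul, Complex.norm_I, one_mul]
      have h1 := norm_cutField_le hζ hR hδ.2 hbR x
      by_cases hxb : x ∈ Metric.ball (0 : ℂ) (2 * R)
      · rw [Set.indicator_of_mem hxb] at h1 ⊢
        have h2 := (hK x ⟨Metric.ball_subset_closedBall hxb, hx⟩).trans (le_abs_self K)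
        rw [mul_comm |K|]
        exact mul_le_mul h1 h2 (norm_nonneg _) ((norm_nonneg _).trans h1)
      · rw [Set.indicator_of_notMem hxb] at h1 ⊢
        rw [le_antisymm h1 (norm_nonneg _), zero_mul]
    · exact (((tendsto_cutField hζ hbR x).const_mul Complex.I).mono_left nhdsWithin_le_nhds).inner
        tendsto_const_nhds
  refine tendsto_nhds_unique hl1 (hl2.neg.congr' ?_)
  filter_upwards [hnear] with δ hδ
  exact (hpos δ hδ.1.ne').symm

lemma setIntegral_ball_inv_norm_sub_le {R : ℝ} {b : ℂ} (hb : ‖b‖ ≤ R) :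
    ∫ x in Metric.ball (0 : ℂ) (2 * R), ‖x - b‖⁻¹ ≤ ∫ x in Metric.ball (0 : ℂ) (3 * R), ‖x‖⁻¹ := by
  have h1 : ∫ x in Metric.ball (0 : ℂ) (2 * R), ‖x - b‖⁻¹ ≤ ∫ x in Metric.ball b (3 * R), ‖x - b‖⁻¹ := by
    refine setIntegral_mono_set (integrableOn_inv_norm_sub b Metric.isBounded_ball)
      (Eventually.of_forall fun x => by positivity) (Eventually.of_forall fun x hx => ?_)
    change x ∈ Metric.ball b (3 * R)
    replace hx : x ∈ Metric.ball (0 : ℂ) (2 * R) := hx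
    rw [Metric.mem_ball, dist_eq_norm] at hx ⊢
    have := norm_sub_le x b
    rw [sub_zero] at hx
    linarith
  refine h1.trans (le_of_eq ?_)
  have h2 := (measurePreserving_sub_right (volume : Measure ℂ) b).setIntegral_preimage_emb
    (Homeomorph.subRight b).measurableEmbedding (fun x => ‖x‖⁻¹) (Metric.ball 0 (3 * R))
  rw [← h2]
  congr 2
  ext x; simp [dist_eq_norm]

/-- Fields of the size of the gradient of a cut-off potential pair integrably with locally bounded
fields. -/
lemma integrableOn_inner_of_norm_le {s : Set ℂ} (hs : MeasurableSet s) {R k c K : ℝ} {p : ℂ}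
    {V G : ℂ → ℂ} (hV : AEStronglyMeasurable V (volume.restrict s))
    (hG : AEStronglyMeasurable G (volume.restrict s))
    (hVb : ∀ x ∈ s, ‖V x‖ ≤ (Metric.ball (0 : ℂ) R).indicator (fun x => k * ‖x - p‖⁻¹ + c) x)
    (hGb : ∀ x ∈ s, x ∈ Metric.ball (0 : ℂ) R → ‖G x‖ ≤ K) :
    IntegrableOn (fun x => inner ℝ (V x) (G x)) s := by
  refine integrable_of_norm_le_indicator (R := R) (c := c * K) (a := p) (k * K) (hV.inner hG) hs ?_
  intro x hx
  refine (norm_inner_le_norm _ _).trans ?_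
  have h1 := hVb x hx
  by_cases hxR : x ∈ Metric.ball (0 : ℂ) R
  · rw [Set.indicator_of_mem hxR] at h1 ⊢
    refine (mul_le_mul h1 (hGb x hx hxR) (norm_nonneg _) ((norm_nonneg _).trans h1)).trans
      (le_of_eq ?_)
    ring
  · rw [Set.indicator_of_notMem hxR] at h1 ⊢
    rw [le_antisymm h1 (norm_nonneg _), zero_mul]

lemma cos_sub_eq_one_of_exp_eq {s t : ℝ}
    (h : Complex.exp (Complex.I * (s : ℂ)) = Complex.exp (Complex.I * (t : ℂ))) :
    Real.cos (s - t) = 1 := by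
  have h1 : Complex.exp (((s - t : ℝ) : ℂ) * Complex.I) = 1 := by
    push_cast
    rw [sub_mul, Complex.exp_sub, mul_comm _ Complex.I, mul_comm _ Complex.I, h,
      div_self (Complex.exp_ne_zero _)]
  have h2 := congrArg Complex.re h1
  rwa [Complex.exp_ofReal_mul_I_re, Complex.one_re] at h2

lemma norm_logField_le_inv {d : ℝ} (hd : 0 < d) (p x : ℂ) : ‖logField d p x‖ ≤ d⁻¹ := by
  rw [norm_logField, inv_mul_eq_div, div_le_iff₀ (by positivity), inv_mul_eq_div, le_div_iff₀ hd]
  nlinarith [sq_nonneg (‖x - p‖ - d), norm_nonneg (x - p), sq_nonneg (‖x - p‖)]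

lemma exists_norm_logField_le {Ω : Set ℂ} (hΩ : IsOpen Ω) {n : ℕ} {a : Fin n → ℂ}
    (ha : ∀ j, a j ∈ Ω) : ∃ ρ : ℝ, ∀ j, ∀ x ∈ Ωᶜ, ‖logField 0 (a j) x‖ ≤ ρ⁻¹ := by
  have h1 : ∀ j, ∀ᶠ ρ : ℝ in 𝓝[>] 0, ∀ x ∈ Ωᶜ, ρ ≤ ‖x - a j‖ := by
    intro j
    obtain ⟨ε, hε, hb⟩ := Metric.isOpen_iff.1 hΩ _ (ha j)
    filter_upwards [Ioo_mem_nhdsGT hε] with ρ hρ x hx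
    by_contra h
    exact hx (hb (by rw [Metric.mem_ball, dist_eq_norm]; linarith [hρ.2]))
  obtain ⟨ρ, h2, h3⟩ := ((eventually_all.2 h1).and self_mem_nhdsWithin).exists
  refine ⟨ρ, fun j x hx => ?_⟩
  rw [norm_logField_zero]
  exact inv_anti₀ h3 (h2 j x hx)

lemma integrableOn_plateau_mul {R M : ℝ} {ζ : ℂ → ℝ} (hζ : IsPlateau R M ζ) {S : Set ℂ}
    (hS : MeasurableSet S) {E H : ℂ → ℂ} (hE : Measurable E) (hH : Measurable H) {A B : ℝ}
    (hEA : ∀ x ∈ S, ‖E x‖ ≤ A) (hHB : ∀ x, ‖H x‖ ≤ B) (s : ℝ) :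
    IntegrableOn (fun x => ζ x * ((1 / 2) * ‖E x‖ ^ 2 + s * inner ℝ (H x) (E x))) S := by
  have hζm : Measurable ζ := hζ.contDiff.continuous.measurable
  have hm : Measurable (fun x => ζ x * ((1 / 2) * ‖E x‖ ^ 2 + s * inner ℝ (H x) (E x))) :=
    hζm.mul (((hE.norm.pow_const 2).const_mul _).add ((hH.inner hE).const_mul _))
  refine IntegrableOn.of_forall_sdiff_eq_zero (s := S ∩ Metric.ball 0 (2 * R)) ?_ hS ?_
  · refine Measure.integrableOn_of_bounded (M := (1 / 2) * A ^ 2 + |s| * (B * A))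
      (measure_lt_top_of_subset Set.inter_subset_right (by finiteness)).ne hm.aestronglyMeasurable ?_
    filter_upwards [ae_restrict_mem (hS.inter measurableSet_ball)] with x hx
    have h1 := hEA x hx.1
    have h2 := (norm_nonneg _).trans (hHB x)
    rw [norm_mul, Real.norm_of_nonneg (hζ.mem_Icc x).1]
    refine (mul_le_of_le_one_left (norm_nonneg _) (hζ.mem_Icc x).2).trans ((norm_add_le _ _).trans ?_)
    refine add_le_add ?_ ?_
    · rw [Real.norm_of_nonneg (by positivity)]
      gcongr
    · rw [norm_mul, Real.norm_eq_abs]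
      refine mul_le_mul_of_nonneg_left ((norm_inner_le_norm _ _).trans ?_) (abs_nonneg _)
      exact mul_le_mul (hHB x) h1 (norm_nonneg _) h2
  · intro x hx
    have : x ∉ Metric.ball (0 : ℂ) (2 * R) := fun h => hx.2 ⟨hx.1, h⟩
    rw [hζ.eq_zero (by simpa using this), zero_mul]

/-- A bound, off the domain, for the terms that involve the gradient of the cutoff or of the Dirichlet
datum. -/
noncomputable def exteriorError (R B c₀ : ℝ) {n : ℕ} (a : Fin n → ℂ) (p x : ℂ) : ℝ :=
  (Metric.ball (0 : ℂ) (2 * R)).indicator (fun x => (2 * B * n ^ 2 + n * c₀ * ((n + 1) * B)) +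
    n * c₀ * (∑ j, ‖x - a j‖⁻¹ + ‖x - p‖⁻¹)) x

/-- Up to the error, pairing with the gradients of the cut-off potentials gives the pairing with the cutoff
outside the gradients, and the terms with the bounded field `w` are negligible. -/
lemma sub_exteriorError_le {R M : ℝ} {ζ : ℂ → ℝ} (hζ : IsPlateau R M ζ) (hR : 1 ≤ R) {n : ℕ}
    (hn1 : (1 : ℝ) ≤ n) {a : Fin n → ℂ} (ha : ∀ j, ‖a j‖ ≤ R - 1) {s : ℝ} (hs : s ∈ Set.Icc (0 : ℝ) 1)
    {d : ℝ} (hd : 0 < d) (hdR : d ≤ 2 * R) {p : ℂ} (hp : ‖p‖ ≤ R - 1) {c₀ : ℝ} (hc₀ : 0 ≤ c₀) {x w : ℂ}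
    (hw : x ∈ Metric.ball (0 : ℂ) (2 * R) → ‖w‖ ≤ n * c₀) :
    ζ x * ((1 / 2) * ‖∑ j, logField 0 (a j) x‖ ^ 2 +
        s * inner ℝ (logField d p x) (∑ j, logField 0 (a j) x)) - exteriorError R (5 * R * M) c₀ a p x ≤
      (1 / 2) * inner ℝ (∑ j, cutField ζ 0 (a j) x) (∑ j, logField 0 (a j) x) +
        s * inner ℝ (cutField ζ d p x) (∑ j, logField 0 (a j) x) -
        inner ℝ (Complex.I * ∑ j, cutField ζ 0 (a j) x) w -
        s * inner ℝ (Complex.I * cutField ζ d p x) w := by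
  set B := 5 * R * M with hB
  have hBnn : 0 ≤ B := mul_nonneg (by linarith) hζ.nonneg
  have hCj : ∀ j x, ‖cutField ζ 0 (a j) x‖ ≤ (Metric.ball (0 : ℂ) (2 * R)).indicator
      (fun x => ‖x - a j‖⁻¹ + B) x := fun j x =>
    norm_cutField_le hζ hR (by simp; linarith) (ha j) x
  have hCh : ∀ x, ‖cutField ζ d p x‖ ≤ (Metric.ball (0 : ℂ) (2 * R)).indicator
      (fun x => ‖x - p‖⁻¹ + B) x := fun x =>
    norm_cutField_le hζ hR (by rwa [abs_of_pos hd]) hp x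
  set E : ℂ := ∑ j, logField 0 (a j) x with hE
  set C : ℂ := ∑ j, cutField ζ 0 (a j) x with hC
  by_cases hxR : x ∈ Metric.ball (0 : ℂ) (2 * R)
  · have hxR' : ‖x‖ < 2 * R := by simpa using hxR
    -- the terms with the gradient of the cutoff live where the potentials are bounded
    have hcut : ∀ δ b, |δ| ≤ 2 * R → ‖b‖ ≤ R - 1 →
        ζ x * inner ℝ (logField δ b x) E - B * n ≤ inner ℝ (cutField ζ δ b x) E := by
      intro δ b hδ hbR
      rw [cutField, inner_add_left, ← Complex.real_smul, ← Complex.real_smul,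
        real_inner_smul_left, real_inner_smul_left]
      have h1 : |logPot δ b x * inner ℝ (planeGrad ζ x) E| ≤ B * n := by
        by_cases hxR1 : ‖x‖ ≤ R
        · rw [hζ.grad_eq_zero_of_le hxR1]; simp; positivity
        · have hxR1 := (not_le.1 hxR1).le
          rw [abs_mul]
          have h2 : ‖E‖ ≤ n := by
            refine (norm_sum_le _ _).trans ?_
            have h3 : ∀ j ∈ Finset.univ, ‖logField 0 (a j) x‖ ≤ 1 := fun j _ => by
              rw [norm_logField_zero]
              apply inv_le_one_of_one_le₀
              have := norm_sub_norm_le x (a j)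
              have := ha j
              linarith
            simpa using Finset.sum_le_card_nsmul _ _ _ h3
          have h4 : |inner ℝ (planeGrad ζ x) E| ≤ M * n :=
            (abs_real_inner_le_norm _ _).trans
              (mul_le_mul (hζ.norm_grad_le x) h2 (norm_nonneg _) hζ.nonneg)
          have h5 := mul_le_mul (abs_logPot_le hR hδ hbR hxR1 hxR'.le) h4 (abs_nonneg _)
            (by linarith)
          rw [hB]; linarith
      linarith [neg_abs_le (logPot δ b x * inner ℝ (planeGrad ζ x) E)]
    have h1 : ζ x * ‖E‖ ^ 2 - B * n ^ 2 ≤ inner ℝ C E := by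
      have h2 : ∑ j, (ζ x * inner ℝ (logField 0 (a j) x) E - B * n) ≤
          ∑ j, inner ℝ (cutField ζ 0 (a j) x) E :=
        Finset.sum_le_sum fun j _ => hcut 0 (a j) (by simp; linarith) (ha j)
      rw [Finset.sum_sub_distrib, ← Finset.mul_sum, ← sum_inner, ← sum_inner] at h2
      rw [← real_inner_self_eq_norm_sq]
      simp only [Finset.sum_const, Finset.card_univ, Fintype.card_fin, nsmul_eq_mul] at h2
      refine le_trans (le_of_eq ?_) h2
      ring
    have h3 := hcut d p (by rwa [abs_of_pos hd]) hp
    have h4 : inner ℝ (Complex.I * C) w ≤ (∑ j, (‖x - a j‖⁻¹ + B)) * (n * c₀) := by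
      refine (real_inner_le_norm _ _).trans (mul_le_mul ?_ (hw hxR) (norm_nonneg _)
        (Finset.sum_nonneg fun j _ => by positivity))
      rw [norm_mul, Complex.norm_I, one_mul]
      refine (norm_sum_le _ _).trans (Finset.sum_le_sum fun j _ => ?_)
      simpa only [Set.indicator_of_mem hxR] using hCj j x
    have h5 : inner ℝ (Complex.I * cutField ζ d p x) w ≤ (‖x - p‖⁻¹ + B) * (n * c₀) := by
      refine (real_inner_le_norm _ _).trans (mul_le_mul ?_ (hw hxR) (norm_nonneg _)
        (by positivity))
      rw [norm_mul, Complex.norm_I, one_mul]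
      simpa only [Set.indicator_of_mem hxR] using hCh x
    have h6 : s * inner ℝ (Complex.I * cutField ζ d p x) w ≤ (‖x - p‖⁻¹ + B) * (n * c₀) :=
      (mul_le_mul_of_nonneg_left h5 hs.1).trans (mul_le_of_le_one_left (by positivity) hs.2)
    have h7 := mul_le_mul_of_nonneg_left h3 hs.1
    have h8 : s * (B * n) ≤ B * n ^ 2 := by
      have h9 : s * (B * n) ≤ B * n := mul_le_of_le_one_left (by positivity) hs.2
      have h10 : (n : ℝ) ≤ n ^ 2 := by nlinarith
      nlinarith
    simp only [Finset.sum_add_distrib, Finset.sum_const, Finset.card_univ, Fintype.card_fin,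
      nsmul_eq_mul] at h4
    simp only [exteriorError, Set.indicator_of_mem hxR]
    nlinarith
  · have hxR' : 2 * R ≤ ‖x‖ := by simpa using hxR
    have h1 : C = 0 := Finset.sum_eq_zero fun j _ => by
      have := hCj j x
      rw [Set.indicator_of_notMem hxR] at this
      exact norm_le_zero_iff.1 this
    have h2 : cutField ζ d p x = 0 := by
      have := hCh x
      rw [Set.indicator_of_notMem hxR] at this
      exact norm_le_zero_iff.1 this
    simp [exteriorError, h1, h2, hζ.eq_zero hxR', Set.indicator_of_notMem hxR]

/-- The energy is bounded below by testing the phase gradient against the rotated gradient of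
`∑ log |x - a_j| + s logPot d p`. The self-interaction of the vortices contributes their logarithmic
energy in the plane, and outside the domain, where the phase has the bounded gradient of the datum,
the energy of the potentials remains as a gain. -/
lemma exists_le_renormalizedEnergy {Ω : Set ℂ} (hΩ : IsOpen Ω) (hc : IsPreconnected Ω)
    (h0 : (0 : ℂ) ∈ Ω) {R M : ℝ} {ζ : ℂ → ℝ} (hζ : IsPlateau R M ζ) (hR : 1 ≤ R)
    (hΩR : ∀ x ∈ Ω, ‖x‖ ≤ R - 1) {φ : ℂ → ℝ} (hφ : IsC2OnBoundary Ω φ) :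
    ∃ C : ℝ, ∀ (n : ℕ), 1 ≤ n → ∀ a : Fin n → ℂ, IsConfiguration Ω a →
      ∀ u : ℂ → ℂ, IsCanonicalHarmonicMap Ω φ a u → ∃ W : ℝ, IsRenormalizedEnergy Ω a u W ∧
        ∀ s ∈ Set.Icc (0 : ℝ) 1, ∀ d : ℝ, 0 < d → d ≤ 2 * R → ∀ p : ℂ, ‖p‖ ≤ R - 1 →
          -Real.pi * (∑ j, ∑ k, Real.log ‖a j - a k‖) - C * (n : ℝ) ^ 2 +
            (∫ x in Ωᶜ, ζ x * ((1 / 2) * ‖∑ j, logField 0 (a j) x‖ ^ 2 +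
              s * inner ℝ (logField d p x) (∑ j, logField 0 (a j) x))) -
            (1 / 2) * s ^ 2 * ∫ x in Ω, ‖logField d p x‖ ^ 2 ≤ W := by
  obtain ⟨Φ, hΦ, hφΦ⟩ := hφ
  obtain ⟨KΦ, hKΦ⟩ := (isCompact_closedBall (0 : ℂ) (2 * R)).exists_bound_of_continuousOn
    (continuous_planeGrad (hΦ.of_le (by norm_num))).continuousOn
  obtain ⟨ρ₀, hρ₀, hball₀⟩ := Metric.isOpen_iff.1 hΩ 0 h0
  have hfar₀ : ∀ x ∈ Ωᶜ, ρ₀ ≤ ‖x‖ := fun x hx => by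
    by_contra h
    exact hx (hball₀ (by simpa using h))
  set B := 5 * R * M with hB
  have hBnn : 0 ≤ B := mul_nonneg (by linarith) hζ.nonneg
  set c₀ := |KΦ| + ρ₀⁻¹ with hc₀
  have hc₀nn : 0 ≤ c₀ := by positivity
  set J := ∫ x in Metric.ball (0 : ℂ) (3 * R), ‖x‖⁻¹ with hJ
  have hJnn : 0 ≤ J := integral_nonneg fun x => by positivity
  set A := (volume : Measure ℂ).real (Metric.ball (0 : ℂ) (2 * R)) with hA
  have hAnn : 0 ≤ A := measureReal_nonneg
  refine ⟨(2 * B + 2 * c₀ * B) * A + 2 * c₀ * J, fun n hn a ha u hu => ?_⟩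
  have hn1 : (1 : ℝ) ≤ n := by exact_mod_cast hn
  obtain ⟨ψ, hψh, hψc, hψi, hu1, hu2⟩ := hu
  have hψ : ContDiffOn ℝ 2 ψ Ω := fun x hx => (hψh x hx).1.contDiffWithinAt
  have hψi' : IntegrableOn (fun x => ‖planeGrad ψ x‖ ^ 2) Ω :=
    hψi.congr (Eventually.of_forall fun x => gradSq_eq_norm_planeGrad_sq ψ x)
  refine ⟨_, isRenormalizedEnergy_of_phase hΩ hζ hR hΩR ha hψ hψi' fun x hx =>
    hu1 x ⟨subset_closure hx.1, hx.2⟩, fun s hs d hd hdR p hp => ?_⟩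
  obtain ⟨N, hN, hΩN, g, hg, hgG, hge⟩ := exists_exterior_phase hΩ hc h0 hΦ ha.2
  have hbd : ∀ x ∈ frontier Ω, Real.cos (ψ x - g x) = 1 := by
    intro x hx
    have hxΩ : x ∉ Ω := by rw [hΩ.frontier_eq] at hx; exact hx.2
    have hxa : x ∉ Set.range a := by rintro ⟨j, rfl⟩; exact hxΩ (ha.2 j)
    have h1 := hu1 x ⟨frontier_subset_closure hx, hxa⟩
    rw [hu2 x hx, boundaryDatum, hφΦ hx, ← hge x (hΩN hxΩ)] at h1
    have h2 : (∏ j, (x - a j) / (‖x - a j‖ : ℂ)) ≠ 0 := by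
      rw [← norm_ne_zero_iff, norm_prod_sub_div_norm hxa]; exact one_ne_zero
    exact cos_sub_eq_one_of_exp_eq (mul_left_cancel₀ h2 h1).symm
  have hΩm := hΩ.measurableSet
  have hcm := hΩm.compl
  have hb : Bornology.IsBounded Ω :=
    (Metric.isBounded_closedBall (x := (0 : ℂ)) (r := R - 1)).subset fun x hx => by
      simpa using hΩR x hx
  -- the fields and their bounds off `Ω`
  set E : ℂ → ℂ := fun x => ∑ j, logField 0 (a j) x with hE
  set C : ℂ → ℂ := fun x => ∑ j, cutField ζ 0 (a j) x with hC
  set H : ℂ → ℂ := logField d p with hH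
  set G : ℂ → ℂ := fun x => planeGrad Φ x + n * (Complex.I * logField 0 0 x) with hG
  have hEm : Measurable E := Finset.measurable_fun_sum _ fun j _ => measurable_logField 0 (a j)
  have hHm : Measurable H := measurable_logField d p
  have hChm := measurable_cutField hζ d p
  have hGm : Measurable G :=
    (continuous_planeGrad (hΦ.of_le (by norm_num))).measurable.add
      (((measurable_logField 0 0).const_mul _).const_mul _)
  obtain ⟨ρ, hEj⟩ := exists_norm_logField_le hΩ ha.2
  have hEb : ∀ x ∈ Ωᶜ, ‖E x‖ ≤ n * ρ⁻¹ := fun x hx => by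
    refine (norm_sum_le _ _).trans ?_
    simpa using Finset.sum_le_card_nsmul Finset.univ _ _ fun j _ => hEj j x hx
  have hGb : ∀ x ∈ Ωᶜ, x ∈ Metric.ball (0 : ℂ) (2 * R) → ‖G x‖ ≤ n * c₀ := by
    intro x hx hxR
    have h1 := (hKΦ x (Metric.ball_subset_closedBall hxR)).trans (le_abs_self _)
    have h2 : ‖(n : ℂ) * (Complex.I * logField 0 0 x)‖ ≤ n * ρ₀⁻¹ := by
      rw [norm_mul, norm_mul, Complex.norm_I, one_mul, norm_logField_zero, sub_zero,
        Complex.norm_natCast]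
      exact mul_le_mul_of_nonneg_left (inv_anti₀ hρ₀ (hfar₀ x hx)) (by positivity)
    have h3 := norm_add_le (planeGrad Φ x) ((n : ℂ) * (Complex.I * logField 0 0 x))
    have h4 : |KΦ| ≤ n * |KΦ| := le_mul_of_one_le_left (abs_nonneg _) hn1
    simp only [hG, hc₀]
    linarith
  have hCj : ∀ j x, ‖cutField ζ 0 (a j) x‖ ≤ (Metric.ball (0 : ℂ) (2 * R)).indicator
      (fun x => ‖x - a j‖⁻¹ + B) x := fun j x =>
    norm_cutField_le hζ hR (by simp; linarith) (hΩR _ (ha.2 j)) x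
  have hCh : ∀ x, ‖cutField ζ d p x‖ ≤ (Metric.ball (0 : ℂ) (2 * R)).indicator
      (fun x => ‖x - p‖⁻¹ + B) x := fun x =>
    norm_cutField_le hζ hR (by rwa [abs_of_pos hd]) hp x
  have hCj' : ∀ j x, ‖cutField ζ 0 (a j) x‖ ≤ (Metric.ball (0 : ℂ) (2 * R)).indicator
      (fun x => 1 * ‖x - a j‖⁻¹ + B) x := by simpa only [one_mul] using hCj
  have hCh' : ∀ x, ‖cutField ζ d p x‖ ≤ (Metric.ball (0 : ℂ) (2 * R)).indicator
      (fun x => 1 * ‖x - p‖⁻¹ + B) x := by simpa only [one_mul] using hCh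
  have iCjE : ∀ j k, IntegrableOn (fun x => inner ℝ (cutField ζ 0 (a j) x) (logField 0 (a k) x)) Ωᶜ :=
    fun j k => integrableOn_inner_of_norm_le hcm (measurable_cutField hζ 0 (a j)).aestronglyMeasurable
      (measurable_logField 0 (a k)).aestronglyMeasurable (fun x _ => hCj' j x) fun x hx _ => hEj k x hx
  have iCjG : ∀ j, IntegrableOn (fun x => inner ℝ (Complex.I * cutField ζ 0 (a j) x) (G x)) Ωᶜ :=
    fun j => integrableOn_inner_of_norm_le hcm
      ((measurable_cutField hζ 0 (a j)).const_mul _).aestronglyMeasurable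
      hGm.aestronglyMeasurable (fun x _ => by rw [norm_mul, Complex.norm_I, one_mul]; exact hCj' j x) hGb
  have iChE : IntegrableOn (fun x => inner ℝ (cutField ζ d p x) (E x)) Ωᶜ :=
    integrableOn_inner_of_norm_le hcm hChm.aestronglyMeasurable hEm.aestronglyMeasurable
      (fun x _ => hCh' x) fun x hx _ => hEb x hx
  have iChG : IntegrableOn (fun x => inner ℝ (Complex.I * cutField ζ d p x) (G x)) Ωᶜ :=
    integrableOn_inner_of_norm_le hcm (hChm.const_mul _).aestronglyMeasurable hGm.aestronglyMeasurable
      (fun x _ => by rw [norm_mul, Complex.norm_I, one_mul]; exact hCh' x) hGb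
  have hCE : ∀ x, inner ℝ (C x) (E x) =
      ∑ j, ∑ k, inner ℝ (cutField ζ 0 (a j) x) (logField 0 (a k) x) := fun x => by
    simp only [hC, hE]
    rw [sum_inner]
    exact Finset.sum_congr rfl fun j _ => inner_sum _ _ _
  have iCE : IntegrableOn (fun x => inner ℝ (C x) (E x)) Ωᶜ := by
    simp only [hCE]
    exact integrable_finsetSum _ fun j _ => integrable_finsetSum _ fun k _ => iCjE j k
  have iCG : IntegrableOn (fun x => inner ℝ (Complex.I * C x) (G x)) Ωᶜ := by
    simp only [hC, Finset.mul_sum, sum_inner]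
    exact integrable_finsetSum _ fun j _ => iCjG j
  -- evaluation of the pairings with `∇ψ`
  have hII : ∀ z w : ℂ, inner ℝ (Complex.I * z) (Complex.I * w) = (inner ℝ z w : ℝ) := fun z w => by
    simp
  have hgΩ : ∀ V : ℂ → ℂ, ∀ x ∈ Ωᶜ, inner ℝ (Complex.I * V x) (planeGrad g x) =
      (inner ℝ (Complex.I * V x) (G x) - inner ℝ (V x) (E x) : ℝ) := fun V x hx => by
    rw [hgG x (hΩN hx), inner_sub_right, hII]
  have hsum1 : ∑ j, ∑ k, ∫ x in Ωᶜ, inner ℝ (cutField ζ 0 (a j) x) (logField 0 (a k) x) =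
      ∫ x in Ωᶜ, inner ℝ (C x) (E x) := by
    simp_rw [← integral_finsetSum Finset.univ fun k _ => iCjE _ k]
    rw [← integral_finsetSum _ fun j _ => integrable_finsetSum _ fun k _ => iCjE j k]
    exact integral_congr_ae (Eventually.of_forall fun x => (hCE x).symm)
  have hsum2 : ∑ j, ∫ x in Ω, inner ℝ (Complex.I * logField 0 (a j) x) (planeGrad ψ x) =
      -∫ x in Ωᶜ, (inner ℝ (Complex.I * C x) (G x) - inner ℝ (C x) (E x)) := by
    have h1 : ∀ j, ∫ x in Ω, inner ℝ (Complex.I * logField 0 (a j) x) (planeGrad ψ x) =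
        -∫ x in Ωᶜ, (inner ℝ (Complex.I * cutField ζ 0 (a j) x) (G x) -
          inner ℝ (cutField ζ 0 (a j) x) (E x)) := fun j => by
      rw [setIntegral_inner_logField_planeGrad_eq hΩ hN hΩN hζ hR hΩR hψ hψc hψi' hg hbd
        (Or.inr ⟨rfl, ha.2 j⟩), setIntegral_congr_fun hcm (hgΩ (cutField ζ 0 (a j)))]
    simp_rw [h1]
    rw [Finset.sum_neg_distrib, ← integral_finsetSum]
    · congr 1
      refine integral_congr_ae (Eventually.of_forall fun x => ?_)
      simp only [hC, Finset.mul_sum, sum_inner, Finset.sum_sub_distrib]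
    · intro j _
      refine (iCjG j).sub ?_
      simp only [hE, inner_sum]
      exact integrable_finsetSum _ fun k _ => iCjE j k
  have hpsi : ∫ x in Ω, inner ℝ (Complex.I * H x) (planeGrad ψ x) =
      -∫ x in Ωᶜ, (inner ℝ (Complex.I * cutField ζ d p x) (G x) - inner ℝ (cutField ζ d p x) (E x)) := by
    rw [hH, setIntegral_inner_logField_planeGrad_eq hΩ hN hΩN hζ hR hΩR hψ hψc hψi' hg hbd
        (Or.inl hd.ne'), setIntegral_congr_fun hcm (hgΩ (cutField ζ d p))]
  have hHb : ∀ x, ‖H x‖ ≤ d⁻¹ := norm_logField_le_inv hd p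
  have iH : IntegrableOn (fun x => ‖H x‖ ^ 2) Ω := by
    refine Measure.integrableOn_of_bounded (M := d⁻¹ ^ 2) hb.measure_lt_top.ne
      (hHm.norm.pow_const 2).aestronglyMeasurable (Eventually.of_forall fun x => ?_)
    rw [norm_pow, norm_norm]
    exact pow_le_pow_left₀ (norm_nonneg _) (hHb x) 2
  have iHψ : IntegrableOn (fun x => inner ℝ (Complex.I * H x) (planeGrad ψ x)) Ω := by
    refine ((integrableOn_planeGrad hΩ hb hψ hψi').norm.const_mul d⁻¹).mono'
      ((hHm.const_mul _).aestronglyMeasurable.inner (aestronglyMeasurable_planeGrad hΩ hψ))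
      (Eventually.of_forall fun x => (norm_inner_le_norm _ _).trans ?_)
    rw [norm_mul, Complex.norm_I, one_mul]
    exact mul_le_mul_of_nonneg_right (hHb x) (norm_nonneg _)
  -- duality: the square of `∇ψ - s i H` is nonnegative
  have hdual : s * (∫ x in Ω, inner ℝ (Complex.I * H x) (planeGrad ψ x)) -
      (1 / 2) * s ^ 2 * ∫ x in Ω, ‖H x‖ ^ 2 ≤ (1 / 2) * ∫ x in Ω, ‖planeGrad ψ x‖ ^ 2 := by
    rw [← integral_const_mul, ← integral_const_mul, ← integral_const_mul, ← integral_sub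
      (iHψ.const_mul s) (iH.const_mul _)]
    refine integral_mono ((iHψ.const_mul s).sub (iH.const_mul _)) (hψi'.const_mul _) fun x => ?_
    have h1 := sq_nonneg ‖planeGrad ψ x - s • (Complex.I * H x)‖
    rw [norm_sub_sq_real, norm_smul, norm_mul, Complex.norm_I, one_mul, real_inner_smul_right,
      real_inner_comm, mul_pow, Real.norm_eq_abs, sq_abs] at h1
    simp only
    linarith
  -- comparison of the exterior terms
  set Q : ℂ → ℝ := fun x => ζ x * ((1 / 2) * ‖E x‖ ^ 2 + s * inner ℝ (H x) (E x)) with hQ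
  set T : ℂ → ℝ := exteriorError R B c₀ a p with hT
  have hiinv : ∀ b, IntegrableOn (fun x => ‖x - b‖⁻¹) (Metric.ball (0 : ℂ) (2 * R)) := fun b =>
    integrableOn_inv_norm_sub b Metric.isBounded_ball
  have hicon : ∀ c : ℝ, IntegrableOn (fun _ => c) (Metric.ball (0 : ℂ) (2 * R)) := fun c =>
    integrableOn_const (by finiteness)
  have iS : IntegrableOn (fun x => ∑ j, ‖x - a j‖⁻¹) (Metric.ball (0 : ℂ) (2 * R)) :=
    integrable_finsetSum _ fun j _ => hiinv (a j)
  have iSp : IntegrableOn (fun x => ∑ j, ‖x - a j‖⁻¹ + ‖x - p‖⁻¹) (Metric.ball (0 : ℂ) (2 * R)) :=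
    iS.add (hiinv p)
  have iT : Integrable T :=
    IntegrableOn.integrable_indicator ((hicon _).add (iSp.const_mul _)) Metric.isOpen_ball.measurableSet
  have hTnn : ∀ x, 0 ≤ T x := fun x => Set.indicator_nonneg (fun x _ => by positivity) x
  have hTint : ∫ x, T x ≤ ((2 * B + 2 * c₀ * B) * A + 2 * c₀ * J) * n ^ 2 := by
    simp only [hT, exteriorError]
    rw [integral_indicator Metric.isOpen_ball.measurableSet, integral_add (hicon _) (iSp.const_mul _),
      setIntegral_const, integral_const_mul, integral_add iS (hiinv p),
      integral_finsetSum _ fun j _ => hiinv (a j), smul_eq_mul, ← hA]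
    have h1 : ∑ j, ∫ x in Metric.ball (0 : ℂ) (2 * R), ‖x - a j‖⁻¹ ≤ n * J := by
      simpa using Finset.sum_le_card_nsmul Finset.univ _ J fun j _ =>
        setIntegral_ball_inv_norm_sub_le (R := R) ((hΩR _ (ha.2 j)).trans (by linarith))
    have h2 : ∫ x in Metric.ball (0 : ℂ) (2 * R), ‖x - p‖⁻¹ ≤ J :=
      setIntegral_ball_inv_norm_sub_le (hp.trans (by linarith))
    have h3 : ∑ j, (∫ x in Metric.ball (0 : ℂ) (2 * R), ‖x - a j‖⁻¹) +
        ∫ x in Metric.ball (0 : ℂ) (2 * R), ‖x - p‖⁻¹ ≤ 2 * n * J := by nlinarith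
    have h4 := mul_le_mul_of_nonneg_left h3 (show 0 ≤ n * c₀ by positivity)
    have h5 : A * (2 * B * n ^ 2 + n * c₀ * ((n + 1) * B)) ≤ A * ((2 * B + 2 * c₀ * B) * n ^ 2) := by
      apply mul_le_mul_of_nonneg_left _ hAnn
      have h6 : (n : ℝ) + 1 ≤ 2 * n := by linarith
      have h7 := mul_le_mul_of_nonneg_left h6 (show 0 ≤ n * c₀ * B by positivity)
      nlinarith
    nlinarith
  have hpt : ∀ x ∈ Ωᶜ, Q x - T x ≤ (1 / 2) * inner ℝ (C x) (E x) + s * inner ℝ (cutField ζ d p x) (E x)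
      - inner ℝ (Complex.I * C x) (G x) - s * inner ℝ (Complex.I * cutField ζ d p x) (G x) :=
    fun x hx => sub_exteriorError_le hζ hR hn1 (fun j => hΩR _ (ha.2 j)) hs hd hdR hp hc₀nn
      (hGb x hx)
  have iQ : IntegrableOn Q Ωᶜ := integrableOn_plateau_mul hζ hcm hEm hHm hEb hHb s
  have hfin : (∫ x in Ωᶜ, Q x) - (∫ x, T x) ≤ (1 / 2) * (∫ x in Ωᶜ, inner ℝ (C x) (E x)) +
      s * (∫ x in Ωᶜ, inner ℝ (cutField ζ d p x) (E x)) - (∫ x in Ωᶜ, inner ℝ (Complex.I * C x) (G x)) -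
      s * ∫ x in Ωᶜ, inner ℝ (Complex.I * cutField ζ d p x) (G x) := by
    have j1 := (iCE.const_mul (1 / 2))
    have j2 := (iChE.const_mul s)
    have j3 := (iChG.const_mul s)
    have h1 : (∫ x in Ωᶜ, T x) ≤ ∫ x, T x :=
      setIntegral_le_integral iT (Eventually.of_forall hTnn)
    have h2 := setIntegral_mono_on (iQ.sub iT.integrableOn) (((j1.add j2).sub iCG).sub j3) hcm hpt
    rw [integral_sub' iQ iT.integrableOn, integral_sub' ((j1.add j2).sub iCG) j3,
      integral_sub' (j1.add j2) iCG, integral_add' j1 j2, integral_const_mul, integral_const_mul,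
      integral_const_mul] at h2
    linarith
  rw [hsum1, hsum2, integral_sub iCG iCE]
  rw [hpsi, integral_sub iChG iChE] at hdual
  have hQe : ∫ x in Ωᶜ, ζ x * ((1 / 2) * ‖∑ j, logField 0 (a j) x‖ ^ 2 +
      s * inner ℝ (logField d p x) (∑ j, logField 0 (a j) x)) = ∫ x in Ωᶜ, Q x := rfl
  rw [hQe]
  linarith

/-! ### Exterior cones -/

/-- The complement of a domain with smooth boundary contains, at each boundary point, a truncated
cone of uniform size and of opening close to a half plane. -/
lemma exists_exterior_cone {Ω : Set ℂ} (hΩ : IsSmoothSimplyConnectedDomain Ω) :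
    ∃ r₀ : ℝ, 0 < r₀ ∧ r₀ ≤ 1 ∧ ∀ p ∈ frontier Ω, ∃ ν : ℂ, ‖ν‖ = 1 ∧ ∀ x, ‖x - p‖ ≤ 2 * r₀ →
      ‖x - p‖ / 20 ≤ inner ℝ ν (x - p) → x ∉ Ω := by
  have hK : IsCompact (frontier Ω) :=
    Metric.isCompact_of_isClosed_isBounded isClosed_frontier
      (hΩ.isBounded.closure.subset frontier_subset_closure)
  suffices h : ∃ r₀ : ℝ, 0 < r₀ ∧ ∀ p ∈ frontier Ω, p ∈ frontier Ω → ∃ ν : ℂ, ‖ν‖ = 1 ∧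
      ∀ x, ‖x - p‖ ≤ 2 * r₀ → ‖x - p‖ / 20 ≤ inner ℝ ν (x - p) → x ∉ Ω by
    obtain ⟨r, hr, h⟩ := h
    refine ⟨min r 1, lt_min hr one_pos, min_le_right _ _, fun p hp => ?_⟩
    obtain ⟨ν, hν, h⟩ := h p hp hp
    exact ⟨ν, hν, fun x hx => h x (hx.trans (by linarith [min_le_left r 1]))⟩
  refine hK.induction_on (p := fun s => ∃ r₀ : ℝ, 0 < r₀ ∧ ∀ p ∈ s, p ∈ frontier Ω →
    ∃ ν : ℂ, ‖ν‖ = 1 ∧ ∀ x, ‖x - p‖ ≤ 2 * r₀ → ‖x - p‖ / 20 ≤ inner ℝ ν (x - p) → x ∉ Ω) ?_ ?_ ?_ ?_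
  · exact ⟨1, one_pos, by simp⟩
  · rintro s t hst ⟨r, hr, h⟩
    exact ⟨r, hr, fun p hp => h p (hst hp)⟩
  · rintro s t ⟨r, hr, h⟩ ⟨r', hr', h'⟩
    refine ⟨min r r', lt_min hr hr', ?_⟩
    rintro p (hp | hp) hpf
    · obtain ⟨ν, hν, h⟩ := h p hp hpf
      exact ⟨ν, hν, fun x hx => h x (hx.trans (by linarith [min_le_left r r']))⟩
    · obtain ⟨ν, hν, h⟩ := h' p hp hpf
      exact ⟨ν, hν, fun x hx => h x (hx.trans (by linarith [min_le_right r r']))⟩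
  · intro p₀ hp₀
    obtain ⟨U, hU, g, hg, hg0, hgU⟩ := hΩ.smoothBoundary p₀ hp₀
    set G := planeGrad g p₀ with hG
    have hGpos : 0 < ‖G‖ := by
      rw [norm_pos_iff]
      intro h
      apply hg0
      ext v
      rw [← inner_planeGrad, ← hG, h, inner_zero_left]; simp
    have hst : HasStrictFDerivAt g (fderiv ℝ g p₀) p₀ :=
      hg.contDiffAt.hasStrictFDerivAt (by simp)
    -- strict differentiability compares `g` with its linear part at `p₀` for all pairs of nearby points,
    -- which gives one radius for all boundary points near `p₀`
    have h1 := hst.isLittleO.def (show 0 < ‖G‖ / 40 by positivity)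
    obtain ⟨ε, hε, h2⟩ := Metric.eventually_nhds_iff_ball.1
      (h1.and (((continuous_fst.tendsto (p₀, p₀)).eventually hU).and
        ((continuous_snd.tendsto (p₀, p₀)).eventually hU)))
    refine ⟨Metric.ball p₀ (ε / 2), mem_nhdsWithin_of_mem_nhds (Metric.ball_mem_nhds _ (half_pos hε)),
      ε / 8, by positivity, fun p hp hpf => ⟨((‖G‖⁻¹ : ℝ) : ℂ) * G, ?_, fun x hx hin hxΩ => ?_⟩⟩
    · rw [norm_mul, Complex.norm_real, Real.norm_of_nonneg (by positivity), inv_mul_cancel₀ hGpos.ne']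
    · have hp' : dist p p₀ < ε / 2 := hp
      have hx' : dist x p₀ < ε := by
        have := dist_triangle x p p₀
        rw [dist_eq_norm x p] at this
        linarith
      obtain ⟨h3, hxU, hpU⟩ := h2 (x, p) (by
        rw [Metric.mem_ball, Prod.dist_eq]
        exact max_lt hx' (by linarith))
      simp only at h3 hxU hpU
      have hgx : g x < 0 := by
        have : x ∈ Ω ∩ U := ⟨hxΩ, hxU⟩
        rw [hgU] at this
        exact this.2
      have hgp : 0 ≤ g p := by
        by_contra h
        have : p ∈ Ω ∩ U := by rw [hgU]; exact ⟨hpU, not_le.1 h⟩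
        rw [hΩ.isOpen.frontier_eq] at hpf
        exact hpf.2 this.1
      rw [← Complex.real_smul, real_inner_smul_left, inner_planeGrad, inv_mul_eq_div,
        le_div_iff₀ hGpos] at hin
      rw [Real.norm_eq_abs] at h3
      have h4 := (abs_le.1 h3).1
      have h5 : 0 ≤ ‖G‖ * ‖x - p‖ := by positivity
      linarith

/-! ### The gain in an exterior sector -/

lemma inner_polarPt_sub (p : ℂ) {ν : ℂ} (hν : ‖ν‖ = 1) (θ ρ : ℝ) :
    inner ℝ ν (polarPt p ν θ ρ - p) = ρ * Real.cos θ := by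
  have h := Complex.normSq_eq_norm_sq ν
  rw [hν, Complex.normSq_apply] at h
  rw [polarPt, add_sub_cancel_left, real_inner_eq]
  simp [-Complex.ofReal_cos, -Complex.ofReal_sin]
  linear_combination ρ * Real.cos θ * h

/-- The weight `ρ²/(ρ²+d²)` is increasing with values in `[0, 1]`, so that integrating by parts
against it loses no more than the oscillation of `q` between its upper bound and its end value. -/
lemma sub_le_integral_weight_mul_deriv {r d : ℝ} (hr : 0 ≤ r) (hd : 0 < d) {q q' : ℝ → ℝ}
    (hq : ∀ ρ ∈ Set.Icc 0 r, HasDerivAt q (q' ρ) ρ) (hq' : ContinuousOn q' (Set.Icc 0 r)) {lo up : ℝ}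
    (hup : ∀ ρ ∈ Set.Icc 0 r, q ρ ≤ up) (hlo : lo ≤ q r) :
    lo - up ≤ ∫ ρ in (0)..r, ρ ^ 2 / (ρ ^ 2 + d ^ 2) * q' ρ := by
  set m : ℝ → ℝ := fun ρ => ρ ^ 2 / (ρ ^ 2 + d ^ 2) with hm
  set m' : ℝ → ℝ := fun ρ => 2 * ρ * d ^ 2 / (ρ ^ 2 + d ^ 2) ^ 2 with hm'
  have hpos : ∀ ρ : ℝ, 0 < ρ ^ 2 + d ^ 2 := fun ρ => by positivity
  have hmd : ∀ ρ, HasDerivAt m (m' ρ) ρ := by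
    intro ρ
    have h1 : HasDerivAt (fun ρ : ℝ => ρ ^ 2) (2 * ρ) ρ := by simpa using hasDerivAt_pow 2 ρ
    refine (h1.div (h1.add_const (d ^ 2)) (hpos ρ).ne').congr_deriv ?_
    simp only [hm']
    congr 1
    ring
  have hm'c : Continuous m' := by
    have h := fun ρ => (hpos ρ).ne'
    have : ∀ ρ : ℝ, (ρ ^ 2 + d ^ 2) ^ 2 ≠ 0 := fun ρ => pow_ne_zero 2 (h ρ)
    exact (by fun_prop : Continuous fun ρ : ℝ => 2 * ρ * d ^ 2).div (by fun_prop) this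
  have hu : Set.uIcc 0 r = Set.Icc 0 r := Set.uIcc_of_le hr
  have hibp := intervalIntegral.integral_mul_deriv_eq_deriv_mul (a := 0) (b := r) (u := m)
    (v := fun ρ => q ρ - up) (u' := m') (v' := q') (fun ρ _ => hmd ρ)
    (fun ρ hρ => (hq ρ (hu ▸ hρ)).sub_const up) hm'c.continuousOn.intervalIntegrable
    (by rw [← hu] at hq'; exact hq'.intervalIntegrable)
  have hneg : ∫ ρ in (0)..r, m' ρ * (q ρ - up) ≤ 0 := by
    have h1 : ∫ ρ in (0)..r, m' ρ * (q ρ - up) ≤ ∫ ρ in (0)..r, (0 : ℝ) := by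
      refine intervalIntegral.integral_mono_on hr ?_ (by simp) fun ρ hρ => ?_
      · have hqc : ContinuousOn q (Set.uIcc 0 r) := fun ρ hρ =>
          (hq ρ (hu ▸ hρ)).continuousAt.continuousWithinAt
        exact (hm'c.continuousOn.mul (hqc.sub continuousOn_const)).intervalIntegrable
      · have h2 : 0 ≤ m' ρ := by
          have := hρ.1
          simp only [hm']; positivity
        nlinarith [hup ρ hρ]
    simpa using h1
  have hm0 : m 0 = 0 := by simp [hm]
  have hmr1 : m r ≤ 1 := by
    simp only [hm]
    rw [div_le_one (hpos r)]
    nlinarith [sq_nonneg d]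
  rw [hm0, zero_mul, sub_zero] at hibp
  rw [hibp]
  have h3 := hup r ⟨hr, le_rfl⟩
  nlinarith

/-- The radial integral of the energy density of `logPot d` over a disc of radius `r`. -/
noncomputable def coreEnergy (r d : ℝ) : ℝ := ∫ ρ in (0)..r, ρ ^ 3 / (ρ ^ 2 + d ^ 2) ^ 2

lemma continuous_coreEnergy_density {d : ℝ} (hd : 0 < d) :
    Continuous fun ρ : ℝ => ρ ^ 3 / (ρ ^ 2 + d ^ 2) ^ 2 := by
  have : ∀ ρ : ℝ, (ρ ^ 2 + d ^ 2) ^ 2 ≠ 0 := fun ρ => by positivity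
  exact (by fun_prop : Continuous fun ρ : ℝ => ρ ^ 3).div (by fun_prop) this

lemma hasDerivAt_half_log_add_sq {d : ℝ} (hd : 0 < d) (ρ : ℝ) :
    HasDerivAt (fun ρ : ℝ => (1 / 2) * Real.log (ρ ^ 2 + d ^ 2)) (ρ / (ρ ^ 2 + d ^ 2)) ρ := by
  have hpos : ρ ^ 2 + d ^ 2 ≠ 0 := by positivity
  have h1 : HasDerivAt (fun ρ : ℝ => ρ ^ 2 + d ^ 2) (2 * ρ) ρ := by
    simpa using (hasDerivAt_pow 2 ρ).add_const (d ^ 2)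
  refine ((h1.log hpos).const_mul (1 / 2)).congr_deriv ?_
  ring

lemma coreEnergy_nonneg {r d : ℝ} (hr : 0 ≤ r) : 0 ≤ coreEnergy r d :=
  intervalIntegral.integral_nonneg hr fun ρ hρ => by have := hρ.1; positivity

lemma log_sub_log_le_coreEnergy {r d : ℝ} (hr : 0 < r) (hd : 0 < d) :
    Real.log r - Real.log d - 1 / 2 ≤ coreEnergy r d := by
  have hder : ∀ ρ ∈ Set.uIcc 0 r, HasDerivAt (fun ρ : ℝ => (1 / 2) * Real.log (ρ ^ 2 + d ^ 2) +
      (1 / 2) * (d ^ 2 / (ρ ^ 2 + d ^ 2))) (ρ ^ 3 / (ρ ^ 2 + d ^ 2) ^ 2) ρ := by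
    intro ρ _
    have hpos : ρ ^ 2 + d ^ 2 ≠ 0 := by positivity
    have h1 : HasDerivAt (fun ρ : ℝ => ρ ^ 2 + d ^ 2) (2 * ρ) ρ := by
      simpa using (hasDerivAt_pow 2 ρ).add_const (d ^ 2)
    have h2 := ((hasDerivAt_const ρ (d ^ 2)).div h1 hpos).const_mul (1 / 2)
    refine ((hasDerivAt_half_log_add_sq hd ρ).add h2).congr_deriv ?_
    field_simp
    ring
  rw [coreEnergy, intervalIntegral.integral_eq_sub_of_hasDerivAt hder
    (continuous_coreEnergy_density hd).continuousOn.intervalIntegrable]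
  have h1 : Real.log (r ^ 2) ≤ Real.log (r ^ 2 + d ^ 2) :=
    Real.log_le_log (by positivity) (by nlinarith [sq_nonneg d])
  have h2 : 0 ≤ d ^ 2 / (r ^ 2 + d ^ 2) := by positivity
  have h3 : d ^ 2 / ((0 : ℝ) ^ 2 + d ^ 2) = 1 := by field_simp; simp
  have h4 : Real.log ((0 : ℝ) ^ 2 + d ^ 2) = 2 * Real.log d := by simp
  rw [h3, h4]
  rw [Real.log_pow] at h1
  push_cast at h1
  linarith

/-- The same bound for a potential with a pole at distance of order `d`, whose slope contributes the
core energy. -/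
lemma coreEnergy_add_le_integral_weight_mul_deriv {r d : ℝ} (hr : 0 ≤ r) (hd : 0 < d) {q q' : ℝ → ℝ}
    (hq : ∀ ρ ∈ Set.Icc 0 r, HasDerivAt q (q' ρ) ρ) (hq' : ContinuousOn q' (Set.Icc 0 r)) {lo up : ℝ}
    (hup : ∀ ρ ∈ Set.Icc 0 r, q ρ ≤ (1 / 2) * Real.log (ρ ^ 2 + d ^ 2) + up) (hlo : lo ≤ q r) :
    coreEnergy r d + (lo - (1 / 2) * Real.log (r ^ 2 + d ^ 2) - up) ≤
      ∫ ρ in (0)..r, ρ ^ 2 / (ρ ^ 2 + d ^ 2) * q' ρ := by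
  have hpos : ∀ ρ : ℝ, ρ ^ 2 + d ^ 2 ≠ 0 := fun ρ => by positivity
  have hc1 : Continuous fun ρ : ℝ => ρ / (ρ ^ 2 + d ^ 2) := continuous_id.div (by fun_prop) hpos
  have hc2 : Continuous fun ρ : ℝ => ρ ^ 2 / (ρ ^ 2 + d ^ 2) :=
    (by fun_prop : Continuous fun ρ : ℝ => ρ ^ 2).div (by fun_prop) hpos
  have h := sub_le_integral_weight_mul_deriv hr hd
    (q := fun ρ => q ρ - (1 / 2) * Real.log (ρ ^ 2 + d ^ 2)) (q' := fun ρ => q' ρ - ρ / (ρ ^ 2 + d ^ 2))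
    (fun ρ hρ => (hq ρ hρ).sub (hasDerivAt_half_log_add_sq hd ρ)) (hq'.sub hc1.continuousOn)
    (lo := lo - (1 / 2) * Real.log (r ^ 2 + d ^ 2)) (up := up)
    (fun ρ hρ => by linarith [hup ρ hρ]) (by linarith)
  have hi1 : IntervalIntegrable (fun ρ => ρ ^ 2 / (ρ ^ 2 + d ^ 2) * q' ρ) volume 0 r := by
    rw [← Set.uIcc_of_le hr] at hq'
    exact (hc2.continuousOn.mul hq').intervalIntegrable
  have hi2 : IntervalIntegrable (fun ρ => ρ ^ 3 / (ρ ^ 2 + d ^ 2) ^ 2) volume 0 r :=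
    (continuous_coreEnergy_density hd).continuousOn.intervalIntegrable
  have he : ∫ ρ in (0)..r, ρ ^ 2 / (ρ ^ 2 + d ^ 2) * (q' ρ - ρ / (ρ ^ 2 + d ^ 2)) =
      (∫ ρ in (0)..r, ρ ^ 2 / (ρ ^ 2 + d ^ 2) * q' ρ) - coreEnergy r d := by
    rw [coreEnergy, ← intervalIntegral.integral_sub hi1 hi2]
    refine intervalIntegral.integral_congr fun ρ _ => ?_
    field_simp
  rw [he] at h
  linarith

lemma cos_halfAngle_ge : (3 : ℝ) / 20 ≤ Real.cos (139 / 100) := by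
  rw [← Real.sin_pi_div_two_sub]
  have h1 : (9 : ℝ) / 50 ≤ Real.pi / 2 - 139 / 100 := by have := Real.pi_gt_d2; linarith
  have h2 : Real.pi / 2 - 139 / 100 ≤ Real.pi / 2 := by linarith
  have h3 := Real.sin_le_sin_of_le_of_le_pi_div_two (by have := Real.pi_pos; linarith) h2 h1
  have h4 := Real.sin_gt_sub_cube (x := 9 / 50) (by norm_num)
  norm_num at h4
  linarith

/-- A ray of an exterior sector at `p` stays away from the domain at a distance comparable with the
radius. -/
lemma div_le_norm_polarPt_sub {Ω : Set ℂ} {p ν : ℂ} {r₀ : ℝ} (hr₀ : 0 < r₀) (hν : ‖ν‖ = 1)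
    (hcone : ∀ x, ‖x - p‖ ≤ 2 * r₀ → ‖x - p‖ / 20 ≤ inner ℝ ν (x - p) → x ∉ Ω) {θ : ℝ}
    (hθ : 3 / 20 ≤ Real.cos θ) {y : ℂ} (hy : y ∈ Ω) : r₀ / 50 ≤ ‖polarPt p ν θ r₀ - y‖ := by
  by_contra! h
  set z := polarPt p ν θ r₀
  have h1 : ‖z - p‖ = r₀ := norm_polarPt_sub p hν θ hr₀.le
  have h2 : ‖y - p‖ ≤ ‖z - p‖ + ‖z - y‖ := by
    have := norm_sub_le (z - p) (z - y)
    rwa [sub_sub_sub_cancel_left] at this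
  have h3 : inner ℝ ν (z - p) = r₀ * Real.cos θ := inner_polarPt_sub p hν θ r₀
  have h4 : inner ℝ ν (y - p) = (inner ℝ ν (z - p) - inner ℝ ν (z - y) : ℝ) := by
    rw [← inner_sub_right]; congr 1; ring
  have h5 : inner ℝ ν (z - y) ≤ ‖z - y‖ := by
    simpa only [hν, one_mul] using real_inner_le_norm ν (z - y)
  have h6 : r₀ * (3 / 20) ≤ r₀ * Real.cos θ := mul_le_mul_of_nonneg_left hθ hr₀.le
  exact hcone y (by linarith) (by linarith) hy

lemma polarPt_notMem_of_cone {Ω : Set ℂ} {p ν : ℂ} {r₀ : ℝ} (hν : ‖ν‖ = 1)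
    (hcone : ∀ x, ‖x - p‖ ≤ 2 * r₀ → ‖x - p‖ / 20 ≤ inner ℝ ν (x - p) → x ∉ Ω) {θ : ℝ}
    (hθ : 3 / 20 ≤ Real.cos θ) {ρ : ℝ} (hρ : ρ ∈ Set.Icc 0 (2 * r₀)) : polarPt p ν θ ρ ∉ Ω := by
  refine hcone _ ?_ ?_
  · rw [norm_polarPt_sub p hν θ hρ.1]; exact hρ.2
  · rw [norm_polarPt_sub p hν θ hρ.1, inner_polarPt_sub p hν]
    have := mul_le_mul_of_nonneg_left hθ hρ.1
    linarith [hρ.1]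

lemma logField_polarPt (d : ℝ) (p : ℂ) {ν : ℂ} (hν : ‖ν‖ = 1) (θ : ℝ) {ρ : ℝ} (hρ : 0 ≤ ρ) :
    logField d p (polarPt p ν θ ρ) =
      (ρ / (ρ ^ 2 + d ^ 2)) • (ν * (Real.cos θ + Real.sin θ * Complex.I)) := by
  rw [logField, norm_polarPt_sub p hν θ hρ, polarPt, add_sub_cancel_left, Complex.real_smul]
  push_cast
  ring

/-- Along a ray of an exterior sector at `p`, the interaction of the test potential with the vortices
exceeds the core energy, the vortex at distance `d` from `p` contributing the core energy. -/
lemma coreEnergy_sub_le_integral_ray {Ω : Set ℂ} {R : ℝ} (hR : 1 ≤ R) (hΩR : ∀ x ∈ Ω, ‖x‖ ≤ R - 1)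
    {p ν : ℂ} (hp : ‖p‖ ≤ R - 1) {r₀ : ℝ} (hr₀ : 0 < r₀) (hr₀1 : r₀ ≤ 1) (hν : ‖ν‖ = 1)
    (hcone : ∀ x, ‖x - p‖ ≤ 2 * r₀ → ‖x - p‖ / 20 ≤ inner ℝ ν (x - p) → x ∉ Ω) {n : ℕ}
    {a : Fin n → ℂ} (ha : ∀ k, a k ∈ Ω) {j : Fin n} {d : ℝ} (hd : 0 < d) (hdR : d ≤ 2 * R)
    (hj : ‖a j - p‖ = d) {θ : ℝ} (hθ : 3 / 20 ≤ Real.cos θ) :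
    coreEnergy r₀ d - n * (6 * R + 1 - Real.log (r₀ / 50)) ≤
      ∫ ρ in (0)..r₀, ρ * inner ℝ (logField d p (polarPt p ν θ ρ))
        (∑ k, logField 0 (a k) (polarPt p ν θ ρ)) := by
  set e : ℂ := ν * (Real.cos θ + Real.sin θ * Complex.I)
  set q : Fin n → ℝ → ℝ := fun k ρ => logPot 0 (a k) (polarPt p ν θ ρ) with hq
  set q' : Fin n → ℝ → ℝ := fun k ρ => inner ℝ (logField 0 (a k) (polarPt p ν θ ρ)) e with hq'
  have hne : ∀ k, ∀ ρ ∈ Set.Icc 0 r₀, polarPt p ν θ ρ ≠ a k := fun k ρ hρ h =>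
    polarPt_notMem_of_cone hν hcone hθ ⟨hρ.1, hρ.2.trans (by linarith)⟩ (h ▸ ha k)
  have hder : ∀ k, ∀ ρ ∈ Set.Icc 0 r₀, HasDerivAt (q k) (q' k ρ) ρ := by
    intro k ρ hρ
    have h1 := sq_add_sq_ne_zero_of_ne (δ := 0) (hne k ρ hρ)
    have h2 := hasDerivAt_comp_polarPt (p := p) (ν := ν) (θ := θ) (ρ := ρ)
      ((contDiffAt_logPot h1).differentiableAt (by simp))
    rwa [planeGrad_logPot h1] at h2
  have hcont : ∀ k, ContinuousOn (q' k) (Set.Icc 0 r₀) := by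
    intro k
    have hpc : Continuous (polarPt p ν θ) := by unfold polarPt; fun_prop
    have h1 : ContinuousOn (fun ρ => logField 0 (a k) (polarPt p ν θ ρ)) (Set.Icc 0 r₀) := by
      unfold logField
      refine ContinuousOn.mul (Complex.continuous_ofReal.comp_continuousOn
        (ContinuousOn.inv₀ (by fun_prop) fun ρ hρ => sq_add_sq_ne_zero_of_ne (hne k ρ hρ)))
        (by fun_prop)
    exact h1.inner continuousOn_const
  have hlo : ∀ k, Real.log (r₀ / 50) ≤ q k r₀ := by
    intro k
    simp only [hq, logPot_zero]
    exact Real.log_le_log (by positivity) (div_le_norm_polarPt_sub hr₀ hν hcone hθ (ha k))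
  have hup : ∀ k, ∀ ρ ∈ Set.Icc 0 r₀, q k ρ ≤ 3 * R := by
    intro k ρ hρ
    simp only [hq, logPot_zero]
    refine (Real.log_le_self (norm_nonneg _)).trans ?_
    have h1 := norm_sub_le_norm_sub_add_norm_sub (polarPt p ν θ ρ) p (a k)
    rw [norm_polarPt_sub p hν θ hρ.1] at h1
    have h2 := norm_sub_le p (a k)
    have h3 := hΩR _ (ha k)
    linarith [hρ.2]
  set c₁ := 6 * R + 1 - Real.log (r₀ / 50)
  have hbase : ∀ k, -c₁ ≤ ∫ ρ in (0)..r₀, ρ ^ 2 / (ρ ^ 2 + d ^ 2) * q' k ρ := fun k => by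
    have := sub_le_integral_weight_mul_deriv hr₀.le hd (hder k) (hcont k) (hup k) (hlo k)
    linarith
  have hnear : coreEnergy r₀ d - c₁ ≤ ∫ ρ in (0)..r₀, ρ ^ 2 / (ρ ^ 2 + d ^ 2) * q' j ρ := by
    have h1 : ∀ ρ ∈ Set.Icc 0 r₀, q j ρ ≤ (1 / 2) * Real.log (ρ ^ 2 + d ^ 2) + 1 := by
      intro ρ hρ
      simp only [hq, logPot_zero]
      have h2 := norm_sub_le_norm_sub_add_norm_sub (polarPt p ν θ ρ) p (a j)
      rw [norm_polarPt_sub p hν θ hρ.1, norm_sub_rev p, hj] at h2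
      have h3 : 0 < ‖polarPt p ν θ ρ - a j‖ := norm_pos_iff.2 (sub_ne_zero.2 (hne j ρ hρ))
      have h4 : Real.log (‖polarPt p ν θ ρ - a j‖ ^ 2) ≤ Real.log (2 * (ρ ^ 2 + d ^ 2)) := by
        refine Real.log_le_log (by positivity) ?_
        nlinarith [sq_nonneg (ρ - d)]
      rw [Real.log_pow, Real.log_mul (by norm_num) (by positivity)] at h4
      have h5 := Real.log_two_lt_d9
      push_cast at h4
      linarith
    have h6 := coreEnergy_add_le_integral_weight_mul_deriv hr₀.le hd (hder j) (hcont j) h1 (hlo j)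
    have h7 : Real.log (r₀ ^ 2 + d ^ 2) ≤ Real.log ((3 * R) ^ 2) :=
      Real.log_le_log (by positivity) (by nlinarith)
    have h8 := Real.log_le_self (show 0 ≤ 3 * R by linarith)
    rw [Real.log_pow] at h7
    push_cast at h7
    linarith
  have hu : Set.uIcc 0 r₀ = Set.Icc 0 r₀ := Set.uIcc_of_le hr₀.le
  have hint : ∀ k, IntervalIntegrable (fun ρ => ρ ^ 2 / (ρ ^ 2 + d ^ 2) * q' k ρ) volume 0 r₀ := by
    intro k
    have hpos : ∀ ρ : ℝ, ρ ^ 2 + d ^ 2 ≠ 0 := fun ρ => by positivity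
    have h1 : Continuous fun ρ : ℝ => ρ ^ 2 / (ρ ^ 2 + d ^ 2) :=
      (by fun_prop : Continuous fun ρ : ℝ => ρ ^ 2).div (by fun_prop) hpos
    refine ContinuousOn.intervalIntegrable (h1.continuousOn.mul ?_)
    rw [hu]; exact hcont k
  have heq : ∫ ρ in (0)..r₀, ρ * inner ℝ (logField d p (polarPt p ν θ ρ))
        (∑ k, logField 0 (a k) (polarPt p ν θ ρ)) =
      ∑ k, ∫ ρ in (0)..r₀, ρ ^ 2 / (ρ ^ 2 + d ^ 2) * q' k ρ := by
    rw [← intervalIntegral.integral_finsetSum fun k _ => hint k]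
    refine intervalIntegral.integral_congr fun ρ hρ => ?_
    rw [hu] at hρ
    rw [logField_polarPt d p hν θ hρ.1, real_inner_smul_left, inner_sum, Finset.mul_sum,
      Finset.mul_sum]
    refine Finset.sum_congr rfl fun k _ => ?_
    rw [real_inner_comm]
    simp only [hq']
    ring
  rw [heq]
  have hsum : ∑ k, (-c₁ + if k = j then coreEnergy r₀ d else 0) ≤
      ∑ k, ∫ ρ in (0)..r₀, ρ ^ 2 / (ρ ^ 2 + d ^ 2) * q' k ρ := by
    refine Finset.sum_le_sum fun k _ => ?_
    split_ifs with h
    · subst h; linarith [hnear]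
    · simpa using hbase k
  refine le_trans (le_of_eq ?_) hsum
  rw [Finset.sum_add_distrib]
  simp
  ring

/-- The part, kept in the estimate near a boundary point `p`, of the energy of the field `E` coupled with
the test field `H`: the coupling `⟪H, E⟫` on the sector at `p` of half-angle `139 / 100` and axis `ν`, and
the least value `-|H|² / 2` of `|E|² / 2 + ⟪H, E⟫` on the rest of the disc of radius `r₀`. -/
noncomputable def sectorDensity (p ν : ℂ) (r₀ : ℝ) (H E : ℂ → ℂ) (x : ℂ) : ℝ :=
  if ‖x - p‖ < r₀ then
    if Real.cos (139 / 100) * ‖x - p‖ < inner ℝ ν (x - p) then inner ℝ (H x) (E x)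
    else -(1 / 2) * ‖H x‖ ^ 2
  else 0

lemma integrable_sectorDensity {p ν : ℂ} {r₀ : ℝ} {H E : ℂ → ℂ} (hH : Measurable H)
    (hE : Measurable E) {A B : ℝ} (hHB : ∀ x, ‖H x‖ ≤ B)
    (hEA : ∀ x, ‖x - p‖ < r₀ → Real.cos (139 / 100) * ‖x - p‖ < inner ℝ ν (x - p) → ‖E x‖ ≤ A) :
    Integrable (sectorDensity p ν r₀ H E) := by
  have hm : Measurable (sectorDensity p ν r₀ H E) := by
    refine Measurable.ite (measurableSet_lt (by fun_prop) (by fun_prop))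
      (Measurable.ite (measurableSet_lt (by fun_prop) ?_) (hH.inner hE)
        ((hH.norm.pow_const 2).const_mul _)) measurable_const
    exact (Continuous.inner continuous_const (by fun_prop)).measurable
  rw [← integrableOn_univ]
  refine IntegrableOn.of_forall_sdiff_eq_zero (s := Metric.ball p r₀) ?_ MeasurableSet.univ ?_
  · refine Measure.integrableOn_of_bounded (M := B * |A| + (1 / 2) * B ^ 2) (by finiteness)
      hm.aestronglyMeasurable (Eventually.of_forall fun x => ?_)
    have hB := (norm_nonneg _).trans (hHB x)
    unfold sectorDensity
    split_ifs with h1 h2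
    · have h3 : ‖H x‖ * ‖E x‖ ≤ B * |A| :=
        mul_le_mul (hHB x) ((hEA x h1 h2).trans (le_abs_self _)) (norm_nonneg _) hB
      exact (norm_inner_le_norm _ _).trans (h3.trans (by linarith [sq_nonneg B]))
    · have h3 := pow_le_pow_left₀ (norm_nonneg _) (hHB x) 2
      rw [norm_mul, norm_pow, norm_norm]
      norm_num
      have : 0 ≤ B * |A| := by positivity
      linarith
    · rw [norm_zero]; positivity
  · intro x hx
    have : ¬ ‖x - p‖ < r₀ := by simpa [dist_eq_norm] using hx
    simp [sectorDensity, this]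

lemma setIntegral_Ioi_mul_eq_intervalIntegral {F g : ℝ → ℝ} {r : ℝ} (hr : 0 ≤ r)
    (h1 : ∀ ρ, 0 < ρ → ρ < r → F ρ = g ρ) (h2 : ∀ ρ, r ≤ ρ → F ρ = 0) :
    ∫ ρ in Set.Ioi (0 : ℝ), ρ * F ρ = ∫ ρ in (0)..r, ρ * g ρ := by
  rw [intervalIntegral.integral_of_le hr, integral_Ioc_eq_integral_Ioo,
    setIntegral_eq_of_subset_of_forall_sdiff_eq_zero measurableSet_Ioi Set.Ioo_subset_Ioi_self]
  · exact setIntegral_congr_fun measurableSet_Ioo fun ρ hρ => by simp only [h1 ρ hρ.1 hρ.2]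
  · intro ρ hρ
    have h3 : 0 < ρ := hρ.1
    rw [h2 ρ (not_lt.1 fun h => hρ.2 ⟨h3, h⟩), mul_zero]

lemma integral_sectorDensity_ray {p ν : ℂ} {r₀ d θ : ℝ} (hr₀ : 0 ≤ r₀) (hν : ‖ν‖ = 1) (E : ℂ → ℂ) :
    ∫ ρ in Set.Ioi (0 : ℝ), ρ * sectorDensity p ν r₀ (logField d p) E (polarPt p ν θ ρ) =
      if Real.cos (139 / 100) < Real.cos θ then ∫ ρ in (0)..r₀, ρ *
        inner ℝ (logField d p (polarPt p ν θ ρ)) (E (polarPt p ν θ ρ))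
      else -(1 / 2) * coreEnergy r₀ d := by
  have hz : ∀ ρ, r₀ ≤ ρ → sectorDensity p ν r₀ (logField d p) E (polarPt p ν θ ρ) = 0 := by
    intro ρ hρ
    rw [sectorDensity, norm_polarPt_sub p hν θ (hr₀.trans hρ), if_neg (not_lt.2 hρ)]
  have hiff : ∀ ρ, 0 < ρ → (Real.cos (139 / 100) * ρ < ρ * Real.cos θ ↔
      Real.cos (139 / 100) < Real.cos θ) := fun ρ hρ => by
    rw [mul_comm]; exact mul_lt_mul_iff_right₀ hρ
  split_ifs with h
  · refine setIntegral_Ioi_mul_eq_intervalIntegral hr₀ (fun ρ hρ hρr => ?_) hz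
    rw [sectorDensity, norm_polarPt_sub p hν θ hρ.le, inner_polarPt_sub p hν, if_pos hρr,
      if_pos ((hiff ρ hρ).2 h)]
  · rw [setIntegral_Ioi_mul_eq_intervalIntegral (g := fun ρ => -(1 / 2) * (ρ / (ρ ^ 2 + d ^ 2)) ^ 2)
      hr₀ (fun ρ hρ hρr => ?_) hz, coreEnergy, ← intervalIntegral.integral_const_mul]
    · refine intervalIntegral.integral_congr fun ρ _ => ?_
      simp only [div_pow]
      ring
    · rw [sectorDensity, norm_polarPt_sub p hν θ hρ.le, inner_polarPt_sub p hν, if_pos hρr,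
        if_neg (fun h' => h ((hiff ρ hρ).1 h')), logField_polarPt d p hν θ hρ.le, norm_smul, norm_mul,
        hν, norm_cos_add_sin_mul_I, mul_one, mul_one, Real.norm_eq_abs, sq_abs]

lemma cos_lt_cos_iff_abs_lt {α θ : ℝ} (hα : α ∈ Set.Icc 0 Real.pi)
    (hθ : θ ∈ Set.Ioo (-Real.pi) Real.pi) : Real.cos α < Real.cos θ ↔ |θ| < α := by
  rw [← Real.cos_abs θ]
  exact Real.strictAntiOn_cos.lt_iff_gt hα ⟨abs_nonneg _, (abs_lt.2 hθ).le⟩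

/-- The half-angle of the sector exceeds `π / 3`, so that the sector gains more than the rest of the disc
can lose. -/
lemma coreEnergy_sub_le_integral_sectorDensity {Ω : Set ℂ} (hΩ : IsOpen Ω) {R : ℝ} (hR : 1 ≤ R)
    (hΩR : ∀ x ∈ Ω, ‖x‖ ≤ R - 1) {p ν : ℂ} (hp : ‖p‖ ≤ R - 1) {r₀ : ℝ} (hr₀ : 0 < r₀) (hr₀1 : r₀ ≤ 1)
    (hν : ‖ν‖ = 1)
    (hcone : ∀ x, ‖x - p‖ ≤ 2 * r₀ → ‖x - p‖ / 20 ≤ inner ℝ ν (x - p) → x ∉ Ω) {n : ℕ}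
    {a : Fin n → ℂ} (ha : ∀ k, a k ∈ Ω) {j : Fin n} {d : ℝ} (hd : 0 < d) (hdR : d ≤ 2 * R)
    (hj : ‖a j - p‖ = d) :
    Integrable (sectorDensity p ν r₀ (logField d p) fun x => ∑ k, logField 0 (a k) x) ∧
    coreEnergy r₀ d - 3 * n * (6 * R + 1 - Real.log (r₀ / 50)) ≤
      ∫ x, sectorDensity p ν r₀ (logField d p) (fun x => ∑ k, logField 0 (a k) x) x := by
  set E : ℂ → ℂ := fun x => ∑ k, logField 0 (a k) x with hE
  have hEm : Measurable E := Finset.measurable_fun_sum _ fun j _ => measurable_logField 0 (a j)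
  obtain ⟨ρ, hEj⟩ := exists_norm_logField_le hΩ ha
  have hi : Integrable (sectorDensity p ν r₀ (logField d p) E) := by
    refine integrable_sectorDensity (A := n * ρ⁻¹) (measurable_logField d p) hEm
      (norm_logField_le_inv hd p) fun x h1 h2 => (norm_sum_le _ _).trans ?_
    have h3 : x ∉ Ω := hcone x (by linarith) (by
      have := mul_le_mul_of_nonneg_right cos_halfAngle_ge (norm_nonneg (x - p))
      linarith [norm_nonneg (x - p)])
    simpa using Finset.sum_le_card_nsmul Finset.univ _ _ fun j _ => hEj j x h3
  refine ⟨hi, ?_⟩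
  obtain ⟨-, h1, h2⟩ := integral_polarPt hi p hν
  rw [h2]
  set K := coreEnergy r₀ d
  have hKnn : 0 ≤ K := coreEnergy_nonneg hr₀.le
  set c₁ := 6 * R + 1 - Real.log (r₀ / 50)
  have hlog : Real.log (r₀ / 50) ≤ 0 := Real.log_nonpos (by positivity) (by linarith)
  have hc₁nn : 0 ≤ c₁ := by linarith
  have hpi := Real.pi_gt_d2
  have hpi' := Real.pi_lt_d2
  have hsub : Set.Ioo (-(139 / 100) : ℝ) (139 / 100) ⊆ Set.Ioo (-Real.pi) Real.pi :=
    Set.Ioo_subset_Ioo (by linarith) (by linarith)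
  set g : ℝ → ℝ := fun θ => -(1 / 2) * K +
    (Set.Ioo (-(139 / 100) : ℝ) (139 / 100)).indicator (fun _ => 3 / 2 * K - n * c₁) θ with hg
  have hgi1 : IntegrableOn (fun _ : ℝ => -(1 / 2) * K) (Set.Ioo (-Real.pi) Real.pi) :=
    integrableOn_const measure_Ioo_lt_top.ne
  have hgi2 : IntegrableOn ((Set.Ioo (-(139 / 100) : ℝ) (139 / 100)).indicator
      fun _ => 3 / 2 * K - n * c₁) (Set.Ioo (-Real.pi) Real.pi) :=
    (integrableOn_const measure_Ioo_lt_top.ne).indicator measurableSet_Ioo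
  have hgint : ∫ θ in Set.Ioo (-Real.pi) Real.pi, g θ =
      2 * Real.pi * (-(1 / 2) * K) + 2 * (139 / 100) * (3 / 2 * K - n * c₁) := by
    simp only [hg]
    rw [integral_add hgi1 hgi2, integral_const_circle, setIntegral_indicator measurableSet_Ioo,
      Set.inter_eq_self_of_subset_right hsub, setIntegral_const, smul_eq_mul, Measure.real,
      Real.volume_Ioo, ENNReal.toReal_ofReal (by norm_num)]
    ring
  have hle : ∫ θ in Set.Ioo (-Real.pi) Real.pi, g θ ≤ ∫ θ in Set.Ioo (-Real.pi) Real.pi,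
      ∫ ρ in Set.Ioi (0 : ℝ), ρ * sectorDensity p ν r₀ (logField d p) E (polarPt p ν θ ρ) := by
    refine setIntegral_mono_on (hgi1.add hgi2) h1 measurableSet_Ioo fun θ hθ => ?_
    rw [integral_sectorDensity_ray hr₀.le hν]
    have hiff := cos_lt_cos_iff_abs_lt (α := 139 / 100) ⟨by norm_num, by linarith⟩ hθ
    split_ifs with h
    · have h3 := coreEnergy_sub_le_integral_ray hR hΩR hp hr₀ hr₀1 hν hcone ha hd hdR hj
        (cos_halfAngle_ge.trans h.le)
      simp only [hg]
      have hmem : θ ∈ Set.Ioo (-(139 / 100) : ℝ) (139 / 100) := abs_lt.1 (hiff.1 h)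
      rw [Set.indicator_of_mem hmem]
      simp only [hE]
      linarith
    · simp only [hg]
      have hmem : θ ∉ Set.Ioo (-(139 / 100) : ℝ) (139 / 100) := fun h' => h (hiff.2 (abs_lt.2 h'))
      rw [Set.indicator_of_notMem hmem]
      linarith
  rw [hgint] at hle
  have h4 : 0 ≤ n * c₁ := by positivity
  -- with `α = 139 / 100` the balance is `(3 α - π) K - 2 α n c₁`, and `3 α - π ≥ 1`
  have h5 : 0 ≤ (3 * (139 / 100) - Real.pi - 1) * K := mul_nonneg (by linarith) hKnn
  linarith

/-- Testing at a boundary point `p` gains the core energy at the scale of the distance of `p` to a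
vortex. -/
lemma coreEnergy_sub_le_setIntegral_compl_sub {Ω : Set ℂ} (hΩ : IsOpen Ω) {R M : ℝ} {ζ : ℂ → ℝ}
    (hζ : IsPlateau R M ζ) (hR : 1 ≤ R)
    (hΩR : ∀ x ∈ Ω, ‖x‖ ≤ R - 1) {p ν : ℂ} (hp : ‖p‖ ≤ R - 1) {r₀ : ℝ} (hr₀ : 0 < r₀) (hr₀1 : r₀ ≤ 1)
    (hν : ‖ν‖ = 1)
    (hcone : ∀ x, ‖x - p‖ ≤ 2 * r₀ → ‖x - p‖ / 20 ≤ inner ℝ ν (x - p) → x ∉ Ω) {n : ℕ}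
    {a : Fin n → ℂ} (ha : ∀ k, a k ∈ Ω) {j : Fin n} {d : ℝ} (hd : 0 < d) (hdR : d ≤ 2 * R)
    (hj : ‖a j - p‖ = d) :
    coreEnergy r₀ d - 3 * n * (6 * R + 1 - Real.log (r₀ / 50)) -
        (volume : Measure ℂ).real (Metric.ball (0 : ℂ) (2 * R)) * ((1 / 2) * r₀⁻¹ ^ 2) ≤
      (∫ x in Ωᶜ, ζ x * ((1 / 2) * ‖∑ k, logField 0 (a k) x‖ ^ 2 +
        1 * inner ℝ (logField d p x) (∑ k, logField 0 (a k) x))) -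
      (1 / 2) * 1 ^ 2 * ∫ x in Ω, ‖logField d p x‖ ^ 2 := by
  obtain ⟨hi, hle⟩ := coreEnergy_sub_le_integral_sectorDensity hΩ hR hΩR hp hr₀ hr₀1 hν hcone ha hd
    hdR hj
  set E : ℂ → ℂ := fun x => ∑ k, logField 0 (a k) x
  set H : ℂ → ℂ := logField d p
  have hEm : Measurable E := Finset.measurable_fun_sum _ fun j _ => measurable_logField 0 (a j)
  have hHm : Measurable H := measurable_logField d p
  have hΩm := hΩ.measurableSet
  obtain ⟨ρ, hEj⟩ := exists_norm_logField_le hΩ ha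
  have hEb : ∀ x ∈ Ωᶜ, ‖E x‖ ≤ n * ρ⁻¹ := fun x hx => by
    refine (norm_sum_le _ _).trans ?_
    simpa using Finset.sum_le_card_nsmul Finset.univ _ _ fun j _ => hEj j x hx
  have hHb : ∀ x, ‖H x‖ ≤ d⁻¹ := norm_logField_le_inv hd p
  have iQ := integrableOn_plateau_mul hζ hΩm.compl hEm hHm hEb hHb 1
  have hΩb : Ω ⊆ Metric.ball 0 (2 * R) := fun x hx => by
    have := hΩR x hx
    rw [mem_ball_zero_iff]; linarith
  have iH : IntegrableOn (fun x => -(1 / 2) * ‖H x‖ ^ 2) Ω := by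
    refine IntegrableOn.mono_set (t := Metric.ball 0 (2 * R)) (Integrable.const_mul ?_ _) hΩb
    refine Measure.integrableOn_of_bounded (M := d⁻¹ ^ 2) (by finiteness)
      (hHm.norm.pow_const 2).aestronglyMeasurable (Eventually.of_forall fun x => ?_)
    rw [norm_pow, norm_norm]
    exact pow_le_pow_left₀ (norm_nonneg _) (hHb x) 2
  set Z : ℂ → ℝ := (Metric.ball (0 : ℂ) (2 * R)).indicator fun _ => (1 / 2) * r₀⁻¹ ^ 2 with hZ
  have iZ : Integrable Z :=
    IntegrableOn.integrable_indicator (integrableOn_const (by finiteness)) measurableSet_ball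
  have hfar : ∀ x, ¬ ‖x - p‖ < r₀ → (1 / 2) * ‖H x‖ ^ 2 ≤ (1 / 2) * r₀⁻¹ ^ 2 := fun x hx => by
    have h1 : ‖H x‖ ≤ r₀⁻¹ := (norm_logField_le d p x).trans (inv_anti₀ hr₀ (not_lt.1 hx))
    gcongr
  have hlow : ∀ x, -(1 / 2) * ‖H x‖ ^ 2 ≤ (1 / 2) * ‖E x‖ ^ 2 + 1 * inner ℝ (H x) (E x) := fun x => by
    have := sq_nonneg ‖H x + E x‖
    rw [norm_add_sq_real] at this
    linarith
  have hin : ∀ x ∈ Ω, sectorDensity p ν r₀ H E x - Z x ≤ -(1 / 2) * ‖H x‖ ^ 2 := by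
    intro x hx
    have hZx : Z x = (1 / 2) * r₀⁻¹ ^ 2 := Set.indicator_of_mem (hΩb hx) _
    have hZnn : 0 ≤ Z x := by rw [hZx]; positivity
    unfold sectorDensity
    split_ifs with h1 h2
    · refine absurd hx (hcone x (by linarith) ?_)
      have := mul_le_mul_of_nonneg_right cos_halfAngle_ge (norm_nonneg (x - p))
      linarith [norm_nonneg (x - p)]
    · linarith
    · linarith [hfar x h1]
  have hout : ∀ x ∈ Ωᶜ, sectorDensity p ν r₀ H E x - Z x ≤
      ζ x * ((1 / 2) * ‖E x‖ ^ 2 + 1 * inner ℝ (H x) (E x)) := by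
    intro x _
    have hZnn : 0 ≤ Z x := Set.indicator_nonneg (fun x _ => by positivity) x
    unfold sectorDensity
    by_cases h1 : ‖x - p‖ < r₀
    · have h2 : ζ x = 1 := by
        apply hζ.eq_one
        have := norm_sub_norm_le x p
        linarith
      rw [if_pos h1, h2]
      split_ifs with h3
      · linarith [sq_nonneg ‖E x‖]
      · linarith [hlow x]
    · rw [if_neg h1]
      by_cases hx : x ∈ Metric.ball (0 : ℂ) (2 * R)
      · have hZx : Z x = (1 / 2) * r₀⁻¹ ^ 2 := Set.indicator_of_mem hx _
        have h2 := hfar x h1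
        have h3 := mul_le_mul_of_nonneg_left (hlow x) (hζ.mem_Icc x).1
        have h4 : ζ x * ((1 / 2) * ‖H x‖ ^ 2) ≤ (1 / 2) * ‖H x‖ ^ 2 :=
          mul_le_of_le_one_left (by positivity) (hζ.mem_Icc x).2
        linarith
      · rw [hζ.eq_zero (by simpa using hx), zero_mul]
        linarith
  have hZint : ∫ x, Z x = (volume : Measure ℂ).real (Metric.ball (0 : ℂ) (2 * R)) *
      ((1 / 2) * r₀⁻¹ ^ 2) := by
    rw [hZ, integral_indicator measurableSet_ball, setIntegral_const, smul_eq_mul]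
  have iD := hi.sub iZ
  have e1 := integral_sub' hi iZ
  have e2 := integral_add_compl hΩm iD
  have e3 := setIntegral_mono_on iD.integrableOn iH hΩm hin
  have e4 := setIntegral_mono_on iD.integrableOn iQ hΩm.compl hout
  rw [integral_const_mul] at e3
  rw [hZint] at e1
  linarith

/-! ### Separation of the vortices -/

/-- The logarithms of the distances are bounded above, so that a single term of the self-interaction is
bounded by the whole. The sum includes the terms `j = k`, which are `log 0 = 0`. -/
lemma neg_log_sub_le_neg_pi_mul_sum {R : ℝ} (hR : 1 ≤ R) {n : ℕ} {a : Fin n → ℂ}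
    (haR : ∀ j, ‖a j‖ ≤ R - 1) :
    (-(2 * Real.pi * R) * (n : ℝ) ^ 2 ≤ -Real.pi * ∑ j, ∑ k, Real.log ‖a j - a k‖) ∧
    ∀ j k, j ≠ k → -Real.log ‖a j - a k‖ - (4 * Real.pi * R) * (n : ℝ) ^ 2 ≤
      -Real.pi * ∑ j, ∑ k, Real.log ‖a j - a k‖ := by
  have hlog : ∀ j k, Real.log ‖a j - a k‖ ≤ 2 * R := fun j k => by
    have h1 := Real.log_le_self (norm_nonneg (a j - a k))
    have h2 := norm_sub_le (a j) (a k)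
    linarith [haR j, haR k]
  have hpi := Real.pi_gt_three
  have hsumconst : ∑ _j : Fin n, ∑ _k : Fin n, 2 * R = 2 * R * (n : ℝ) ^ 2 := by simp; ring
  have h1 : ∑ j, ∑ k, Real.log ‖a j - a k‖ ≤ 2 * R * (n : ℝ) ^ 2 := by
    rw [← hsumconst]
    exact Finset.sum_le_sum fun j _ => Finset.sum_le_sum fun k _ => hlog j k
  refine ⟨by nlinarith, fun j₀ k₀ hjk => ?_⟩
  set D := 2 * R - Real.log ‖a j₀ - a k₀‖ with hD
  have hDnn : 0 ≤ D := by linarith [hlog j₀ k₀]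
  have h2 : D ≤ ∑ j, ∑ k, (2 * R - Real.log ‖a j - a k‖) := by
    have hnn : ∀ j k, 0 ≤ 2 * R - Real.log ‖a j - a k‖ := fun j k => by linarith [hlog j k]
    refine le_trans ?_ (Finset.single_le_sum (f := fun j => ∑ k, (2 * R - Real.log ‖a j - a k‖))
      (fun j _ => Finset.sum_nonneg fun k _ => hnn j k) (Finset.mem_univ j₀))
    exact Finset.single_le_sum (f := fun k => 2 * R - Real.log ‖a j₀ - a k‖) (fun k _ => hnn j₀ k)
      (Finset.mem_univ k₀)
  simp only [Finset.sum_sub_distrib] at h2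
  rw [hsumconst] at h2
  have hn : 0 ≤ R * (n : ℝ) ^ 2 := by positivity
  have h3 : D ≤ Real.pi * D := le_mul_of_one_le_left hDnn (by linarith)
  have h4 := mul_le_mul_of_nonneg_left h2 Real.pi_pos.le
  nlinarith

lemma norm_le_of_mem_closure {Ω : Set ℂ} {R : ℝ} (hΩR : ∀ x ∈ Ω, ‖x‖ ≤ R) {p : ℂ}
    (hp : p ∈ closure Ω) : ‖p‖ ≤ R := by
  have h1 : closure Ω ⊆ Metric.closedBall 0 R :=
    closure_minimal (fun x hx => by simpa using hΩR x hx) Metric.isClosed_closedBall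
  simpa using h1 hp

lemma exp_neg_le_of_neg_log_le {r c : ℝ} (hr : 0 < r) (h : -Real.log r ≤ c) : Real.exp (-c) ≤ r := by
  rw [← Real.le_log_iff_exp_le hr]; linarith

theorem mainTheorem8 (Ω : Set ℂ) (hΩ : IsSmoothSimplyConnectedDomain Ω) (h0 : (0 : ℂ) ∈ Ω)
    (φ : ℂ → ℝ) (hφ : IsC2OnBoundary Ω φ) :
    ∃ C : ℝ, ∀ (n : ℕ), 1 ≤ n → ∀ a : Fin n → ℂ, IsConfiguration Ω a →
      ∀ u : ℂ → ℂ, IsCanonicalHarmonicMap Ω φ a u →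
        ∃ W : ℝ, IsRenormalizedEnergy Ω a u W ∧
          Real.exp (-W - C * (n : ℝ) ^ 2) ≤ vortexSeparation Ω a := by
  obtain ⟨R', hR'⟩ := hΩ.isBounded.exists_norm_le
  have hR'0 : 0 ≤ R' := by simpa using hR' 0 h0
  set R := R' + 1 with hRdef
  have hR : 1 ≤ R := by linarith
  have hΩR : ∀ x ∈ Ω, ‖x‖ ≤ R - 1 := fun x hx => (hR' x hx).trans (by linarith)
  have hc : IsPreconnected Ω := by
    have := hΩ.simplyConnected
    exact isPreconnected_iff_preconnectedSpace.2 inferInstance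
  have hfront : (frontier Ω).Nonempty := by
    rw [nonempty_frontier_iff]
    refine ⟨⟨0, h0⟩, fun h => ?_⟩
    have := hΩR R (h ▸ Set.mem_univ _)
    rw [Complex.norm_real, Real.norm_of_nonneg (by linarith)] at this
    linarith
  obtain ⟨ζ, M, hζ⟩ := exists_isPlateau (show 0 < R by linarith)
  obtain ⟨C₀, hC₀⟩ := exists_le_renormalizedEnergy hΩ.isOpen hc h0 hζ hR hΩR hφ
  obtain ⟨r₀, hr₀, hr₀1, hcone⟩ := exists_exterior_cone hΩ
  set c₁ := 6 * R + 1 - Real.log (r₀ / 50) with hc₁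
  set c₂ := (volume : Measure ℂ).real (Metric.ball (0 : ℂ) (2 * R)) * ((1 / 2) * r₀⁻¹ ^ 2) with hc₂
  have hlog : Real.log (r₀ / 50) ≤ 0 := Real.log_nonpos (by positivity) (by linarith)
  have hlogr : Real.log r₀ ≤ 0 := Real.log_nonpos hr₀.le hr₀1
  have hc₁nn : 0 ≤ c₁ := by linarith
  have hc₂nn : 0 ≤ c₂ := by positivity
  refine ⟨4 * Real.pi * R + C₀ + 3 * c₁ + c₂ + 1 / 2 - Real.log r₀ + Real.log 4,
    fun n hn a ha u hu => ?_⟩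
  obtain ⟨W, hW, hest⟩ := hC₀ n hn a ha u hu
  refine ⟨W, hW, ?_⟩
  have hn1 : (1 : ℝ) ≤ n := by exact_mod_cast hn
  have hn2 : (1 : ℝ) ≤ (n : ℝ) ^ 2 := one_le_pow₀ hn1
  have hnn2 : (n : ℝ) ≤ (n : ℝ) ^ 2 := by nlinarith
  have hlog4 : 0 ≤ Real.log 4 := Real.log_nonneg (by norm_num)
  have haR : ∀ j, ‖a j‖ ≤ R - 1 := fun j => hΩR _ (ha.2 j)
  obtain ⟨hself, hpair⟩ := neg_log_sub_le_neg_pi_mul_sum hR haR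
  -- all constants are absorbed in `C n²`
  have habs : ∀ t, t ≤ W + (4 * Real.pi * R + C₀) * (n : ℝ) ^ 2 + 3 * n * c₁ + c₂ + 1 / 2 - Real.log r₀ →
      t + Real.log 4 ≤ W + (4 * Real.pi * R + C₀ + 3 * c₁ + c₂ + 1 / 2 - Real.log r₀ + Real.log 4) *
        (n : ℝ) ^ 2 := by
    intro t ht
    have h1 := mul_le_mul_of_nonneg_left hnn2 hc₁nn
    have h2 := mul_le_mul_of_nonneg_left hn2
      (show 0 ≤ c₂ + 1 / 2 - Real.log r₀ + Real.log 4 by linarith)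
    linarith
  have hmain : ∀ r : ℝ, 0 < r →
      -Real.log r ≤ W + (4 * Real.pi * R + C₀) * (n : ℝ) ^ 2 + 3 * n * c₁ + c₂ + 1 / 2 - Real.log r₀ →
      Real.exp (-W - (4 * Real.pi * R + C₀ + 3 * c₁ + c₂ + 1 / 2 - Real.log r₀ + Real.log 4) *
        (n : ℝ) ^ 2) ≤ 1 / 4 * r := by
    intro r hr h
    rw [← neg_add']
    refine exp_neg_le_of_neg_log_le (by positivity) ?_
    rw [Real.log_mul (by norm_num) hr.ne', one_div, Real.log_inv]
    linarith [habs _ h]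
  have hfree : 0 ≤ 3 * n * c₁ + c₂ + 1 / 2 - Real.log r₀ := by
    have : 0 ≤ n * c₁ := by positivity
    linarith
  set X := Real.exp (-W - (4 * Real.pi * R + C₀ + 3 * c₁ + c₂ + 1 / 2 - Real.log r₀ + Real.log 4) *
        (n : ℝ) ^ 2) with hX
  have hinf : 4 * X ≤ sInf ({r | ∃ j k, j ≠ k ∧ r = dist (a j) (a k)} ∪
      {r | ∃ j, r = Metric.infDist (a j) (frontier Ω)}) := by
    refine le_csInf ⟨_, Or.inr ⟨⟨0, hn⟩, rfl⟩⟩ ?_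
    rintro r (⟨j, k, hjk, rfl⟩ | ⟨j, rfl⟩)
    · -- distinct vortices: no test potential
      have hpos : 0 < dist (a j) (a k) := dist_pos.2 fun h => hjk (ha.1 h)
      have h1 := hest 0 ⟨le_rfl, zero_le_one⟩ 1 one_pos (by linarith) 0 (by rw [norm_zero]; linarith)
      have h2 : 0 ≤ ∫ x in Ωᶜ, ζ x * ((1 / 2) * ‖∑ j, logField 0 (a j) x‖ ^ 2 +
          0 * inner ℝ (logField 1 0 x) (∑ j, logField 0 (a j) x)) :=
        integral_nonneg fun x => mul_nonneg (hζ.mem_Icc x).1 (by rw [zero_mul]; positivity)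
      have h3 := hpair j k hjk
      have := hmain _ hpos (by rw [dist_eq_norm]; linarith)
      linarith
    · -- a vortex and the boundary: test with a potential centred at the nearest boundary point
      have hK : IsCompact (frontier Ω) :=
        Metric.isCompact_of_isClosed_isBounded isClosed_frontier
          (hΩ.isBounded.closure.subset frontier_subset_closure)
      obtain ⟨p, hp, hpd⟩ := hK.exists_infDist_eq_dist hfront (a j)
      have hpR : ‖p‖ ≤ R - 1 := norm_le_of_mem_closure hΩR (frontier_subset_closure hp)
      have hpΩ : p ∉ Ω := by rw [hΩ.isOpen.frontier_eq] at hp; exact hp.2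
      rw [hpd]
      have hpos : 0 < dist (a j) p := dist_pos.2 fun h => hpΩ (h ▸ ha.2 j)
      have hdR : dist (a j) p ≤ 2 * R := by
        rw [dist_eq_norm]
        linarith [norm_sub_le (a j) p, haR j]
      obtain ⟨ν, hν, hcn⟩ := hcone p hp
      have h1 := hest 1 ⟨zero_le_one, le_rfl⟩ (dist (a j) p) hpos hdR p hpR
      have h2 := coreEnergy_sub_le_setIntegral_compl_sub hΩ.isOpen hζ hR hΩR hpR hr₀ hr₀1 hν hcn ha.2
        hpos hdR (dist_eq_norm (a j) p).symm
      have h3 := log_sub_log_le_coreEnergy hr₀ hpos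
      have h4 : 0 ≤ Real.pi * R * (n : ℝ) ^ 2 := by positivity
      have := hmain _ hpos (by linarith)
      linarith
  rw [vortexSeparation]
  linarith
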